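/- **Setting.** A symmetric convex body $K\subseteq\mathbb R^n$ ($n\ge 1$) is a compact convex set with non-empty interior and $K=-K$; $\|x\|_K$ is its gauge. For an $n$-dimensional lattice $L$ put $\lambda_1(K,L)=\inf_{y\in L\setminus\{0\}}\|y\|_K$, $d_K(L,x)=\min_{y\in L}\|y-x\|_K$, $\mu(K,L)=\inf\{s\ge 0: L+sK=\mathbb R^n\}$. $L$ is *$K$-covering* if $\mu(K,L)\le 1$ and *$\alpha$-thin* if $\mathrm{vol}_n(K)/\det L\le\alpha$; its packing density is $\mathrm{vol}_n(\tfrac{\lambda_1}{2}K)/\det L$. For a basis $B=(b_1,\dots,b_n)$ of $L$ let $\pi_i$ be the orthogonal projection onto $\mathrm{span}(b_1,\dots,b_{i-1})^\perp$; $K$ is *$\alpha$-SE* with respect to $B$ if $|\pi_i(K+t)\cap\pi_i(L)|\le\alpha$ for all $i$ and all $t\in\mathbb R^n$. A basis $B'$ is *directional* with respect to $B$ if $\mathrm{span}(b'_1,\dots,b'_i)=\mathrm{span}(b_1,\dots,b_i)$ for all $i$. $N(A,D)$ is the least number of translates of $D$ that cover $A$. Let $c\ge 5$ be a constant. Let $L$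 be a lattice with basis $B$ such that $2^{n+1}\det L\le\mathrm{vol}_n(K)$ and $N(K,B[-\frac12,\frac12)^n)\le c^n$. Let $M\subseteq L$ be a sublattice with $[L:M]\le 2c^n$, with a basis $B_M$ that is directional with respect to $B$, such that $1\le\lambda_1(K,M)\le c$, $K$ is $c^n$-SE with respect to $B_M$, and $M$ has packing density at least $c^{-n}$ with respect to $K$. *Rogers' densification* of $M$: as long as the current lattice $M'$ has a point $x$ with $3x\in M'$ and $d_K(M',x)>\lambda_1(K,M')$, choose one and replace $M'$ by $M'+\mathbb Zx$; stop when there is none. **Statement.** (I) Every lattice $\Lambda$ at which the densification of $M$ stops contains $M$ and satisfies 1. $\lambda_1(K,M)=\lambda_1(K,\Lambda)=:\lambda$, 2. $\mu(K,\Lambda)\le\frac32\lambda\le\frac{3c}2$, 3. $[\Lambda:M]\le c^n$, and moreover (a) $\frac{2}{3\lambda}\Lambda$ is a $3^n$-thin $K$-covering lattice; (b) $K$ is $\tilde O((2c^3)^n)$-SE with respect to $\frac2{3\lambda}\Lambda$ with the basis $\frac2{3\lambda}B_\Lambda$, for every basis $B_\Lambda$ of $\Lambda$ that is directional with respect to $B_M$.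 (II) There is one deterministic program that, for all such $n,K,L,B,M,B_M$, computes such a $\Lambda$ by a basis $B_\Lambda=B_MX$ ($X$ a rational matrix) that is directional with respect to $B_M$, together with a vector $v\in M\setminus\{0\}$ with $\|v\|_K=\lambda$, in time $\tilde O((2c^3)^n)$ and $\mathrm{poly}(n)$ space. Here $\tilde O(T)$ means at most $C\,T(\log T)^k$, with $C,k$ depending only on $c$. The program runs on a random access machine with integer memory cells. Time is the number of arithmetic operations, memory accesses, comparisons and oracle calls, each of cost one. Space is poly(n) in the sense that at most $Cn^k$ cells are ever used, each holding at most $C(n+\log(2+R))^k$ bits, where $R$ is any positive integer with $K\subseteq B_M[-R,R]^n$. The machine is given $n$, and it has exact access to $K$ in coordinates with respect to $B_M$: for rational coordinate vectors $u,v$, a rational $r$ and $0\le j\le n$, one oracle call decides whether there are real $w_1,\dots,w_j$ with $\|B_M(w_1,\dots,w_j,u_{j+1},\dots,u_n)\|_K\le\|B_Mv\|_K+r$ (that is, membership in the projection along $b_1,\dots,b_j$ of a dilate of $K$), and if so and $j\ge1$ it returns $\lfloor D w_j\rfloor$ for some such $w$, where $D$ is the common denominator used in the query. -/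

import Mathlib

open scoped Pointwise

noncomputable section

namespace ThinLattice

/-- Euclidean space `ℝⁿ`. -/
abbrev E (n : ℕ) : Type := EuclideanSpace ℝ (Fin n)

/-! ## Convex bodies and lattices -/

/-- A symmetric convex body: compact, convex, with non-empty interior, and `K = -K`. -/
structure IsSymmetricConvexBody {n : ℕ} (K : Set (E n)) : Prop where
  compact : IsCompact K
  convex : Convex ℝ K
  interior_nonempty : (interior K).Nonempty
  symmetric : -K = K

/-- The lattice `ℒ(B)` of integer combinations of `b₁, …, bₙ`. -/
def lat {n : ℕ} (b : Fin n → E n) : Submodule ℤ (E n) :=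
  Submodule.span ℤ (Set.range b)

/-- The half-open parallelepiped `B[-1/2,1/2)ⁿ`. -/
def parallelepiped {n : ℕ} (b : Fin n → E n) : Set (E n) :=
  {x | ∃ a : Fin n → ℝ, (∀ i, a i ∈ Set.Ico (-(1 / 2) : ℝ) (1 / 2)) ∧ x = ∑ i, a i • b i}

/-- `N(A, D) ≤ α`: the set `A` is covered by at most `α` translates of `D`. -/
def CoveringNumberLE {n : ℕ} (A D : Set (E n)) (α : ℝ) : Prop :=
  ∃ T : Finset (E n), A ⊆ (T : Set (E n)) + D ∧ (T.card : ℝ) ≤ α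

/-- The distance `d_K(L, x)` from `x` to the lattice in the norm with unit ball `K`. -/
def latDist {n : ℕ} (K : Set (E n)) (L : Submodule ℤ (E n)) (x : E n) : ℝ :=
  sInf ((fun y => gauge K (y - x)) '' (L : Set (E n)))

/-- The minimum distance `λ₁(K, L)`. -/
def minDist {n : ℕ} (K : Set (E n)) (L : Submodule ℤ (E n)) : ℝ :=
  sInf (gauge K '' ((L : Set (E n)) \ {0}))

/-- The covering radius `μ(K, L)`. -/
def covRadius {n : ℕ} (K : Set (E n)) (L : Submodule ℤ (E n)) : ℝ :=
  sInf {s : ℝ | 0 ≤ s ∧ (L : Set (E n)) + s • K = Set.univ}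

/-- The volume `volₙ(A)` as a real number. -/
def vol {n : ℕ} (A : Set (E n)) : ℝ := (MeasureTheory.volume A).toReal

/-- The determinant of a lattice. -/
def latDet {n : ℕ} (L : Submodule ℤ (E n)) : ℝ := ZLattice.covolume L

/-- The index `[L : M]`, for `M ≤ L`. -/
def index {n : ℕ} (L M : Submodule ℤ (E n)) : ℕ :=
  M.toAddSubgroup.relIndex L.toAddSubgroup

/-- `L` is `K`-covering. -/
def IsCovering {n : ℕ} (K : Set (E n)) (L : Submodule ℤ (E n)) : Prop :=
  covRadius K L ≤ 1

/-- `L` is `α`-thin with respect to `K`. -/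
def IsThin {n : ℕ} (K : Set (E n)) (L : Submodule ℤ (E n)) (α : ℝ) : Prop :=
  vol K / latDet L ≤ α

/-- The packing density `volₙ((λ₁/2) K) / det L`. -/
def packingDensity {n : ℕ} (K : Set (E n)) (L : Submodule ℤ (E n)) : ℝ :=
  vol ((minDist K L / 2) • K) / latDet L

/-- The Gram-Schmidt projection: orthogonal projection along the `bⱼ` with `j < i`. -/
def gsProj {n : ℕ} (b : Fin n → E n) (i : Fin n) : E n → E n :=
  fun x => (Submodule.span ℝ (b '' Set.Iio i))ᗮ.starProjection x

/-- `K` is `α`-Schnorr-Euchner enumerable with respect to the basis `b` of `lat b`. -/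
def IsSE {n : ℕ} (K : Set (E n)) (b : Fin n → E n) (α : ℝ) : Prop :=
  ∀ (i : Fin n) (t : E n),
    (gsProj b i '' (K + {t}) ∩ gsProj b i '' (lat b : Set (E n))).Finite ∧
    ((gsProj b i '' (K + {t}) ∩ gsProj b i '' (lat b : Set (E n))).ncard : ℝ) ≤ α

/-- `b` is a basis of the full-rank lattice `L`, directional with respect to `v₁, …, vₙ`. -/
structure IsDirectionalBasis {n : ℕ} (b : Fin n → E n) (L : Submodule ℤ (E n))
    (v : Fin n → E n) : Prop where
  linearIndependent : LinearIndependent ℝ b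
  lat_eq : lat b = L
  span_eq : ∀ i : Fin n, Submodule.span ℝ (b '' Set.Iic i) = Submodule.span ℝ (v '' Set.Iic i)

/-- The lattice `L = lat b` is an M-lattice of `K` with constant `c`. -/
structure IsMLattice {n : ℕ} (K : Set (E n)) (c : ℝ) (b : Fin n → E n) : Prop where
  linearIndependent : LinearIndependent ℝ b
  det_le : 2 ^ (n + 1) * latDet (lat b) ≤ vol K
  covering : CoveringNumberLE K (parallelepiped b) (c ^ n)

/-- `M = lat bM` is a sparsified sublattice ("packing lattice") of the M-lattice `lat b`. -/
structure IsPackingLattice {n : ℕ} (K : Set (E n)) (c : ℝ) (b bM : Fin n → E n) : Prop where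
  le : lat bM ≤ lat b
  index_le : (index (lat b) (lat bM) : ℝ) ≤ 2 * c ^ n
  directional : IsDirectionalBasis bM (lat bM) b
  one_le_minDist : 1 ≤ minDist K (lat bM)
  minDist_le : minDist K (lat bM) ≤ c
  se : IsSE K bM (c ^ n)
  density : (c ^ n)⁻¹ ≤ packingDensity K (lat bM)

/-! ## Rogers' densification -/

/-- One step of the greedy procedure: adjoin some `x ∈ L/3` with `d_K(L, x) > λ₁(K, L)`. -/
def RogersStep {n : ℕ} (K : Set (E n)) (L L' : Submodule ℤ (E n)) : Prop :=
  ∃ x : E n, (3 : ℤ) • x ∈ L ∧ minDist K L < latDist K L x ∧ L' = L ⊔ Submodule.span ℤ {x}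

/-- `Λ` is a possible final lattice of the greedy procedure started at `M`: it is reached by
finitely many steps, and no further step is possible. -/
def IsRogersOutput {n : ℕ} (K : Set (E n)) (M Λ : Submodule ℤ (E n)) : Prop :=
  Relation.ReflTransGen (RogersStep K) M Λ ∧ ∀ Λ', ¬ RogersStep K Λ Λ'

/-! ## Exact access to the convex body

Vectors are given by their rational coordinates, with a common denominator, with respect to the
basis `bM`. -/

/-- An oracle query. With `u = point / den`, `v = ref / den` and `ρ = ‖v‖_K + rad / den`, it asks
whether some real vector with coordinates `(w₁, …, w_j, u_{j+1}, …, uₙ)` lies in `ρ K`, where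
`j = level`. In other words: does the projection of `u` along `b₁, …, b_j` lie in the projection
of `ρ K`. For `j = 0` this is membership of `u` in `ρ K`. -/
structure Query (n : ℕ) where
  level : ℕ
  den : ℕ
  rad : ℤ
  point : Fin n → ℤ
  ref : Fin n → ℤ

/-- The vector with the given coordinates with respect to `b`. -/
def comb {n : ℕ} (b : Fin n → E n) (w : Fin n → ℝ) : E n := ∑ i, w i • b i

/-- `w` is a solution of the query `q`. -/
def Query.IsSolution {n : ℕ} (K : Set (E n)) (b : Fin n → E n) (q : Query n)
    (w : Fin n → ℝ) : Prop :=
  (∀ i : Fin n, q.level ≤ (i : ℕ) → w i = (q.point i : ℝ) / q.den) ∧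
  gauge K (comb b w) ≤
    gauge K (comb b (fun i => (q.ref i : ℝ) / q.den)) + (q.rad : ℝ) / q.den

/-- `O` answers well-formed queries correctly: `none` if there is no solution; if there is one,
the answer is `some z`, where `z = ⌊den * w_j⌋` for the last free coordinate `w_j` of some
solution `w` (`z = 0` if there is no free coordinate). -/
def IsOracle {n : ℕ} (K : Set (E n)) (b : Fin n → E n) (O : Query n → Option ℤ) : Prop :=
  ∀ q : Query n, q.level ≤ n → 0 < q.den →
    (O q = none → ∀ w, ¬ q.IsSolution K b w) ∧
    (∀ z : ℤ, O q = some z → ∃ w, q.IsSolution K b w ∧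
      (q.level = 0 → z = 0) ∧
      (∀ j : Fin n, (j : ℕ) + 1 = q.level → z = ⌊(q.den : ℝ) * w j⌋))

/-! ## A random access machine with oracle -/

/-- The memory: cells indexed by natural numbers, holding integers. -/
abbrev Mem : Type := ℕ → ℤ

/-- Arithmetic expressions; `load a` is the content of the cell with address `a`. -/
inductive Arith : Type
  | lit (z : ℤ)
  | load (a : Arith)
  | add (a₁ a₂ : Arith)
  | sub (a₁ a₂ : Arith)
  | mul (a₁ a₂ : Arith)
  | div (a₁ a₂ : Arith)

/-- The value of an expression (`div` is integer division). -/
def Arith.value : Arith → Mem → ℤ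
  | .lit z, _ => z
  | .load a, m => m (a.value m).toNat
  | .add a₁ a₂, m => a₁.value m + a₂.value m
  | .sub a₁ a₂, m => a₁.value m - a₂.value m
  | .mul a₁ a₂, m => a₁.value m * a₂.value m
  | .div a₁ a₂, m => a₁.value m / a₂.value m

/-- The number of operations needed to evaluate an expression. -/
def Arith.cost : Arith → ℕ
  | .lit _ => 1
  | .load a => a.cost + 1
  | .add a₁ a₂ => a₁.cost + a₂.cost + 1
  | .sub a₁ a₂ => a₁.cost + a₂.cost + 1
  | .mul a₁ a₂ => a₁.cost + a₂.cost + 1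
  | .div a₁ a₂ => a₁.cost + a₂.cost + 1

/-- Programs. `ite a₁ a₂` and `loop a₁ a₂` test the condition `a₁ ≤ a₂`. -/
inductive Prog : Type
  | store (a e : Arith)
  | ask (a : Arith)
  | seq (p₁ p₂ : Prog)
  | ite (a₁ a₂ : Arith) (p₁ p₂ : Prog)
  | loop (a₁ a₂ : Arith) (p : Prog)

/-- The query stored in memory from address `p` on. -/
def readQuery (n : ℕ) (m : Mem) (p : ℕ) : Query n where
  level := (m p).toNat
  den := (m (p + 1)).toNat
  rad := m (p + 2)
  point := fun i => m (p + 3 + i)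
  ref := fun i => m (p + 3 + n + i)

/-- The answer overwrites the first two cells of the query: a flag, and the value if any. -/
def writeAnswer (m : Mem) (p : ℕ) : Option ℤ → Mem
  | none => Function.update m p 0
  | some z => Function.update (Function.update m p 1) (p + 1) z

/-- The memory fits into the first `N` cells, each holding an integer of at most `W` bits. -/
def Fits (N W : ℕ) (m : Mem) : Prop :=
  (∀ a, N ≤ a → m a = 0) ∧ ∀ a, |m a| < 2 ^ W

/-- `Run O N W p m m' t`: started with memory `m`, the program `p` halts with memory `m'` after
`t` operations and oracle calls, and its memory always fits into `N` cells of `W` bits. -/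
inductive Run {n : ℕ} (O : Query n → Option ℤ) (N W : ℕ) : Prog → Mem → Mem → ℕ → Prop
  | store (a e : Arith) (m : Mem)
      (hm : Fits N W m)
      (hm' : Fits N W (Function.update m (a.value m).toNat (e.value m))) :
      Run O N W (.store a e) m (Function.update m (a.value m).toNat (e.value m))
        (a.cost + e.cost + 1)
  | ask (a : Arith) (m : Mem)
      (hm : Fits N W m)
      (hm' : Fits N W (writeAnswer m (a.value m).toNat (O (readQuery n m (a.value m).toNat)))) :
      Run O N W (.ask a) m
        (writeAnswer m (a.value m).toNat (O (readQuery n m (a.value m).toNat))) (a.cost + 1)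
  | seq (p₁ p₂ : Prog) (m₁ m₂ m₃ : Mem) (t₁ t₂ : ℕ)
      (h₁ : Run O N W p₁ m₁ m₂ t₁) (h₂ : Run O N W p₂ m₂ m₃ t₂) :
      Run O N W (.seq p₁ p₂) m₁ m₃ (t₁ + t₂)
  | ite_pos (a₁ a₂ : Arith) (p₁ p₂ : Prog) (m m' : Mem) (t : ℕ)
      (h : a₁.value m ≤ a₂.value m) (h₁ : Run O N W p₁ m m' t) :
      Run O N W (.ite a₁ a₂ p₁ p₂) m m' (a₁.cost + a₂.cost + 1 + t)
  | ite_neg (a₁ a₂ : Arith) (p₁ p₂ : Prog) (m m' : Mem) (t : ℕ)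
      (h : ¬ a₁.value m ≤ a₂.value m) (h₂ : Run O N W p₂ m m' t) :
      Run O N W (.ite a₁ a₂ p₁ p₂) m m' (a₁.cost + a₂.cost + 1 + t)
  | loop_stop (a₁ a₂ : Arith) (p : Prog) (m : Mem)
      (hm : Fits N W m) (h : ¬ a₁.value m ≤ a₂.value m) :
      Run O N W (.loop a₁ a₂ p) m m (a₁.cost + a₂.cost + 1)
  | loop_step (a₁ a₂ : Arith) (p : Prog) (m m' m'' : Mem) (t t' : ℕ)
      (h : a₁.value m ≤ a₂.value m) (h₁ : Run O N W p m m' t)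
      (h₂ : Run O N W (.loop a₁ a₂ p) m' m'' t') :
      Run O N W (.loop a₁ a₂ p) m m'' (a₁.cost + a₂.cost + 1 + t + t')

/-- The initial memory: the dimension `n` in cell `0`, and zeros. -/
def initMem (n : ℕ) : Mem := fun a => if a = 0 then (n : ℤ) else 0

/-- The basis read off the final memory: cell `0` holds a common denominator, the next `n²` cells
hold the numerators of the coordinates of the vectors with respect to `b` (row by row, one vector
in each column). -/
def outBasis {n : ℕ} (b : Fin n → E n) (m : Mem) : Fin n → E n :=
  fun j => comb b (fun i => (m (1 + i * n + j) : ℝ) / (m 0 : ℝ))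

/-- The vector read off the next `n` cells of the final memory (integer coordinates with respect
to `b`). -/
def outVector {n : ℕ} (b : Fin n → E n) (m : Mem) : E n :=
  comb b (fun i => (m (1 + n * n + i) : ℝ))

/-- `T (log T)^k`, up to the constant factor `C`. -/
def softO (C k : ℕ) (T : ℝ) : ℝ := C * T * Real.log T ^ k

end ThinLattice

end

/-! Write λ for the minimum distance of M. Part (I) is a volume argument. A densification step
adjoins x with 3x in M', so the new points lie in the cosets M' + x and M' - x, where all norms
exceed λ; hence λ never changes (`RogersStep.minDist_eq`). Minkowski's theorem
(`minDist_pow_mul_vol_le`) bounds the determinant of every lattice so reached from below by (λ/2)^n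
vol K. Against the packing density of M this gives the index bound c^n (`index_le_pow`), and after
rescaling it is exactly the thinness. If no step is possible, every point of Λ/3 is within λ of Λ.
Let δ be the supremum of the distances to Λ: approximating 3x by y in Λ and then y/3 by another
lattice point gives δ ≤ λ + δ/3, so δ ≤ 3λ/2 (`latDist_le_of_third`). For the enumeration bound,
copies of K placed around lifted points of a projection overlap at most α times and fill at most the
volume of (r+1)K, so translates of rK contain at most α(r+1)^n projected points of M
(`card_le_of_se`); going from M to Λ costs the index (`card_le_of_se_of_index`).

For part (II), each non-zero class of Λ/3 modulo Λ has, up to sign, a representative (b_j + Σ_{i<j}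
z_i b_i)/3 with digits z_i (`mem_or_exists_thirdVec`). Adjoining it replaces only b_j, so the basis
stays directional and its matrix triangular. A class is tested by enumerating its points in the ball
of radius λ by depth first search. With the later coordinates fixed and the earlier ones free, the
values of one coordinate in the ball form an interval; so feasible siblings are consecutive, and the
rounded coordinate returned by the oracle tells where to look for them. The number λ is never
computed: a shortest vector of M, found once by enumerations with integer radii, serves as reference
in all later queries.

The M-lattice gives the sharper index bound (c/λ)^n (`index_le_div_pow`). Its denominator cancels
the growth (λ+1)^n ≤ (2λ)^n of the enumeration, which leaves (2c²)^n nodes per level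
(`Setup.count_of_eq`). Every extension at least triples the index, so there are O(n) of them, each
followed by a fresh pass over fewer than 3^n classes; and 3 · 2c² ≤ 2c³. The same index bound keeps
the common denominator below c^n, and the free coordinates are reduced modulo it, so all numbers
stay short.

The program is verified with a calculus of total correctness, `Wp`, that carries time and space
along. Its main statements are `EnumEnv.wp_searchP` for the depth first search, `wp_svpP` for the
shortest vector, and `Setup.wp_classP` with `Setup.wp_classesP` for the densification loop. -/

namespace ThinLattice

open MeasureTheory Module

variable {n : ℕ} {K : Set (E n)}

/-! ## The gauge of a symmetric convex body -/

namespace IsSymmetricConvexBody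

lemma neg_mem (hK : IsSymmetricConvexBody K) {x : E n} (hx : x ∈ K) : -x ∈ K := by
  rw [← Set.mem_neg, hK.symmetric]; exact hx

/-- The interior is symmetric as well, so the origin is the midpoint of two interior points. -/
lemma mem_nhds_zero (hK : IsSymmetricConvexBody K) : K ∈ nhds (0 : E n) := by
  obtain ⟨x, hx⟩ := hK.interior_nonempty
  have hx' : -x ∈ interior K := by
    have h : interior K = -interior K := by
      conv_lhs => rw [← hK.symmetric]
      exact ((Homeomorph.neg (E n)).preimage_interior K).symm
    rw [← Set.mem_neg, ← h]; exact hx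
  have := hK.convex.interior hx hx' (by norm_num : (0 : ℝ) ≤ 1 / 2) (by norm_num) (by norm_num :
    (1 / 2 : ℝ) + 1 / 2 = 1)
  rw [smul_neg, add_neg_cancel] at this
  exact mem_interior_iff_mem_nhds.1 this

lemma absorbent (hK : IsSymmetricConvexBody K) : Absorbent ℝ K :=
  absorbent_nhds_zero hK.mem_nhds_zero

lemma gauge_neg (hK : IsSymmetricConvexBody K) (x : E n) : gauge K (-x) = gauge K x :=
  _root_.gauge_neg (fun _ => hK.neg_mem) x

lemma gauge_sub_comm (hK : IsSymmetricConvexBody K) (x y : E n) :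
    gauge K (x - y) = gauge K (y - x) := by
  rw [← hK.gauge_neg, neg_sub]

lemma gauge_add_le (hK : IsSymmetricConvexBody K) (x y : E n) :
    gauge K (x + y) ≤ gauge K x + gauge K y :=
  _root_.gauge_add_le hK.convex hK.absorbent x y

lemma gauge_smul (hK : IsSymmetricConvexBody K) (a : ℝ) (x : E n) :
    gauge K (a • x) = |a| * gauge K x := by
  rcases le_total 0 a with h | h
  · rw [gauge_smul_of_nonneg h, abs_of_nonneg h, smul_eq_mul]
  · rw [← hK.gauge_neg, ← neg_smul, gauge_smul_of_nonneg (by linarith), abs_of_nonpos h,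
      smul_eq_mul]

lemma gauge_pos (hK : IsSymmetricConvexBody K) {x : E n} (hx : x ≠ 0) : 0 < gauge K x :=
  (_root_.gauge_pos hK.absorbent
    (NormedSpace.isVonNBounded_of_isBounded ℝ hK.compact.isBounded)).2 hx

lemma gauge_le_iff (hK : IsSymmetricConvexBody K) {r : ℝ} (hr : 0 < r) {x : E n} :
    gauge K x ≤ r ↔ x ∈ r • K := by
  have h : gauge K x ≤ r ↔ gauge K (r⁻¹ • x) ≤ 1 := by
    rw [hK.gauge_smul, abs_of_pos (inv_pos.2 hr), inv_mul_le_iff₀ hr, mul_one]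
  rw [h, gauge_le_one_iff_mem_closure hK.convex hK.mem_nhds_zero,
    hK.compact.isClosed.closure_eq, Set.mem_smul_set_iff_inv_smul_mem₀ hr.ne']

lemma gauge_le_one_iff (hK : IsSymmetricConvexBody K) {x : E n} : gauge K x ≤ 1 ↔ x ∈ K := by
  rw [hK.gauge_le_iff one_pos, one_smul]

lemma continuous_gauge (hK : IsSymmetricConvexBody K) : Continuous (gauge K) :=
  _root_.continuous_gauge hK.convex hK.mem_nhds_zero

lemma isBounded_gauge_le (hK : IsSymmetricConvexBody K) (r : ℝ) :
    Bornology.IsBounded {x : E n | gauge K x ≤ r} := by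
  refine (hK.compact.smul (max r 1)).isBounded.subset fun x hx => ?_
  exact (hK.gauge_le_iff (lt_max_of_lt_right one_pos)).1 (le_max_of_le_left hx)

lemma vol_pos (hK : IsSymmetricConvexBody K) : 0 < vol K :=
  ENNReal.toReal_pos (Measure.measure_pos_of_mem_nhds _ hK.mem_nhds_zero).ne'
    hK.compact.measure_lt_top.ne

end IsSymmetricConvexBody

/-! ### Volumes and overlapping translates -/

lemma vol_smul {r : ℝ} (hr : 0 ≤ r) (A : Set (E n)) : vol (r • A) = r ^ n * vol A := by
  rw [vol, vol, Measure.addHaar_smul_of_nonneg _ hr, ENNReal.toReal_mul,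
    ENNReal.toReal_ofReal (by positivity)]
  simp

/-- Double counting: integrate over z the number of translates `f p + A` that contain z. The
integrand is at most N on B and vanishes outside B. -/
lemma mul_measure_le_of_overlap_le {ι : Type*} (S : Finset ι) (f : ι → E n) {A B : Set (E n)}
    (hA : MeasurableSet A) (hB : MeasurableSet B) (N : ℕ)
    (hsub : ∀ p ∈ S, ∀ x ∈ A, f p + x ∈ B)
    (hN : ∀ z, ∀ T ⊆ S, (∀ p ∈ T, z - f p ∈ A) → T.card ≤ N) :
    (S.card : ENNReal) * volume A ≤ N * volume B := by
  classical
  have hm : ∀ p, MeasurableSet ((fun z => z - f p) ⁻¹' A) := fun p =>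
    (measurable_id.sub_const (f p)) hA
  have h1 : ∀ p, volume ((fun z => z - f p) ⁻¹' A) = volume A := fun p => by
    simp_rw [sub_eq_add_neg]
    exact measure_preimage_add_right _ _ _
  calc (S.card : ENNReal) * volume A
      = ∑ p ∈ S, volume ((fun z => z - f p) ⁻¹' A) := by simp [h1]
    _ = ∑ p ∈ S, ∫⁻ z, ((fun z => z - f p) ⁻¹' A).indicator 1 z := by
        simp_rw [lintegral_indicator_one (hm _)]
    _ = ∫⁻ z, ∑ p ∈ S, ((fun z => z - f p) ⁻¹' A).indicator 1 z := by
        rw [lintegral_finsetSum]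
        exact fun p _ => measurable_one.indicator (hm p)
    _ ≤ ∫⁻ z, B.indicator (fun _ => (N : ENNReal)) z := by
        refine lintegral_mono fun z => ?_
        have e : ∑ p ∈ S, ((fun z => z - f p) ⁻¹' A).indicator (1 : E n → ENNReal) z
            = ((S.filter fun p => z - f p ∈ A).card : ENNReal) := by
          simp [Set.indicator_apply]
        simp only [e]
        by_cases hz : z ∈ B
        · rw [Set.indicator_of_mem hz]
          exact_mod_cast hN z _ (Finset.filter_subset _ _) fun p hp => (Finset.mem_filter.1 hp).2
        · rw [Set.indicator_of_notMem hz, nonpos_iff_eq_zero, Nat.cast_eq_zero,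
            Finset.card_eq_zero, Finset.filter_eq_empty_iff]
          intro p hp hA'
          exact hz (by simpa using hsub p hp _ hA')
    _ = N * volume B := by rw [lintegral_indicator_const hB]

/-! ## Lattices given by bases -/

section Lat

variable {b : Fin n → E n}

/-- Linearly independent vectors as a basis of the space. -/
noncomputable def realBasis (hb : LinearIndependent ℝ b) : Basis (Fin n) ℝ (E n) :=
  basisOfLinearIndependentOfCardEqFinrank' b hb (by simp)

@[simp] lemma coe_realBasis (hb : LinearIndependent ℝ b) : ⇑(realBasis hb) = b := by
  simp [realBasis]

lemma lat_eq_span (hb : LinearIndependent ℝ b) :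
    lat b = Submodule.span ℤ (Set.range (realBasis hb)) := by simp [lat]

lemma discreteTopology_lat (hb : LinearIndependent ℝ b) : DiscreteTopology (lat b) := by
  rw [lat_eq_span hb]; infer_instance

lemma isZLattice_lat (hb : LinearIndependent ℝ b) :
    @IsZLattice ℝ _ _ _ _ (lat b) (discreteTopology_lat hb) := by
  have := discreteTopology_lat hb
  refine ⟨?_⟩
  rw [lat_eq_span hb]
  exact IsZLattice.span_top

lemma mem_lat_iff {x : E n} : x ∈ lat b ↔ ∃ a : Fin n → ℤ, x = ∑ i, (a i : ℝ) • b i := by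
  rw [lat, Submodule.mem_span_range_iff_exists_fun]
  simp [Int.cast_smul_eq_zsmul, eq_comm]

lemma lat_inter_finite (hb : LinearIndependent ℝ b) {s : Set (E n)} (hs : Bornology.IsBounded s) :
    (s ∩ lat b).Finite := by
  rw [lat_eq_span hb]
  exact ZSpan.setFinite_inter _ hs

lemma latDet_pos (hb : LinearIndependent ℝ b) : 0 < latDet (lat b) := by
  have := discreteTopology_lat hb
  have := isZLattice_lat hb
  exact ZLattice.covolume_pos _ _

lemma latDet_div_latDet {b' : Fin n → E n} (hb : LinearIndependent ℝ b)
    (hb' : LinearIndependent ℝ b') (h : lat b ≤ lat b') :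
    latDet (lat b) = index (lat b') (lat b) * latDet (lat b') := by
  have := discreteTopology_lat hb
  have := isZLattice_lat hb
  have := discreteTopology_lat hb'
  have := isZLattice_lat hb'
  have h1 := ZLattice.covolume_div_covolume_eq_relIndex' (lat b) (lat b') h
  rw [index, ← h1, latDet, latDet, div_mul_cancel₀ _ (ZLattice.covolume_ne_zero _ _)]

lemma latDet_smul (hb : LinearIndependent ℝ b) {a : ℝ} (ha : 0 < a) :
    latDet (lat fun i => a • b i) = a ^ n * latDet (lat b) := by
  have hb' : LinearIndependent ℝ fun i => a • b i :=
    hb.units_smul fun _ => Units.mk0 a ha.ne'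
  -- Relative to one fixed basis every covolume is a determinant times the same constant, so only
  -- the homogeneity of the determinant is left.
  have key : ∀ (c : Fin n → E n) (hc : LinearIndependent ℝ c),
      latDet (lat c) = |(realBasis hb).det c| *
        volume.real (ZSpan.fundamentalDomain (realBasis hb)) := by
    intro c hc
    rw [lat_eq_span hc]
    rw [latDet, ZLattice.covolume_eq_measure_fundamentalDomain _ _
      (ZSpan.isAddFundamentalDomain (realBasis hc) volume),
      ZSpan.measureReal_fundamentalDomain _ _ (realBasis hb),
      measureReal_congr (ZSpan.fundamentalDomain_ae_parallelepiped (realBasis hb) _)]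
    simp
  rw [key _ hb', key _ hb]
  have : (realBasis hb).det (fun i => a • b i) = a ^ n * (realBasis hb).det b := by
    have := (realBasis hb).det.map_smul_univ (fun _ => a) b
    simpa using this
  rw [this, abs_mul, abs_of_pos (pow_pos ha n)]
  ring

lemma smul_lat {a : ℝ} : a • lat b = lat fun i => a • b i := by
  rw [lat, lat, Submodule.smul_span]
  congr 1
  ext x
  simp [Set.mem_smul_set]

/-- Minkowski's theorem: the packing radius is bounded by the determinant. -/
lemma minDist_pow_mul_vol_le (hn : n ≠ 0) (hK : IsSymmetricConvexBody K) (hb : LinearIndependent ℝ b) :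
    minDist K (lat b) ^ n * vol K ≤ 2 ^ n * latDet (lat b) := by
  -- Minkowski's theorem with a strict volume inequality produces a non-zero point of norm at most
  -- r, which is absurd for r below the minimum. The bound at the minimum itself is the limit from
  -- the left.
  have hlt : ∀ r, 0 ≤ r → r < minDist K (lat b) → r ^ n * vol K ≤ 2 ^ n * latDet (lat b) := by
    intro r hr0 hr
    by_contra! hcon
    have := discreteTopology_lat hb
    have := isZLattice_lat hb
    have hfund := ZSpan.isAddFundamentalDomain (realBasis hb) (volume : Measure (E n))
    have hdet : (volume (ZSpan.fundamentalDomain (realBasis hb))).toReal = latDet (lat b) := by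
      rw [lat_eq_span hb]
      exact (ZLattice.covolume_eq_measure_fundamentalDomain _ _ hfund).symm
    have hK' : ∀ x ∈ r • K, -x ∈ r • K := by
      rintro _ ⟨x, hx, rfl⟩
      exact ⟨-x, hK.neg_mem hx, by simp⟩
    have hfin : volume (ZSpan.fundamentalDomain (realBasis hb)) ≠ ⊤ :=
      (ZSpan.fundamentalDomain_isBounded (realBasis hb)).measure_lt_top.ne
    have hvol : volume (ZSpan.fundamentalDomain (realBasis hb)) * 2 ^ finrank ℝ (E n)
        < volume (r • K) := by
      rw [← ENNReal.toReal_lt_toReal (ENNReal.mul_ne_top hfin (by simp))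
        (hK.compact.smul r).measure_lt_top.ne, ENNReal.toReal_mul, hdet]
      have := vol_smul hr0 K
      rw [vol] at this
      rw [this]
      simpa [mul_comm] using hcon
    have : Countable (Submodule.span ℤ (Set.range (realBasis hb))).toAddSubgroup :=
      inferInstanceAs (Countable (Submodule.span ℤ (Set.range (realBasis hb))))
    obtain ⟨x, hx0, hx⟩ := exists_ne_zero_mem_lattice_of_measure_mul_two_pow_lt_measure
      (L := (Submodule.span ℤ (Set.range (realBasis hb))).toAddSubgroup) hfund hK'
      (hK.convex.smul r) hvol
    have h1 : gauge K (x : E n) ≤ r := gauge_le_of_mem hr0 hx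
    have h2 : minDist K (lat b) ≤ gauge K (x : E n) := by
      refine csInf_le ⟨0, ?_⟩ ⟨x, ⟨?_, ?_⟩, rfl⟩
      · rintro _ ⟨y, -, rfl⟩
        exact gauge_nonneg _
      · rw [lat_eq_span hb]; exact x.2
      · simpa using hx0
    linarith
  have h0 : 0 ≤ minDist K (lat b) := Real.sInf_nonneg (by
    rintro _ ⟨y, -, rfl⟩
    exact gauge_nonneg _)
  rcases h0.eq_or_lt with h0 | h0
  · rw [← h0, zero_pow hn, zero_mul]
    have := latDet_pos hb
    positivity
  · have hc : ContinuousWithinAt (fun r : ℝ => r ^ n * vol K) (Set.Iio (minDist K (lat b)))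
        (minDist K (lat b)) := by fun_prop
    refine le_of_tendsto hc ?_
    filter_upwards [self_mem_nhdsWithin, Ico_mem_nhdsLT h0] with r hr hr'
    exact hlt r hr'.1 hr

end Lat

end ThinLattice

namespace ThinLattice

open MeasureTheory Module

variable {n : ℕ} {K : Set (E n)}

/-! ## Counting lattice points in projections -/

lemma finite_and_ncard_le {α : Type*} {A : Set α} {B : ℝ}
    (h : ∀ S : Finset α, (S : Set α) ⊆ A → (S.card : ℝ) ≤ B) :
    A.Finite ∧ (A.ncard : ℝ) ≤ B := by
  have hA : A.Finite := by
    by_contra hA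
    obtain ⟨S, hS, hc⟩ := Set.Infinite.exists_subset_card_eq hA (⌊B⌋₊ + 1)
    have h1 := h S hS
    rw [hc] at h1
    push_cast at h1
    linarith [Nat.lt_floor_add_one B]
  refine ⟨hA, ?_⟩
  have := h hA.toFinset (by simp)
  rwa [← Set.ncard_eq_toFinset_card A hA] at this

/-- Lift each p to a point `f p` of the ball. The translates `f p + K` lie in the ball of radius r +
1. If z lies in several of them, then by symmetry each of these `f p` lies in K + z, so the
corresponding p are among the at most ⌊α⌋ points that the hypothesis counts for t = z. Comparing
volumes gives the factor (r + 1)^n. -/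
lemma card_le_of_se (hK : IsSymmetricConvexBody K) (π : E n →ₗ[ℝ] E n) {M : Submodule ℤ (E n)}
    {α : ℝ} (hα : ∀ t, (π '' (K + {t}) ∩ π '' (M : Set (E n))).Finite ∧
      ((π '' (K + {t}) ∩ π '' (M : Set (E n))).ncard : ℝ) ≤ α) {r : ℝ} (hr : 0 ≤ r) (t : E n)
    (S : Finset (E n)) (hS : (S : Set (E n)) ⊆ π '' {x | gauge K (x - t) ≤ r} ∩ π '' M) :
    (S.card : ℝ) ≤ α * (r + 1) ^ n := by
  have hα0 : 0 ≤ α := (Nat.cast_nonneg _).trans (hα 0).2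
  choose! f hf using fun p (hp : p ∈ S) => (hS hp).1
  have hB : {x | gauge K (x - t) ≤ r + 1} = (fun x => x + -t) ⁻¹' ((r + 1) • K) := by
    ext x
    simp only [Set.mem_ofPred_eq, Set.mem_preimage, ← sub_eq_add_neg]
    exact hK.gauge_le_iff (by linarith)
  have hcB : IsClosed ((r + 1) • K) := (hK.compact.smul (r + 1)).isClosed
  have key := mul_measure_le_of_overlap_le S f (A := K) (B := {x | gauge K (x - t) ≤ r + 1})
    hK.compact.isClosed.measurableSet
    (isClosed_le (hK.continuous_gauge.comp (continuous_id.sub continuous_const))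
      continuous_const).measurableSet ⌊α⌋₊ ?_ ?_
  · rw [hB, measure_preimage_add_right] at key
    have h2 := ENNReal.toReal_mono (ENNReal.mul_ne_top (by simp)
      (hK.compact.smul (r + 1)).measure_lt_top.ne) key
    rw [ENNReal.toReal_mul, ENNReal.toReal_mul] at h2
    have h3 := vol_smul (by linarith : 0 ≤ r + 1) K
    rw [vol, vol] at h3
    rw [h3] at h2
    have hv := hK.vol_pos
    rw [vol] at hv
    simp only [ENNReal.toReal_natCast] at h2
    have h4 : (S.card : ℝ) ≤ ⌊α⌋₊ * (r + 1) ^ n := by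
      rw [← mul_assoc] at h2
      exact le_of_mul_le_mul_right h2 hv
    refine h4.trans ?_
    gcongr
    exact Nat.floor_le hα0
  · intro p hp x hx
    have h1 := hK.gauge_add_le (f p - t) x
    have h2 := (hf p hp).1
    have h3 := hK.gauge_le_one_iff.2 hx
    simp only [Set.mem_ofPred_eq] at h2 ⊢
    rw [show f p + x - t = f p - t + x by abel]
    linarith
  · intro z T hT hz
    refine Nat.le_floor ?_
    refine le_trans ?_ (hα z).2
    rw [← Set.ncard_coe_finset]
    refine Nat.cast_le.2 (Set.ncard_le_ncard ?_ (hα z).1)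
    intro p hp
    refine ⟨⟨f p, ⟨f p - z, ?_, z, rfl, by simp⟩, (hf p (hT hp)).2⟩, (hS (hT hp)).2⟩
    rw [← neg_sub]
    exact hK.neg_mem (hz p hp)

/-- Λ is the union of `index Λ M` cosets of M. Subtracting the projection of a coset representative
moves the points of that coset into the projection of M and merely shifts the ball, so
`card_le_of_se` applies coset by coset. -/
lemma card_le_of_se_of_index (hK : IsSymmetricConvexBody K) (π : E n →ₗ[ℝ] E n)
    {M Λ : Submodule ℤ (E n)} (hidx : index Λ M ≠ 0)
    {α : ℝ} (hα : ∀ t, (π '' (K + {t}) ∩ π '' (M : Set (E n))).Finite ∧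
      ((π '' (K + {t}) ∩ π '' (M : Set (E n))).ncard : ℝ) ≤ α) {r : ℝ} (hr : 0 ≤ r) (t : E n) :
    (π '' {x | gauge K (x - t) ≤ r} ∩ π '' (Λ : Set (E n))).Finite ∧
    ((π '' {x | gauge K (x - t) ≤ r} ∩ π '' (Λ : Set (E n))).ncard : ℝ) ≤
      index Λ M * (α * (r + 1) ^ n) := by
  classical
  let H := M.toAddSubgroup.addSubgroupOf Λ.toAddSubgroup
  -- The value zero of the index encodes infinite index.
  have hfin : H.FiniteIndex := ⟨hidx⟩
  have : Fintype (Λ.toAddSubgroup ⧸ H) := AddSubgroup.fintypeQuotientOfFiniteIndex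
  have hcard : Fintype.card (Λ.toAddSubgroup ⧸ H) = index Λ M := by
    rw [← Nat.card_eq_fintype_card]; rfl
  refine finite_and_ncard_le fun S hS => ?_
  let Sq : Λ.toAddSubgroup ⧸ H → Finset (E n) := fun q =>
    S.filter fun p => p - π (q.out : E n) ∈ π '' (M : Set (E n))
  have hcov : S ⊆ Finset.univ.biUnion Sq := by
    intro p hp
    obtain ⟨-, y, hy, rfl⟩ := hS hp
    simp only [Finset.mem_biUnion, Finset.mem_univ, true_and]
    refine ⟨((⟨y, hy⟩ : Λ.toAddSubgroup) : Λ.toAddSubgroup ⧸ H), Finset.mem_filter.2 ⟨hp, ?_⟩⟩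
    set q : Λ.toAddSubgroup ⧸ H := ((⟨y, hy⟩ : Λ.toAddSubgroup) : Λ.toAddSubgroup ⧸ H) with hq
    have h1 : ((q.out : Λ.toAddSubgroup) : Λ.toAddSubgroup ⧸ H) = q := Quotient.out_eq' q
    have h2 : -q.out + ⟨y, hy⟩ ∈ H := QuotientAddGroup.eq.1 (h1.trans hq)
    refine ⟨y - (q.out : E n), ?_, by simp⟩
    have h3 : ((-q.out + ⟨y, hy⟩ : Λ.toAddSubgroup) : E n) ∈ M := h2
    rw [sub_eq_neg_add]
    simpa using h3
  have hle : ∀ q, ((Sq q).card : ℝ) ≤ α * (r + 1) ^ n := by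
    intro q
    rw [← Finset.card_image_of_injective (Sq q) (sub_left_injective (b := π (q.out : E n)))]
    refine card_le_of_se hK π hα hr (t - (q.out : E n)) _ ?_
    intro p hp
    obtain ⟨p', hp', rfl⟩ := Finset.mem_image.1 hp
    obtain ⟨hp1, hp2⟩ := Finset.mem_filter.1 hp'
    refine ⟨?_, hp2⟩
    obtain ⟨⟨x, hx, rfl⟩, -⟩ := hS hp1
    refine ⟨x - (q.out : E n), ?_, by simp⟩
    simpa using hx
  calc (S.card : ℝ) ≤ ((Finset.univ.biUnion Sq).card : ℝ) := by
        exact_mod_cast Finset.card_le_card hcov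
    _ ≤ ∑ q, ((Sq q).card : ℝ) := by exact_mod_cast Finset.card_biUnion_le
    _ ≤ ∑ _q : Λ.toAddSubgroup ⧸ H, α * (r + 1) ^ n := Finset.sum_le_sum fun q _ => hle q
    _ = index Λ M * (α * (r + 1) ^ n) := by
        rw [Finset.sum_const, Finset.card_univ, hcard, nsmul_eq_mul]

/-- The Gram-Schmidt projection as a linear map. -/
noncomputable def gsProjL (b : Fin n → E n) (i : Fin n) : E n →ₗ[ℝ] E n :=
  ((Submodule.span ℝ (b '' Set.Iio i))ᗮ.starProjection : E n →L[ℝ] E n)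

lemma coe_gsProjL (b : Fin n → E n) (i : Fin n) : ⇑(gsProjL b i) = gsProj b i := rfl

lemma gsProj_eq_iff (b : Fin n → E n) (i : Fin n) (x y : E n) :
    gsProj b i x = gsProj b i y ↔ x - y ∈ Submodule.span ℝ (b '' Set.Iio i) := by
  rw [← sub_eq_zero, ← coe_gsProjL, ← map_sub]
  set U := Submodule.span ℝ (b '' Set.Iio i)
  change Uᗮ.starProjection (x - y) = 0 ↔ _
  rw [Submodule.starProjection_apply_eq_zero_iff, Submodule.orthogonal_orthogonal]

lemma gsProj_congr {b b' : Fin n → E n}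
    (h : ∀ i : Fin n, Submodule.span ℝ (b '' Set.Iic i) = Submodule.span ℝ (b' '' Set.Iic i))
    (i : Fin n) : gsProj b i = gsProj b' i := by
  -- The hypothesis speaks of closed initial segments, the projection of open ones; an open segment
  -- is the union of the closed segments strictly below its end.
  have e : ∀ c : Fin n → E n, Submodule.span ℝ (c '' Set.Iio i) =
      ⨆ j : Set.Iio i, Submodule.span ℝ (c '' Set.Iic (j : Fin n)) := by
    intro c
    rw [← Submodule.span_iUnion, ← Set.image_iUnion]
    congr 2
    ext j
    simp only [Set.mem_Iio, Set.mem_iUnion, Set.mem_Iic, Subtype.exists, exists_prop]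
    exact ⟨fun hj => ⟨j, hj, le_rfl⟩, fun ⟨k, hk, hj⟩ => hj.trans_lt hk⟩
  have : Submodule.span ℝ (b '' Set.Iio i) = Submodule.span ℝ (b' '' Set.Iio i) := by
    rw [e, e]; simp_rw [h]
  have key : ∀ U V : Submodule ℝ (E n), U = V →
      (fun x => Uᗮ.starProjection x) = fun x => Vᗮ.starProjection x := by
    rintro U _ rfl
    rfl
  exact key _ _ this

/-! ## Distances -/

section Dist

variable {L : Submodule ℤ (E n)}

lemma minDist_le_gauge {y : E n} (hy : y ∈ L) (h0 : y ≠ 0) : minDist K L ≤ gauge K y := by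
  refine csInf_le ⟨0, ?_⟩ ⟨y, ⟨hy, by simpa using h0⟩, rfl⟩
  rintro _ ⟨z, -, rfl⟩
  exact gauge_nonneg _

/-- The non-zero vector y is needed because the infimum of the empty set is 0 by convention. -/
lemma le_minDist {y : E n} (hy : y ∈ L) (h0 : y ≠ 0) {r : ℝ}
    (h : ∀ z ∈ L, z ≠ 0 → r ≤ gauge K z) : r ≤ minDist K L := by
  refine le_csInf ⟨_, y, ⟨hy, by simpa using h0⟩, rfl⟩ ?_
  rintro _ ⟨z, ⟨hz, hz0⟩, rfl⟩
  exact h z hz (by simpa using hz0)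

lemma minDist_nonneg : 0 ≤ minDist K L := Real.sInf_nonneg (by
  rintro _ ⟨y, -, rfl⟩
  exact gauge_nonneg _)

lemma latDist_le {x y : E n} (hy : y ∈ L) : latDist K L x ≤ gauge K (y - x) := by
  refine csInf_le ⟨0, ?_⟩ ⟨y, hy, rfl⟩
  rintro _ ⟨z, -, rfl⟩
  exact gauge_nonneg _

lemma le_latDist {x : E n} {r : ℝ} (h : ∀ y ∈ L, r ≤ gauge K (y - x)) : r ≤ latDist K L x := by
  refine le_csInf ⟨_, 0, L.zero_mem, rfl⟩ ?_
  rintro _ ⟨z, hz, rfl⟩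
  exact h z hz

lemma exists_gauge_sub_lt {x : E n} {r : ℝ} (h : latDist K L x < r) :
    ∃ y ∈ L, gauge K (y - x) < r := by
  obtain ⟨_, ⟨y, hy, rfl⟩, hlt⟩ := exists_lt_of_csInf_lt
    (by exact ⟨_, 0, L.zero_mem, rfl⟩) h
  exact ⟨y, hy, hlt⟩

lemma latDist_add_mem {x y : E n} (hy : y ∈ L) : latDist K L (x + y) = latDist K L x := by
  have : ∀ x y, y ∈ L → latDist K L (x + y) ≤ latDist K L x := fun x y hy =>
    le_latDist fun z hz => (latDist_le (L.add_mem hz hy)).trans_eq (by congr 1; abel)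
  refine le_antisymm (this x y hy) ?_
  simpa using this (x + y) (-y) (L.neg_mem hy)

lemma latDist_neg (hK : IsSymmetricConvexBody K) (x : E n) :
    latDist K L (-x) = latDist K L x := by
  have : ∀ x, latDist K L (-x) ≤ latDist K L x := fun x =>
    le_latDist fun z hz => (latDist_le (L.neg_mem hz)).trans_eq (by
      rw [← hK.gauge_neg]; congr 1; abel)
  exact le_antisymm (this x) (by simpa using this (-x))

end Dist

/-- Only finitely many lattice points come within one unit of the infimum, so it is attained. -/
lemma exists_latDist_eq {b : Fin n → E n} (hK : IsSymmetricConvexBody K)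
    (hb : LinearIndependent ℝ b) (x : E n) :
    ∃ y ∈ lat b, gauge K (y - x) = latDist K (lat b) x := by
  have hbd : Bornology.IsBounded {y | gauge K (y - x) ≤ latDist K (lat b) x + 1} := by
    have := (hK.isBounded_gauge_le (latDist K (lat b) x + 1)).vadd x
    refine this.subset fun y hy => ⟨y - x, hy, by simp⟩
  have hfin := lat_inter_finite hb hbd
  obtain ⟨y0, hy0, hlt0⟩ := exists_gauge_sub_lt (lt_add_one (latDist K (lat b) x))
  obtain ⟨y, hy, hmin⟩ := hfin.exists_minimalFor (fun y => gauge K (y - x)) _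
    ⟨y0, hlt0.le, hy0⟩
  refine ⟨y, hy.2, le_antisymm (le_latDist fun z hz => ?_) (latDist_le hy.2)⟩
  by_cases hz' : gauge K (z - x) ≤ latDist K (lat b) x + 1
  · rcases le_total (gauge K (y - x)) (gauge K (z - x)) with h | h
    · exact h
    · exact hmin ⟨hz', hz⟩ h
  · exact hy.1.trans (not_le.1 hz').le

end ThinLattice

namespace ThinLattice

open MeasureTheory Module

variable {n : ℕ} {K : Set (E n)}

/-! ## Rogers' densification -/

/-- As 3x lies in L, a point l + m x belongs to L, to L + x or to L - x. In the last two cosets all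
norms are at least the distance of x from L, which exceeds the old minimum. -/
lemma RogersStep.minDist_eq (hK : IsSymmetricConvexBody K) {L L' : Submodule ℤ (E n)}
    (h : RogersStep K L L') {y : E n} (hy : y ∈ L) (hy0 : y ≠ 0) :
    minDist K L' = minDist K L := by
  obtain ⟨x, hx, hd, rfl⟩ := h
  have hle : L ≤ L ⊔ Submodule.span ℤ {x} := le_sup_left
  refine le_antisymm (le_minDist hy hy0 fun z hz hz0 => minDist_le_gauge (hle hz) hz0)
    (le_minDist (hle hy) hy0 fun z hz hz0 => ?_)
  obtain ⟨l, hl, w, hw, rfl⟩ := Submodule.mem_sup.1 hz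
  obtain ⟨m, rfl⟩ := Submodule.mem_span_singleton.1 hw
  have h3 : ∀ q : ℤ, (3 * q) • x ∈ L := fun q => by
    rw [mul_comm, mul_smul]; exact L.smul_mem _ hx
  have hcase : m % 3 = 0 ∨ m % 3 = 1 ∨ m % 3 = 2 := by omega
  rcases hcase with h0 | h1 | h2
  · have hm : m = 3 * (m / 3) := by omega
    rw [hm] at hz0 ⊢
    exact minDist_le_gauge (L.add_mem hl (h3 _)) hz0
  · have hm : m = 3 * (m / 3) + 1 := by omega
    refine (hd.le.trans (latDist_le (L.neg_mem (L.add_mem hl (h3 (m / 3)))))).trans_eq ?_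
    rw [← hK.gauge_neg]
    congr 1
    conv_rhs => rw [hm, add_smul, one_smul]
    abel
  · have hm : m = 3 * (m / 3 + 1) - 1 := by omega
    refine (hd.le.trans (latDist_le (L.add_mem hl (h3 (m / 3 + 1))))).trans_eq ?_
    congr 1
    conv_rhs => rw [hm, sub_smul, one_smul]
    abel

/-- The new basis vector of a densification step. -/
noncomputable def thirdVec (b : Fin n → E n) (j : Fin n) (z : Fin n → ℤ) : E n :=
  (1 / 3 : ℝ) • (b j + ∑ i ∈ Finset.Iio j, (z i : ℝ) • b i)

lemma three_smul_thirdVec (b : Fin n → E n) (j : Fin n) (z : Fin n → ℤ) :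
    (3 : ℤ) • thirdVec b j z = b j + ∑ i ∈ Finset.Iio j, z i • b i := by
  rw [thirdVec, ← Int.cast_smul_eq_zsmul ℝ, smul_smul]
  norm_num [Int.cast_smul_eq_zsmul]

/-- The old vector is three times the new one minus an integer combination of earlier basis vectors.
Since the coefficients are integers the scalars may be arbitrary: the real case serves the flag, the
integral case the lattice. -/
lemma subset_span_update {R : Type*} [Ring R] [Module R (E n)] (b : Fin n → E n) (j i : Fin n)
    (z : Fin n → ℤ) :
    b '' Set.Iic i ⊆ Submodule.span R (Function.update b j (thirdVec b j z) '' Set.Iic i) := by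
  rintro _ ⟨k, hk, rfl⟩
  have hne : ∀ k ∈ Set.Iic i, k ≠ j →
      b k ∈ Submodule.span R (Function.update b j (thirdVec b j z) '' Set.Iic i) :=
    fun k hk hkj => Submodule.subset_span ⟨k, hk, by rw [Function.update_of_ne hkj]⟩
  by_cases hkj : k = j
  · subst hkj
    have h1 : thirdVec b k z ∈
        Submodule.span R (Function.update b k (thirdVec b k z) '' Set.Iic i) :=
      Submodule.subset_span ⟨k, hk, by rw [Function.update_self]⟩
    have h2 := three_smul_thirdVec b k z
    rw [← sub_eq_iff_eq_add] at h2
    rw [← h2]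
    refine Submodule.sub_mem _ (zsmul_mem h1 _) (Submodule.sum_mem _ fun l hl => zsmul_mem ?_ _)
    have hl' := Finset.mem_Iio.1 hl
    exact hne l (hl'.le.trans hk) hl'.ne
  · exact hne k hk hkj

/-- The new vector is b_j / 3 plus a combination of earlier basis vectors, so no initial span
changes. -/
lemma isDirectionalBasis_update {b : Fin n → E n} (hb : LinearIndependent ℝ b) (j : Fin n)
    (z : Fin n → ℤ) :
    IsDirectionalBasis (Function.update b j (thirdVec b j z))
      (lat b ⊔ Submodule.span ℤ {thirdVec b j z}) b := by
  set b' := Function.update b j (thirdVec b j z) with hb'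
  have hspan : ∀ i : Fin n, Submodule.span ℝ (b' '' Set.Iic i) = Submodule.span ℝ (b '' Set.Iic i) := by
    intro i
    refine le_antisymm (Submodule.span_le.2 ?_) (Submodule.span_le.2 (subset_span_update b j i z))
    rintro _ ⟨k, hk, rfl⟩
    have hne : ∀ k ∈ Set.Iic i, b k ∈ Submodule.span ℝ (b '' Set.Iic i) :=
      fun k hk => Submodule.subset_span ⟨k, hk, rfl⟩
    by_cases hkj : k = j
    · subst hkj
      rw [hb', Function.update_self]
      refine Submodule.smul_mem _ _ (Submodule.add_mem _ (hne k hk) (Submodule.sum_mem _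
        fun l hl => Submodule.smul_mem _ _ (hne l ?_)))
      exact (Finset.mem_Iio.1 hl).le.trans hk
    · rw [hb', Function.update_of_ne hkj]
      exact hne k hk
  have himg : ∀ c : Fin n → E n, Set.range c = ⋃ i, c '' Set.Iic i := by
    intro c
    ext x
    simp only [Set.mem_range, Set.mem_iUnion, Set.mem_image, Set.mem_Iic]
    exact ⟨fun ⟨i, hi⟩ => ⟨i, i, le_rfl, hi⟩, fun ⟨_, i, _, hi⟩ => ⟨i, hi⟩⟩
  refine ⟨?_, ?_, hspan⟩
  · refine linearIndependent_of_top_le_span_of_card_eq_finrank ?_ (by simp)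
    rw [himg b', Submodule.span_iUnion]
    simp_rw [hspan]
    rw [← Submodule.span_iUnion, ← himg b, ← coe_realBasis hb, (realBasis hb).span_eq]
  · refine le_antisymm (Submodule.span_le.2 ?_) (sup_le (Submodule.span_le.2 ?_)
      ((Submodule.span_singleton_le_iff_mem _ _).2 (Submodule.subset_span ⟨j, by simp [hb']⟩)))
    · rintro _ ⟨k, rfl⟩
      by_cases hkj : k = j
      · subst hkj
        rw [hb', Function.update_self]
        exact (le_sup_right : _ ≤ lat b ⊔ _) (Submodule.mem_span_singleton_self _)
      · rw [hb', Function.update_of_ne hkj]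
        exact (le_sup_left : lat b ≤ _) (Submodule.subset_span ⟨k, rfl⟩)
    · rintro _ ⟨k, rfl⟩
      exact Submodule.span_mono (Set.image_subset_range _ _)
        (subset_span_update (R := ℤ) b j k z ⟨k, Set.mem_Iic.2 le_rfl, rfl⟩)

/-- Reducing the coefficients of 3x modulo 3 changes x by a lattice vector, and the residues are 1
at j and 0 beyond j. -/
lemma exists_sub_thirdVec_mem {b : Fin n → E n} {x : E n} {a : Fin n → ℤ}
    (hx : (3 : ℝ) • x = ∑ i, (a i : ℝ) • b i) {j : Fin n} (hj : a j % 3 = 1)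
    (hgt : ∀ i, j < i → a i % 3 = 0) :
    x - thirdVec b j (fun i => a i % 3) ∈ lat b := by
  rw [mem_lat_iff]
  refine ⟨fun i => a i / 3, ?_⟩
  have h3 : (3 : ℝ) • (x - thirdVec b j (fun i => a i % 3))
      = (3 : ℝ) • ∑ i, ((a i / 3 : ℤ) : ℝ) • b i := by
    have e1 : b j + ∑ i ∈ Finset.Iio j, ((a i % 3 : ℤ) : ℝ) • b i
        = ∑ i, ((a i % 3 : ℤ) : ℝ) • b i := by
      have hsplit : ∑ i ∈ Finset.Iic j, ((a i % 3 : ℤ) : ℝ) • b i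
          = ∑ i, ((a i % 3 : ℤ) : ℝ) • b i := by
        refine Finset.sum_subset (Finset.subset_univ _) fun i _ hi => ?_
        rw [hgt i (by simpa using hi)]; simp
      rw [← hsplit, ← Finset.Iio_insert, Finset.sum_insert (by simp), hj]
      simp
    rw [smul_sub, hx, thirdVec, smul_smul, e1]
    norm_num only [one_smul]
    rw [← Finset.sum_sub_distrib, Finset.smul_sum]
    refine Finset.sum_congr rfl fun i _ => ?_
    rw [smul_smul, ← sub_smul]
    congr 1
    have := Int.emod_add_mul_ediv (a i) 3
    have h : ((a i % 3 : ℤ) : ℝ) + 3 * ((a i / 3 : ℤ) : ℝ) = a i := by exact_mod_cast this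
    linarith
  exact smul_right_injective _ (by norm_num : (3 : ℝ) ≠ 0) h3

/-- Let j be the last index at which the coefficient of 3x is not divisible by 3; after a change of
sign of x the residue there is 1. As the distance to the lattice is even, a densification only has
to test these (3^n - 1)/2 representatives, and each of them can replace one basis vector. -/
lemma mem_or_exists_thirdVec {b : Fin n → E n} {x : E n} (hx : (3 : ℤ) • x ∈ lat b) :
    x ∈ lat b ∨ ∃ (j : Fin n) (z : Fin n → ℤ), (∀ i, 0 ≤ z i ∧ z i < 3) ∧
      (x - thirdVec b j z ∈ lat b ∨ -x - thirdVec b j z ∈ lat b) := by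
  classical
  rw [← Int.cast_smul_eq_zsmul ℝ] at hx
  obtain ⟨a, ha⟩ := mem_lat_iff.1 hx
  push_cast at ha
  by_cases hall : ∀ i, a i % 3 = 0
  · left
    rw [mem_lat_iff]
    refine ⟨fun i => a i / 3, smul_right_injective _ (by norm_num : (3 : ℝ) ≠ 0) ?_⟩
    change (3 : ℝ) • x = (3 : ℝ) • _
    rw [ha, Finset.smul_sum]
    refine Finset.sum_congr rfl fun i _ => ?_
    rw [smul_smul]
    congr 1
    have := Int.emod_add_mul_ediv (a i) 3
    rw [hall i] at this
    have h : (3 : ℝ) * ((a i / 3 : ℤ) : ℝ) = a i := by exact_mod_cast (by linarith)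
    linarith
  · right
    push Not at hall
    let S : Finset (Fin n) := Finset.univ.filter fun i => a i % 3 ≠ 0
    have hS : S.Nonempty := let ⟨i, hi⟩ := hall; ⟨i, Finset.mem_filter.2 ⟨Finset.mem_univ _, hi⟩⟩
    have hjS : a (S.max' hS) % 3 ≠ 0 := (Finset.mem_filter.1 (S.max'_mem hS)).2
    have hgt : ∀ i, S.max' hS < i → a i % 3 = 0 := by
      intro i hi
      by_contra hne
      exact absurd (S.le_max' i (Finset.mem_filter.2 ⟨Finset.mem_univ _, hne⟩)) (not_le.2 hi)
    have hcase : a (S.max' hS) % 3 = 1 ∨ a (S.max' hS) % 3 = 2 := by omega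
    rcases hcase with h1 | h2
    · exact ⟨_, fun i => a i % 3, fun i => by dsimp only; omega, Or.inl (exists_sub_thirdVec_mem ha h1 hgt)⟩
    · refine ⟨S.max' hS, fun i => (-a i) % 3, fun i => by dsimp only; omega, Or.inr (exists_sub_thirdVec_mem
        (a := fun i => -a i) (x := -x) ?_ (by omega) fun i hi => by have := hgt i hi; omega)⟩
      rw [smul_neg, ha, ← Finset.sum_neg_distrib]
      simp

lemma IsDirectionalBasis.trans {b₁ b₂ b₃ : Fin n → E n} {L L' : Submodule ℤ (E n)}
    (h : IsDirectionalBasis b₁ L b₂) (h' : IsDirectionalBasis b₂ L' b₃) :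
    IsDirectionalBasis b₁ L b₃ :=
  ⟨h.1, h.2, fun i => (h.3 i).trans (h'.3 i)⟩

lemma IsDirectionalBasis.refl {b : Fin n → E n} (hb : LinearIndependent ℝ b) :
    IsDirectionalBasis b (lat b) b :=
  ⟨hb, rfl, fun _ => rfl⟩

lemma RogersStep.exists_basis {b : Fin n → E n}
    (hb : LinearIndependent ℝ b)
    {L' : Submodule ℤ (E n)} (h : RogersStep K (lat b) L') :
    ∃ b', IsDirectionalBasis b' L' b := by
  obtain ⟨x, hx, hd, rfl⟩ := h
  have hxL : x ∉ lat b := fun hxL => by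
    have h1 := latDist_le (K := K) (x := x) hxL
    rw [sub_self, gauge_zero] at h1
    linarith [minDist_nonneg (K := K) (L := lat b)]
  obtain ⟨j, z, -, hz⟩ := (mem_or_exists_thirdVec hx).resolve_left hxL
  refine ⟨Function.update b j (thirdVec b j z), ?_⟩
  · have := isDirectionalBasis_update hb j z
    convert this using 1
    -- Up to sign, x and the new basis vector agree modulo the lattice, so they generate the same
    -- extension.
    refine le_antisymm (sup_le le_sup_left ?_) (sup_le le_sup_left ?_) <;>
      rw [Submodule.span_singleton_le_iff_mem]
    · have ht : thirdVec b j z ∈ lat b ⊔ Submodule.span ℤ {thirdVec b j z} :=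
        (le_sup_right : _ ≤ lat b ⊔ _) (Submodule.mem_span_singleton_self _)
      rcases hz with hz | hz
      · have := Submodule.add_mem _ ((le_sup_left : lat b ≤ _ ⊔ _) hz) ht
        simpa using this
      · have := Submodule.add_mem _ ((le_sup_left : lat b ≤ _ ⊔ _) hz) ht
        simpa using Submodule.neg_mem _ this
    · have ht : x ∈ lat b ⊔ Submodule.span ℤ {x} :=
        (le_sup_right : _ ≤ lat b ⊔ _) (Submodule.mem_span_singleton_self _)
      rcases hz with hz | hz
      · have := Submodule.sub_mem _ ht ((le_sup_left : lat b ≤ _ ⊔ _) hz)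
        simpa using this
      · have := Submodule.add_mem _ ht ((le_sup_left : lat b ≤ _ ⊔ _) hz)
        simpa using Submodule.neg_mem _ this

lemma rogers_reach (hK : IsSymmetricConvexBody K) (hn : 0 < n) {b : Fin n → E n}
    (hb : LinearIndependent ℝ b) {Λ : Submodule ℤ (E n)}
    (h : Relation.ReflTransGen (RogersStep K) (lat b) Λ) :
    lat b ≤ Λ ∧ minDist K Λ = minDist K (lat b) ∧ ∃ b', IsDirectionalBasis b' Λ b := by
  induction h with
  | refl => exact ⟨le_rfl, rfl, b, .refl hb⟩
  | @tail L L' _ hstep ih =>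
    obtain ⟨hle, hmin, b', hb'⟩ := ih
    have h0 : b ⟨0, hn⟩ ∈ L := hle (Submodule.subset_span ⟨_, rfl⟩)
    have hmin' := hstep.minDist_eq hK h0 (hb.ne_zero _)
    rw [← hb'.lat_eq] at hstep
    obtain ⟨b'', hb''⟩ := hstep.exists_basis hb'.linearIndependent
    refine ⟨hle.trans ?_, hmin'.trans hmin, b'', hb''.trans hb'⟩
    obtain ⟨x, -, -, rfl⟩ := hstep
    rw [hb'.lat_eq]
    exact le_sup_left

end ThinLattice

namespace ThinLattice

open MeasureTheory Module

variable {n : ℕ} {K : Set (E n)} {c : ℝ} {b bM : Fin n → E n}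

/-! ## The index of the densified lattice -/

section Index

variable {b' : Fin n → E n}

/-- Minkowski's theorem for the larger lattice, whose minimum is still that of M, multiplied by the
index. -/
lemma index_mul_le (hn : 0 < n) (hK : IsSymmetricConvexBody K) (hM : LinearIndependent ℝ bM)
    (hb' : LinearIndependent ℝ b') (hle : lat bM ≤ lat b')
    (hmin : minDist K (lat b') = minDist K (lat bM)) :
    index (lat b') (lat bM) * (minDist K (lat bM) ^ n * vol K) ≤ 2 ^ n * latDet (lat bM) := by
  rw [latDet_div_latDet hM hb' hle, ← hmin]
  calc _ ≤ index (lat b') (lat bM) * (2 ^ n * latDet (lat b')) := by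
        exact mul_le_mul_of_nonneg_left (minDist_pow_mul_vol_le hn.ne' hK hb') (Nat.cast_nonneg _)
    _ = _ := by ring

lemma index_pos (hM : LinearIndependent ℝ bM)
    (hb' : LinearIndependent ℝ b') (hle : lat bM ≤ lat b') :
    0 < index (lat b') (lat bM) := by
  have h1 := latDet_pos hM
  rw [latDet_div_latDet hM hb' hle] at h1
  by_contra! h0
  rw [nonpos_iff_eq_zero.1 h0] at h1
  simp at h1

/-- The density hypothesis says that the determinant of M is at most c^n (λ/2)^n vol K; by Minkowski
the larger lattice has determinant at least (λ/2)^n vol K. -/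
lemma index_le_pow (hn : 0 < n) (hK : IsSymmetricConvexBody K) (hP : IsPackingLattice K c b bM)
    (hc : 0 < c) (hb' : LinearIndependent ℝ b') (hle : lat bM ≤ lat b')
    (hmin : minDist K (lat b') = minDist K (lat bM)) :
    (index (lat b') (lat bM) : ℝ) ≤ c ^ n := by
  have hM := hP.directional.linearIndependent
  have h1 := index_mul_le hn hK hM hb' hle hmin
  have h2 := hP.density
  have hl := hP.one_le_minDist
  set l := minDist K (lat bM)
  have hd := latDet_pos hM
  have hv := hK.vol_pos
  rw [packingDensity, vol_smul (by linarith), le_div_iff₀ hd, inv_mul_le_iff₀ (by positivity),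
    div_pow] at h2
  have h3 : 2 ^ n * latDet (lat bM) ≤ c ^ n * (l ^ n * vol K) := by
    calc 2 ^ n * latDet (lat bM) ≤ 2 ^ n * (c ^ n * (l ^ n / 2 ^ n * vol K)) := by gcongr
      _ = _ := by field_simp
  exact le_of_mul_le_mul_right (h1.trans h3) (by positivity)

/-- Here the determinant of M is bounded through the M-lattice: [L:M] det L is at most 2 c^n times
vol K / 2^(n+1). The gain of λ^n over `index_le_pow` is what the running time needs. -/
lemma index_le_div_pow (hn : 0 < n) (hK : IsSymmetricConvexBody K) (hL : IsMLattice K c b)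
    (hP : IsPackingLattice K c b bM)
    (hb' : LinearIndependent ℝ b') (hle : lat bM ≤ lat b')
    (hmin : minDist K (lat b') = minDist K (lat bM)) :
    (index (lat b') (lat bM) : ℝ) ≤ (c / minDist K (lat bM)) ^ n := by
  have hM := hP.directional.linearIndependent
  have h1 := index_mul_le hn hK hM hb' hle hmin
  have hl := hP.one_le_minDist
  set l := minDist K (lat bM)
  have hv := hK.vol_pos
  have h2 := latDet_div_latDet hM hL.linearIndependent hP.le
  have h3 := hL.det_le
  have h4 := hP.index_le
  have hd := latDet_pos hL.linearIndependent
  rw [div_pow, le_div_iff₀ (by positivity)]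
  refine le_of_mul_le_mul_right ?_ hv
  calc index (lat b') (lat bM) * l ^ n * vol K ≤ 2 ^ n * latDet (lat bM) := by linarith
    _ = 2 ^ n * (index (lat b) (lat bM) * latDet (lat b)) := by rw [h2]
    _ ≤ 2 ^ n * (2 * c ^ n * latDet (lat b)) := by gcongr
    _ = c ^ n * (2 ^ (n + 1) * latDet (lat b)) := by ring
    _ ≤ c ^ n * vol K := by
        have : 0 ≤ c := by linarith [hP.minDist_le]
        gcongr

end Index

/-! ## Covering radius -/

lemma latDist_le_of_third (hK : IsSymmetricConvexBody K) (hb : LinearIndependent ℝ b)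
    {r : ℝ} (h : ∀ x, (3 : ℤ) • x ∈ lat b → latDist K (lat b) x ≤ r) (x : E n) :
    latDist K (lat b) x ≤ 3 / 2 * r := by
  set L := lat b
  -- The supremum D below must be known to be finite before D ≤ r + D/3 can be solved for D.
  -- Rounding down the coordinates of x gives a crude bound.
  have hbdd : ∃ C, ∀ x, latDist K L x ≤ C := by
    refine ⟨∑ i, gauge K (b i), fun x => ?_⟩
    have hx : (ZSpan.floor (realBasis hb) x : E n) ∈ lat b :=
      (lat_eq_span hb).symm ▸ Subtype.prop (ZSpan.floor (realBasis hb) x)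
    refine (latDist_le hx).trans ?_
    rw [hK.gauge_sub_comm, ← ZSpan.fract_apply, ← (realBasis hb).sum_repr (ZSpan.fract _ x)]
    refine (gauge_sum_le hK.convex hK.absorbent _ _).trans (Finset.sum_le_sum fun i _ => ?_)
    rw [hK.gauge_smul, ZSpan.repr_fract_apply, coe_realBasis, abs_of_nonneg (Int.fract_nonneg _)]
    exact mul_le_of_le_one_left (gauge_nonneg _) (Int.fract_lt_one _).le
  obtain ⟨C, hC⟩ := hbdd
  have hB : BddAbove (Set.range (latDist K L)) := ⟨C, by rintro _ ⟨x, rfl⟩; exact hC x⟩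
  set D := ⨆ x, latDist K L x with hD
  have hle : ∀ x, latDist K L x ≤ D := fun x => le_ciSup hB x
  -- A lattice point y near 3x puts y/3 within about D/3 of x, and y/3 is one of the points to which
  -- the hypothesis applies.
  have hstep : ∀ x, latDist K L x ≤ r + D / 3 := by
    intro x
    refine le_of_forall_pos_lt_add fun ε hε => ?_
    obtain ⟨y, hy, hlt⟩ := exists_gauge_sub_lt (L := L) (x := (3 : ℝ) • x) (K := K)
      (r := D + ε) ((hle _).trans_lt (by linarith))
    have h3 : latDist K L ((1 / 3 : ℝ) • y) ≤ r := by
      refine h _ ?_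
      rw [← Int.cast_smul_eq_zsmul ℝ, smul_smul]
      norm_num
      exact hy
    obtain ⟨z, hz, hlt'⟩ := exists_gauge_sub_lt (L := L) (x := (1 / 3 : ℝ) • y) (K := K)
      (r := r + ε / 3) (by linarith)
    have h4 : gauge K ((1 / 3 : ℝ) • y - x) = gauge K (y - (3 : ℝ) • x) / 3 := by
      have : (1 / 3 : ℝ) • y - x = (1 / 3 : ℝ) • (y - (3 : ℝ) • x) := by
        rw [smul_sub, smul_smul]; norm_num
      rw [this, hK.gauge_smul, abs_of_pos (by norm_num)]
      ring
    have h5 := hK.gauge_add_le (z - (1 / 3 : ℝ) • y) ((1 / 3 : ℝ) • y - x)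
    rw [sub_add_sub_cancel] at h5
    have := latDist_le (K := K) (x := x) hz
    linarith
  have hD' : D ≤ r + D / 3 := ciSup_le hstep
  linarith [hle x]

lemma add_smul_eq_univ (hK : IsSymmetricConvexBody K) {L : Submodule ℤ (E n)} {s : ℝ}
    (hs : 0 < s) (h : ∀ x, latDist K L x < s) : (L : Set (E n)) + s • K = Set.univ := by
  refine Set.eq_univ_of_forall fun x => ?_
  obtain ⟨y, hy, hlt⟩ := exists_gauge_sub_lt (h x)
  refine ⟨y, hy, x - y, (hK.gauge_le_iff hs).1 ?_, by simp⟩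
  rw [hK.gauge_sub_comm]
  exact hlt.le

/-- Every radius s > r covers, which suffices for an infimum; no nearest lattice point has to exist.
-/
lemma covRadius_le (hK : IsSymmetricConvexBody K) {L : Submodule ℤ (E n)} {r : ℝ} (hr : 0 ≤ r)
    (h : ∀ x, latDist K L x ≤ r) : covRadius K L ≤ r := by
  refine le_of_forall_gt_imp_ge_of_dense fun s hs => ?_
  refine csInf_le ⟨0, fun _ h => h.1⟩ ⟨hr.trans hs.le, ?_⟩
  exact add_smul_eq_univ hK (by linarith) fun x => (h x).trans_lt hs

lemma latDist_smul (hK : IsSymmetricConvexBody K) {L : Submodule ℤ (E n)} {a : ℝ} (ha : 0 < a)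
    (x : E n) : latDist K (a • L) x ≤ a * latDist K L (a⁻¹ • x) := by
  refine le_of_forall_pos_lt_add fun ε hε => ?_
  obtain ⟨y, hy, hlt⟩ := exists_gauge_sub_lt (L := L) (x := a⁻¹ • x) (K := K)
    (lt_add_of_pos_right _ (div_pos hε ha))
  refine (latDist_le (Submodule.smul_mem_pointwise_smul y a L hy)).trans_lt ?_
  have : a • y - x = a • (y - a⁻¹ • x) := by rw [smul_sub, smul_inv_smul₀ ha.ne']
  rw [this, hK.gauge_smul, abs_of_pos ha]
  calc _ < a * (latDist K L (a⁻¹ • x) + ε / a) := by gcongr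
    _ = _ := by field_simp

/-! ## Properties of the densified lattice -/

lemma se_finite (hP : IsPackingLattice K c b bM) (i : Fin n) (t : E n) :
    (gsProjL bM i '' (K + {t}) ∩ gsProjL bM i '' (lat bM : Set (E n))).Finite ∧
    ((gsProjL bM i '' (K + {t}) ∩ gsProjL bM i '' (lat bM : Set (E n))).ncard : ℝ) ≤ c ^ n :=
  hP.se i t

/-- Dividing by the scaling factor turns points of the scaled lattice in K + t into points of Λ in a
translate of (3λ/2)K. The index and `card_le_of_se_of_index` give c^n · c^n (3λ/2 + 1)^n, and 3λ/2 +
1 ≤ 2c. -/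
lemma isSE_smul (hn : 0 < n) (hc : 5 ≤ c) (hK : IsSymmetricConvexBody K)
    (hP : IsPackingLattice K c b bM) {Λ : Submodule ℤ (E n)} (hle : lat bM ≤ Λ)
    (hmin : minDist K Λ = minDist K (lat bM)) {bΛ : Fin n → E n}
    (hΛ : IsDirectionalBasis bΛ Λ bM) :
    IsSE K (fun i => (2 / (3 * minDist K Λ)) • bΛ i) ((2 * c ^ 3) ^ n) := by
  have hM := hP.directional.linearIndependent
  have hl := hP.one_le_minDist
  have hl' := hP.minDist_le
  rw [← hmin] at hl hl'
  set l := minDist K Λ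
  have ha : 0 < 2 / (3 * l) := by positivity
  set a := 2 / (3 * l) with had
  intro i t
  have hdir : ∀ i : Fin n, Submodule.span ℝ ((fun i => a • bΛ i) '' Set.Iic i) =
      Submodule.span ℝ (bM '' Set.Iic i) := by
    intro i
    rw [← hΛ.span_eq i]
    have : (fun i => a • bΛ i) '' Set.Iic i = a • (bΛ '' Set.Iic i) := by
      rw [← Set.image_smul, Set.image_image]
    rw [this]
    exact Submodule.span_smul_eq_of_isUnit _ _ (ha.ne'.isUnit)
  rw [gsProj_congr hdir i, ← coe_gsProjL, ← smul_lat, hΛ.lat_eq]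
  have hidx := index_le_pow hn hK hP (by linarith) hΛ.linearIndependent
    (by rw [hΛ.lat_eq]; exact hle) (by rw [hΛ.lat_eq]; exact hmin)
  have hpos := index_pos hM hΛ.linearIndependent (by rw [hΛ.lat_eq]; exact hle)
  rw [hΛ.lat_eq] at hidx hpos
  have key := card_le_of_se_of_index hK (gsProjL bM i) hpos.ne' (se_finite hP i)
    (r := a⁻¹) (by positivity) (a⁻¹ • t)
  have hsub : gsProjL bM i '' (K + {t}) ∩ gsProjL bM i '' ((a • Λ : Submodule ℤ (E n)) : Set (E n)) ⊆
      (fun x => a • x) '' (gsProjL bM i '' {x | gauge K (x - a⁻¹ • t) ≤ a⁻¹} ∩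
        gsProjL bM i '' (Λ : Set (E n))) := by
    rintro _ ⟨⟨_, ⟨x, hx, t', ht', rfl⟩, rfl⟩, y, hy, hxy⟩
    obtain rfl : t' = t := ht'
    obtain ⟨y, hy', rfl⟩ := Submodule.mem_smul_pointwise_iff_exists _ _ _ |>.1 hy
    refine ⟨gsProjL bM i y, ⟨⟨a⁻¹ • (x + t'), ?_, ?_⟩, y, hy', rfl⟩, ?_⟩
    · simp only [Set.mem_ofPred_eq]
      rw [← smul_sub, add_sub_cancel_right, hK.gauge_smul, abs_of_pos (inv_pos.2 ha)]
      exact mul_le_of_le_one_right (by positivity) (hK.gauge_le_one_iff.2 hx)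
    · rw [map_smul]
      rw [← hxy, map_smul, inv_smul_smul₀ ha.ne']
    · change a • _ = gsProjL bM i (x + t')
      rw [← hxy, map_smul]
  have hfin := (key.1.image (fun x => a • x)).subset hsub
  refine ⟨hfin, ?_⟩
  have h1 : ((gsProjL bM i '' (K + {t}) ∩ gsProjL bM i '' ((a • Λ : Submodule ℤ (E n)) :
      Set (E n))).ncard : ℝ) ≤ index Λ (lat bM) * (c ^ n * (a⁻¹ + 1) ^ n) := by
    refine le_trans ?_ key.2
    exact_mod_cast (Set.ncard_le_ncard hsub (key.1.image _)).trans (Set.ncard_image_le key.1)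
  refine h1.trans ?_
  have hai : a⁻¹ = 3 * l / 2 := by rw [had, inv_div]
  calc (index Λ (lat bM) : ℝ) * (c ^ n * (a⁻¹ + 1) ^ n)
      ≤ c ^ n * (c ^ n * (2 * c) ^ n) := by
        have : a⁻¹ + 1 ≤ 2 * c := by rw [hai]; linarith
        gcongr
    _ = (2 * c ^ 3) ^ n := by rw [← mul_pow, ← mul_pow]; ring

theorem rogersOutput_properties (hn : 0 < n) (hc : 5 ≤ c) (hK : IsSymmetricConvexBody K)
    (hP : IsPackingLattice K c b bM) {Λ : Submodule ℤ (E n)}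
    (h : IsRogersOutput K (lat bM) Λ) :
    lat bM ≤ Λ ∧
    minDist K (lat bM) = minDist K Λ ∧
    covRadius K Λ ≤ 3 / 2 * minDist K Λ ∧
    3 / 2 * minDist K Λ ≤ 3 * c / 2 ∧
    0 < index Λ (lat bM) ∧ (index Λ (lat bM) : ℝ) ≤ c ^ n ∧
    IsCovering K ((2 / (3 * minDist K Λ)) • Λ) ∧
    IsThin K ((2 / (3 * minDist K Λ)) • Λ) (3 ^ n) ∧
    ∀ bΛ : Fin n → E n, IsDirectionalBasis bΛ Λ bM →
      IsSE K (fun i => (2 / (3 * minDist K Λ)) • bΛ i) ((2 * c ^ 3) ^ n) := by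
  have hM := hP.directional.linearIndependent
  obtain ⟨hle, hmin, b', hb'⟩ := rogers_reach hK hn hM h.1
  have hl := hP.one_le_minDist
  have hl' := hP.minDist_le
  have hlat := hb'.lat_eq
  have hthird : ∀ x, (3 : ℤ) • x ∈ lat b' → latDist K (lat b') x ≤ minDist K (lat b') := by
    intro x hx
    by_contra! hlt
    rw [hlat] at hx hlt
    exact h.2 _ ⟨x, hx, hlt, rfl⟩
  have hdist := latDist_le_of_third hK hb'.linearIndependent hthird
  have hidx := index_le_pow hn hK hP (by linarith) hb'.linearIndependent
    (by rw [hlat]; exact hle) (by rw [hlat]; exact hmin)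
  have hpos := index_pos hM hb'.linearIndependent (by rw [hlat]; exact hle)
  have hpack := minDist_pow_mul_vol_le hn.ne' hK hb'.linearIndependent
  have hdet := latDet_pos hb'.linearIndependent
  have hse := fun bΛ => isSE_smul (bΛ := bΛ) hn hc hK hP hle hmin
  rw [← hmin] at hl hl'
  rw [hlat] at hdist hidx hpos hpack hdet
  have hl0 : 0 < minDist K Λ := by linarith
  have ha : 0 < 2 / (3 * minDist K Λ) := by positivity
  refine ⟨hle, hmin.symm, covRadius_le hK (by linarith) hdist, by linarith, hpos, hidx, ?_, ?_,
    hse⟩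
  · refine covRadius_le hK zero_le_one fun x => (latDist_smul hK ha x).trans ?_
    calc _ ≤ 2 / (3 * minDist K Λ) * (3 / 2 * minDist K Λ) := by gcongr; exact hdist _
      _ = 1 := by field_simp
  -- Scaling multiplies the determinant by (2/(3λ))^n, after which thinness is Minkowski's
  -- inequality for Λ.
  · have hsm : latDet ((2 / (3 * minDist K Λ)) • Λ) =
        (2 / (3 * minDist K Λ)) ^ n * latDet Λ := by
      rw [← hlat, smul_lat, latDet_smul hb'.linearIndependent (by rw [hlat]; exact ha)]
    rw [IsThin, hsm, div_le_iff₀ (by positivity), div_pow, mul_pow]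
    have : 3 ^ n * (2 ^ n / (3 ^ n * minDist K Λ ^ n) * latDet Λ) =
        2 ^ n * latDet Λ / minDist K Λ ^ n := by field_simp
    rw [this, le_div_iff₀ (by positivity)]
    linarith

end ThinLattice

namespace ThinLattice

/-! ## Structured memory

A store consists of numbered arrays of integers; array `a` occupies the cells
`1 + a * width n + i`, `i < width n`, and cell `0` holds `n`. -/

/-- A store: the entry `s a i` is the `i`-th entry of the array number `a`. -/
abbrev Store : Type := ℕ → ℕ → ℤ

/-- The number of cells of an array. -/
def width (n : ℕ) : ℕ := n * n + 2 * n + 3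

/-- The memory that represents a store. -/
def enc (n : ℕ) (s : Store) : Mem := fun a =>
  if a = 0 then (n : ℤ) else s ((a - 1) / width n) ((a - 1) % width n)

/-- Replace one entry of a store. -/
def upd (s : Store) (a i : ℕ) (v : ℤ) : Store := Function.update s a (Function.update (s a) i v)

@[simp] lemma upd_same (s : Store) (a i : ℕ) (v : ℤ) : upd s a i v a = Function.update (s a) i v :=
  Function.update_self ..

lemma upd_ne {s : Store} {a i : ℕ} {v : ℤ} {b : ℕ} (h : b ≠ a) : upd s a i v b = s b :=
  Function.update_of_ne h ..

/-- The number of memory cells in use. -/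
def cells (n : ℕ) : ℕ := 1 + 32 * width n

/-- The store uses at most `32` arrays, and its entries have at most `W` bits. -/
structure StoreFits (W : ℕ) (s : Store) : Prop where
  zero : ∀ a, 32 ≤ a → s a = 0
  bound : ∀ a i, |s a i| < 2 ^ W

lemma StoreFits.upd {W : ℕ} {s : Store} (h : StoreFits W s) {a i : ℕ} {v : ℤ} (ha : a < 32)
    (hv : |v| < 2 ^ W) : StoreFits W (upd s a i v) := by
  refine ⟨fun b hb => ?_, fun b j => ?_⟩
  · rw [upd_ne (by omega), h.zero b hb]
  · by_cases hb : b = a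
    · subst hb
      rw [upd_same]
      by_cases hj : j = i
      · subst hj; rwa [Function.update_self]
      · rw [Function.update_of_ne hj]; exact h.bound _ _
    · rw [upd_ne hb]; exact h.bound _ _

variable {n W : ℕ} {s : Store}

lemma width_pos : 0 < width n := by unfold width; omega

lemma enc_addr {a i : ℕ} (hi : i < width n) : enc n s (1 + (a * width n + i)) = s a i := by
  unfold enc
  rw [if_neg (by omega), Nat.add_sub_cancel_left, mul_comm a, Nat.mul_add_div width_pos,
    Nat.div_eq_of_lt hi, Nat.mul_add_mod, Nat.mod_eq_of_lt hi, add_zero]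

lemma update_enc {a i : ℕ} (hi : i < width n) (v : ℤ) :
    Function.update (enc n s) (1 + (a * width n + i)) v = enc n (upd s a i v) := by
  funext x
  by_cases hx : x = 1 + (a * width n + i)
  · subst hx
    rw [Function.update_self, enc_addr hi, upd_same, Function.update_self]
  · rw [Function.update_of_ne hx]
    unfold enc
    by_cases h0 : x = 0
    · rw [if_pos h0, if_pos h0]
    · rw [if_neg h0, if_neg h0]
      by_cases ha : (x - 1) / width n = a
      · rw [ha, upd_same, Function.update_of_ne]
        intro hi'
        have := Nat.div_add_mod (x - 1) (width n)
        rw [ha, hi', mul_comm] at this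
        omega
      · rw [upd_ne ha]

lemma StoreFits.fits (h : StoreFits W s) (hn : (n : ℤ) < 2 ^ W) : Fits (cells n) W (enc n s) := by
  refine ⟨fun a ha => ?_, fun a => ?_⟩
  · unfold cells at ha
    unfold enc
    rw [if_neg (by omega), h.zero, Pi.zero_apply]
    rw [Nat.le_div_iff_mul_le width_pos]
    omega
  · unfold enc
    split_ifs
    · simpa using hn
    · exact h.bound _ _

/-! ## Expressions -/

/-- The dimension. -/
def dimE : Arith := .load (.lit 0)

/-- The address of an array entry. -/
def addrE (a : ℕ) (e : Arith) : Arith :=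
  .add (.lit 1) (.add (.mul (.lit a) (.add (.add (.mul dimE dimE) (.mul (.lit 2) dimE)) (.lit 3))) e)

/-- An array entry. -/
def rd (a : ℕ) (e : Arith) : Arith := .load (addrE a e)

/-- The scalar stored in entry `0` of an array. -/
def sc (a : ℕ) : Arith := rd a (.lit 0)

/-- Assignment to an array entry. -/
def put (a : ℕ) (e v : Arith) : Prog := .store (addrE a e) v

/-- Assignment to a scalar. -/
def set (a : ℕ) (v : Arith) : Prog := put a (.lit 0) v

@[simp] lemma value_dimE : dimE.value (enc n s) = n := by simp [dimE, Arith.value, enc]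

lemma value_addrE {a i : ℕ} {e : Arith} (he : e.value (enc n s) = i) :
    (addrE a e).value (enc n s) = ((1 + (a * width n + i) : ℕ) : ℤ) := by
  simp [addrE, Arith.value, he, width]

lemma value_rd {a i : ℕ} {e : Arith} (he : e.value (enc n s) = i) (hi : i < width n) :
    (rd a e).value (enc n s) = s a i := by
  rw [rd, Arith.value, value_addrE he, Int.toNat_natCast, enc_addr hi]

@[simp] lemma value_sc (a : ℕ) : (sc a).value (enc n s) = s a 0 :=
  value_rd (by simp [Arith.value]) width_pos

/-! ## Total correctness with time bounds -/

/-- Started in `s`, the program halts after at most `T` operations in a store that satisfies `Q`,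
using `cells n` cells of `W` bits. -/
def Wp (O : Query n → Option ℤ) (W : ℕ) (p : Prog) (T : ℕ) (Q : Store → Prop) (s : Store) : Prop :=
  ∃ s' t, Run O (cells n) W p (enc n s) (enc n s') t ∧ t ≤ T ∧ StoreFits W s' ∧ Q s'

variable {O : Query n → Option ℤ} {p p₁ p₂ : Prog} {T T' T₁ T₂ : ℕ} {Q Q' : Store → Prop}

lemma Wp.mono (h : Wp O W p T Q s) (hT : T ≤ T') (hQ : ∀ s', StoreFits W s' → Q s' → Q' s') :
    Wp O W p T' Q' s :=
  let ⟨s', t, h1, h2, h3, h4⟩ := h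
  ⟨s', t, h1, h2.trans hT, h3, hQ s' h3 h4⟩

lemma Wp.seq (h : Wp O W p₁ T₁ Q' s) (h' : ∀ s', StoreFits W s' → Q' s' → Wp O W p₂ T₂ Q s')
    (hT : T₁ + T₂ ≤ T) : Wp O W (.seq p₁ p₂) T Q s := by
  obtain ⟨s', t, h1, h2, h3, h4⟩ := h
  obtain ⟨s'', t', h1', h2', h3', h4'⟩ := h' s' h3 h4
  exact ⟨s'', _, .seq _ _ _ _ _ _ _ h1 h1', by omega, h3', h4'⟩

lemma wp_put {a i : ℕ} {e v : Arith} {x : ℤ} (hn : (n : ℤ) < 2 ^ W) (hs : StoreFits W s)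
    (ha : a < 32) (hi : i < width n) (he : e.value (enc n s) = i) (hv : v.value (enc n s) = x)
    (hx : |x| < 2 ^ W) (hT : (addrE a e).cost + v.cost + 1 ≤ T) (hQ : Q (upd s a i x)) :
    Wp O W (put a e v) T Q s := by
  have hs' := hs.upd ha hx (i := i)
  refine ⟨_, _, ?_, hT, hs', hQ⟩
  have h := Run.store (O := O) (N := cells n) (W := W) (addrE a e) v (enc n s) (hs.fits hn)
  rw [value_addrE he, hv, Int.toNat_natCast, update_enc hi] at h
  exact h (hs'.fits hn)

lemma wp_set {a : ℕ} {v : Arith} {x : ℤ} (hn : (n : ℤ) < 2 ^ W) (hs : StoreFits W s)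
    (ha : a < 32) (hv : v.value (enc n s) = x)
    (hx : |x| < 2 ^ W) (hT : (addrE a (.lit 0)).cost + v.cost + 1 ≤ T) (hQ : Q (upd s a 0 x)) :
    Wp O W (set a v) T Q s :=
  wp_put hn hs ha width_pos (by simp [Arith.value]) hv hx hT hQ

lemma wp_ite {a₁ a₂ : Arith} (h₁ : a₁.value (enc n s) ≤ a₂.value (enc n s) → Wp O W p₁ T' Q s)
    (h₂ : a₂.value (enc n s) < a₁.value (enc n s) → Wp O W p₂ T' Q s)
    (hT : a₁.cost + a₂.cost + 1 + T' ≤ T) : Wp O W (.ite a₁ a₂ p₁ p₂) T Q s := by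
  by_cases h : a₁.value (enc n s) ≤ a₂.value (enc n s)
  · obtain ⟨s', t, h1, h2, h3, h4⟩ := h₁ h
    exact ⟨s', _, .ite_pos _ _ _ _ _ _ _ h h1, by omega, h3, h4⟩
  · obtain ⟨s', t, h1, h2, h3, h4⟩ := h₂ (not_le.1 h)
    exact ⟨s', _, .ite_neg _ _ _ _ _ _ _ h h1, by omega, h3, h4⟩

lemma wp_loop_stop {a₁ a₂ : Arith} (hn : (n : ℤ) < 2 ^ W) (hs : StoreFits W s)
    (h : a₂.value (enc n s) < a₁.value (enc n s)) (hT : a₁.cost + a₂.cost + 1 ≤ T) (hQ : Q s) :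
    Wp O W (.loop a₁ a₂ p) T Q s :=
  ⟨s, _, Run.loop_stop _ _ _ _ (hs.fits hn) (not_le.2 h), hT, hs, hQ⟩

lemma wp_loop_step {a₁ a₂ : Arith} (h : a₁.value (enc n s) ≤ a₂.value (enc n s))
    (hp : Wp O W p T₁ Q' s)
    (h' : ∀ s', StoreFits W s' → Q' s' → Wp O W (.loop a₁ a₂ p) T₂ Q s')
    (hT : a₁.cost + a₂.cost + 1 + T₁ + T₂ ≤ T) :
    Wp O W (.loop a₁ a₂ p) T Q s := by
  obtain ⟨s', t, h1, h2, h3, h4⟩ := hp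
  obtain ⟨s'', t', h1', h2', h3', h4'⟩ := h' s' h3 h4
  exact ⟨s'', _, .loop_step _ _ _ _ _ _ _ _ h h1 h1', by omega, h3', h4'⟩

/-- A counting loop. -/
def forTo (v : ℕ) (bound : Arith) (body : Prog) : Prog :=
  .seq (set v (.lit 0)) (.loop (.add (sc v) (.lit 1)) bound
    (.seq body (set v (.add (sc v) (.lit 1)))))

/-- Induction on the number of rounds left. The bound is evaluated anew in every round, so its value
must follow from the invariant. The body has to leave the counter alone; the invariant for k + 1
refers to the store after the increment. -/
lemma wp_forTo {v N Tb : ℕ} {bound : Arith} (I : ℕ → Store → Prop)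
    (hn : (n : ℤ) < 2 ^ W) (hs : StoreFits W s) (hv : v < 32) (hN : (N : ℤ) < 2 ^ W)
    (hb : ∀ k ≤ N, ∀ s', StoreFits W s' → s' v 0 = k → I k s' → bound.value (enc n s') = N)
    (h0 : I 0 (upd s v 0 0))
    (hstep : ∀ k < N, ∀ s', StoreFits W s' → s' v 0 = k → I k s' →
      Wp O W p Tb (fun s'' => s'' v 0 = k ∧ I (k + 1) (upd s'' v 0 (k + 1))) s')
    (hT : (Tb + bound.cost + 100) * (N + 1) ≤ T)
    (hQ : ∀ s', StoreFits W s' → s' v 0 = N → I N s' → Q s') :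
    Wp O W (forTo v bound p) T Q s := by
  have hc1 : (Arith.add (sc v) (.lit 1)).cost = 21 := rfl
  have hc2 : (addrE v (.lit 0)).cost = 18 := rfl
  have hloop : ∀ m k, k + m = N → ∀ s', StoreFits W s' → s' v 0 = k → I k s' →
      Wp O W (.loop (.add (sc v) (.lit 1)) bound
        (.seq p (set v (.add (sc v) (.lit 1))))) ((Tb + bound.cost + 100) * m + bound.cost + 30) Q s' := by
    intro m
    induction m with
    | zero =>
      intro k hk s' hs' hv' hI
      obtain rfl : k = N := by omega
      refine wp_loop_stop hn hs' ?_ (by omega) (hQ s' hs' hv' hI)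
      rw [hb k le_rfl s' hs' hv' hI]
      simp [Arith.value, hv']
    | succ m ih =>
      intro k hk s' hs' hv' hI
      refine wp_loop_step (T₁ := Tb + 50) (Q' := fun s'' => s'' v 0 = (k + 1 : ℕ) ∧ I (k + 1) s'') ?_ ?_
        (fun s'' hs'' h => ih (k + 1) (by omega) s'' hs'' h.1 h.2) (by rw [hc1]; ring_nf; omega)
      · rw [hb k (by omega) s' hs' hv' hI]
        simp only [Arith.value, value_sc, hv']
        omega
      · refine (hstep k (by omega) s' hs' hv' hI).seq (T₂ := 50) (fun s'' hs'' h => ?_) le_rfl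
        refine wp_set hn hs'' hv (x := k + 1) (by simp [Arith.value, h.1]) ?_ (by omega) ?_
        · rw [abs_of_nonneg (by positivity)]
          have : ((k : ℤ) + 1) ≤ N := by omega
          omega
        · exact ⟨by simp, h.2⟩
  refine (wp_set hn hs hv (x := 0) (T := 50) (Q := fun s' => s' v 0 = (0 : ℕ) ∧ I 0 s')
    (by simp [Arith.value]) (by simp) (by rw [hc2]; simp [Arith.cost]) ⟨by simp, h0⟩).seq
    (fun s' hs' h => hloop N 0 (by omega) s' hs' h.1 h.2) ?_
  ring_nf at hT ⊢
  omega

/-- All arrays outside `F` agree. -/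
def Frame (F : List ℕ) (s s' : Store) : Prop := ∀ a, a ∉ F → s' a = s a

lemma Frame.refl (F : List ℕ) (s : Store) : Frame F s s := fun _ _ => rfl

lemma Frame.trans {F : List ℕ} {s₁ s₂ s₃ : Store} (h : Frame F s₁ s₂) (h' : Frame F s₂ s₃) :
    Frame F s₁ s₃ := fun a ha => (h' a ha).trans (h a ha)

lemma Frame.mono {F F' : List ℕ} {s₁ s₂ : Store} (h : Frame F s₁ s₂) (hF : F ⊆ F') :
    Frame F' s₁ s₂ := fun a ha => h a fun h' => ha (hF h')

lemma Frame.upd {F : List ℕ} {s₁ s₂ : Store} (h : Frame F s₁ s₂) {a : ℕ} (ha : a ∈ F) (i : ℕ)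
    (v : ℤ) : Frame F s₁ (upd s₂ a i v) := fun b hb => by
  rw [upd_ne (by rintro rfl; exact hb ha)]
  exact h b hb

/-- Programs are verified with exactly `cells n` cells; this passes to the polynomial bound of the
theorem. -/
lemma Run.mono {N N' W W' : ℕ} {m m' : Mem} {t : ℕ} (h : Run O N W p m m' t) (hN : N ≤ N')
    (hW : W ≤ W') : Run O N' W' p m m' t := by
  have hF : ∀ m, Fits N W m → Fits N' W' m := fun m hm =>
    ⟨fun a ha => hm.1 a (hN.trans ha), fun a => (hm.2 a).trans_le
      (pow_le_pow_right₀ (by norm_num) hW)⟩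
  induction h with
  | store a e m hm hm' => exact .store a e m (hF _ hm) (hF _ hm')
  | ask a m hm hm' => exact .ask a m (hF _ hm) (hF _ hm')
  | seq p₁ p₂ m₁ m₂ m₃ t₁ t₂ _ _ h₁ h₂ => exact .seq _ _ _ _ _ _ _ h₁ h₂
  | ite_pos a₁ a₂ p₁ p₂ m m' t h _ h₁ => exact .ite_pos _ _ _ _ _ _ _ h h₁
  | ite_neg a₁ a₂ p₁ p₂ m m' t h _ h₁ => exact .ite_neg _ _ _ _ _ _ _ h h₁
  | loop_stop a₁ a₂ p m hm h => exact Run.loop_stop _ _ _ _ (hF _ hm) h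
  | loop_step a₁ a₂ p m m' m'' t t' h _ _ h₁ h₂ => exact .loop_step _ _ _ _ _ _ _ _ h h₁ h₂

end ThinLattice

namespace ThinLattice

/-! ## Subroutines: asking the oracle, copying, reduced row operations

The arrays: `0` query buffer and output, `1` current point, `2` target, `3` reference vector,
`4` best vector, `5` basis matrix. The scalars: `6` level, `7` denominator, `8` radius, `9` success
flag, `10` coefficient, `11` inner loop counter, `13` non-zero flag. -/

/-- The vector stored in an array. -/
def vec (n : ℕ) (s : Store) (a : ℕ) : Fin n → ℤ := fun i => s a i

variable {n W : ℕ} {s : Store} {O : Query n → Option ℤ} {T : ℕ} {Q : Store → Prop}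

lemma lt_width {i : ℕ} (h : i ≤ 2 * n + 2) : i < width n := by unfold width; nlinarith

lemma mul_add_lt {i j : ℕ} (hi : i < n) (hj : j < n) : i * n + j < n * n :=
  calc i * n + j < i * n + n := by omega
    _ = (i + 1) * n := by ring
    _ ≤ n * n := Nat.mul_le_mul_right _ hi

lemma mul_add_lt_width {i j : ℕ} (hi : i < n) (hj : j < n) : i * n + j < width n := by
  have := mul_add_lt hi hj
  unfold width; omega

lemma mul_add_inj {i j i' j' : ℕ} (hj : j < n) (hj' : j' < n) (h : i * n + j = i' * n + j') :
    i = i' ∧ j = j' := by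
  have h1 : (i * n + j) / n = i := by
    rw [mul_comm, Nat.mul_add_div (by omega), Nat.div_eq_of_lt hj, add_zero]
  have h2 : (i' * n + j') / n = i' := by
    rw [mul_comm, Nat.mul_add_div (by omega), Nat.div_eq_of_lt hj', add_zero]
  have : i = i' := by rw [← h1, ← h2, h]
  subst this
  exact ⟨rfl, by omega⟩

lemma abs_natCast_lt {k N : ℕ} (hk : k ≤ N) (hN : (N : ℤ) < 2 ^ W) : |(k : ℤ)| < 2 ^ W := by
  rw [abs_of_nonneg (by positivity)]
  exact lt_of_le_of_lt (by exact_mod_cast hk) hN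

/-- Ask the oracle about the current point. -/
def askP (levE radE : Arith) (ref : ℕ) : Prog :=
  .seq (put 0 (.lit 0) levE) <| .seq (put 0 (.lit 1) (sc 7)) <| .seq (put 0 (.lit 2) radE) <|
  .seq (forTo 11 dimE (.seq (put 0 (.add (.lit 3) (sc 11)) (rd 1 (sc 11)))
    (put 0 (.add (.add (.lit 3) dimE) (sc 11)) (rd ref (sc 11))))) (.ask (.lit 1))

lemma wp_ask (hn : (n : ℤ) < 2 ^ W) (hs : StoreFits W s)
    (hO : ∀ z, O (readQuery n (enc n s) 1) = some z → |z| < 2 ^ W)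
    (hW : 0 < W) (hT : 2 ≤ T)
    (h0 : O (readQuery n (enc n s) 1) = none → Q (upd s 0 0 0))
    (h1 : ∀ z, O (readQuery n (enc n s) 1) = some z → Q (upd (upd s 0 0 1) 0 1 z)) :
    Wp O W (.ask (.lit 1)) T Q s := by
  have hrun := Run.ask (O := O) (N := cells n) (W := W) (.lit 1) (enc n s) (hs.fits hn)
  have e0 : ∀ (s : Store) v, Function.update (enc n s) 1 v = enc n (upd s 0 0 v) := fun s v => by
    have := update_enc (s := s) (a := 0) (i := 0) (n := n) width_pos v
    simpa using this
  have e1 : ∀ (s : Store) v, Function.update (enc n s) 2 v = enc n (upd s 0 1 v) := fun s v => by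
    have := update_enc (s := s) (a := 0) (i := 1) (n := n) (lt_width (by omega)) v
    simpa using this
  have hone : |(1 : ℤ)| < 2 ^ W := by
    rw [abs_one]
    exact one_lt_pow₀ (by norm_num) hW.ne'
  simp only [Arith.value, Int.toNat_one] at hrun
  cases hz : O (readQuery n (enc n s) 1) with
  | none =>
    rw [hz] at hrun
    simp only [writeAnswer, e0] at hrun
    have hf := hs.upd (a := 0) (i := 0) (v := 0) (by omega) (by simp)
    exact ⟨_, _, hrun (hf.fits hn), hT, hf, h0 hz⟩
  | some z =>
    rw [hz] at hrun
    simp only [writeAnswer, e0, Nat.reduceAdd, e1] at hrun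
    have hf := (hs.upd (a := 0) (i := 0) (v := 1) (by omega) hone).upd (a := 0) (i := 1) (v := z)
      (by omega) (hO z hz)
    exact ⟨_, _, hrun (hf.fits hn), hT, hf, h1 z hz⟩

/-- The query is assembled in array 0, that is, from memory address 1 on. The radius is evaluated
only after parts of that array have been overwritten, hence the assumption that its value does not
depend on the arrays 0 and 11. -/
lemma wp_askP {levE radE : Arith} {ref j D : ℕ} {r : ℤ} (hn : (n : ℤ) < 2 ^ W)
    (hs : StoreFits W s) (href : ref = 3 ∨ ref = 4)
    (hlev : levE.value (enc n s) = j) (hjn : j ≤ n)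
    (hD : s 7 0 = D) (hrad : ∀ s', Frame [0, 11] s s' → radE.value (enc n s') = r)
    (hr : |r| < 2 ^ W) (hcl : levE.cost ≤ 30) (hcr : radE.cost ≤ 30)
    (hO : ∀ z, O ⟨j, D, r, vec n s 1, vec n s ref⟩ = some z → |z| < 2 ^ W)
    (hW : 0 < W) (hT : 1000 * (n + 1) ≤ T)
    (h0 : ∀ s', StoreFits W s' → Frame [0, 11] s s' →
      O ⟨j, D, r, vec n s 1, vec n s ref⟩ = none → s' 0 0 = 0 → Q s')
    (h1 : ∀ s' z, StoreFits W s' → Frame [0, 11] s s' →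
      O ⟨j, D, r, vec n s 1, vec n s ref⟩ = some z → s' 0 0 = 1 → s' 0 1 = z → Q s') :
    Wp O W (askP levE radE ref) T Q s := by
  refine Wp.seq (T₁ := 60) (T₂ := T - 60) (Q' := fun s' => Frame [0, 11] s s' ∧ s' 0 0 = j)
    (wp_put hn hs (by omega) (lt_width (by omega)) (i := 0) rfl hlev (abs_natCast_lt hjn hn) ?_ ?_)
    ?_ (by omega)
  · have : (addrE 0 (.lit 0)).cost = 18 := rfl
    omega
  · exact ⟨(Frame.refl _ _).upd (by simp) _ _, by simp⟩
  rintro s₁ hs₁ ⟨hF₁, hb0⟩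
  refine Wp.seq (T₁ := 60) (T₂ := T - 120)
    (Q' := fun s' => Frame [0, 11] s s' ∧ s' 0 0 = j ∧ s' 0 1 = D)
    (wp_put hn hs₁ (by omega) (lt_width (by omega)) (i := 1) rfl (value_sc 7) (hs₁.bound _ _)
      (by decide) ?_) ?_ (by omega)
  · exact ⟨hF₁.upd (by simp) _ _, by simpa using hb0, by simp [hF₁ 7 (by simp), hD]⟩
  rintro s₂ hs₂ ⟨hF₂, hb0, hb1⟩
  refine Wp.seq (T₁ := 60) (T₂ := T - 180)
    (Q' := fun s' => Frame [0, 11] s s' ∧ s' 0 0 = j ∧ s' 0 1 = D ∧ s' 0 2 = r)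
    (wp_put hn hs₂ (by omega) (lt_width (by omega)) (i := 2) rfl (hrad _ hF₂) hr ?_ ?_)
      ?_ (by omega)
  · have : (addrE 0 (.lit 2)).cost = 18 := rfl
    omega
  · exact ⟨hF₂.upd (by simp) _ _, by simpa using hb0, by simpa using hb1, by simp⟩
  rintro s₃ hs₃ ⟨hF₃, hb0, hb1, hb2⟩
  let I : ℕ → Store → Prop := fun k s' => Frame [0, 11] s s' ∧ s' 0 0 = j ∧ s' 0 1 = D ∧
    s' 0 2 = r ∧ ∀ l < k, s' 0 (3 + l) = s 1 l ∧ s' 0 (3 + n + l) = s ref l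
  have href0 : ref ∉ [0, 11] := by rcases href with rfl | rfl <;> simp
  refine Wp.seq (T₁ := T - 190) (T₂ := 5) (Q' := I n)
    (wp_forTo (Tb := 400) I hn hs₃ (by omega) hn (fun _ _ _ _ _ _ => value_dimE)
      ⟨hF₃.upd (by simp) _ _, by simpa [upd_ne] using hb0, by simpa [upd_ne] using hb1,
        by simpa [upd_ne] using hb2, by simp⟩ ?_ ?_ fun s' _ _ h => h) ?_ (by omega)
  · rintro k hk s' hs' hk' ⟨hF, h0', h1', h2', h3'⟩
    have e1 : (rd 1 (sc 11)).value (enc n s') = s 1 k := by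
      rw [value_rd (by simpa using hk') (lt_width (by omega)), hF 1 (by simp)]
    refine Wp.seq (T₁ := 200) (T₂ := 200) (Q' := fun s'' => StoreFits W s'' ∧
      s'' = upd s' 0 (3 + k) (s 1 k))
      (wp_put hn hs' (by omega) (i := 3 + k) (lt_width (by omega))
        (by simp [Arith.value, hk']) e1 ?_ (by decide) ?_) ?_ le_rfl
    · exact hs.bound _ _
    · exact ⟨hs'.upd (by omega) (hs.bound _ _), rfl⟩
    rintro s'' - ⟨hs'', rfl⟩
    refine wp_put hn hs'' (by omega) (i := 3 + n + k) (x := s ref k) (lt_width (by omega))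
        (by simp [Arith.value, hk', upd_ne]) ?_ (hs.bound _ _)
        (by rcases href with rfl | rfl <;> decide) ?_
    · rw [value_rd (i := k) (by simpa [upd_ne] using hk') (lt_width (by omega)), upd_ne (by
        rcases href with rfl | rfl <;> simp), hF ref href0]
    · refine ⟨by simpa [upd_ne] using hk', ((hF.upd (by simp) _ _).upd (by simp) _ _).upd
        (by simp) _ _, ?_, ?_, ?_, ?_⟩
      · rw [upd_ne (by omega), upd_same, Function.update_of_ne (by omega), upd_same,
          Function.update_of_ne (by omega), h0']
      · rw [upd_ne (by omega), upd_same, Function.update_of_ne (by omega), upd_same,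
          Function.update_of_ne (by omega), h1']
      · rw [upd_ne (by omega), upd_same, Function.update_of_ne (by omega), upd_same,
          Function.update_of_ne (by omega), h2']
      · intro l hl
        rw [upd_ne (by omega), upd_same, upd_same]
        rcases Nat.lt_succ_iff_lt_or_eq.1 hl with hl | rfl
        · rw [Function.update_of_ne (by omega), Function.update_of_ne (by omega),
            Function.update_of_ne (by omega)]
          refine ⟨(h3' l hl).1, ?_⟩
          rw [Function.update_of_ne (by omega)]
          exact (h3' l hl).2
        · rw [Function.update_of_ne (by omega), Function.update_self, Function.update_self]
          exact ⟨rfl, rfl⟩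
  · have : dimE.cost = 2 := rfl
    rw [this]
    ring_nf at hT ⊢
    omega
  · rintro s₄ hs₄ ⟨hF₄, hb0, hb1, hb2, hb3⟩
    have hq : readQuery n (enc n s₄) 1 = ⟨j, D, r, vec n s 1, vec n s ref⟩ := by
      have e : ∀ i < width n, enc n s₄ (1 + i) = s₄ 0 i := fun i hi => by
        have := enc_addr (s := s₄) (a := 0) hi
        simpa using this
      unfold readQuery
      congr
      · have := e 0 width_pos
        rw [add_zero] at this
        rw [this, hb0, Int.toNat_natCast]
      · rw [e 1 (lt_width (by omega)), hb1, Int.toNat_natCast]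
      · rw [e 2 (lt_width (by omega)), hb2]
      · funext i
        rw [add_assoc, e _ (lt_width (by omega)), (hb3 i i.2).1]
        rfl
      · funext i
        rw [add_assoc, add_assoc, ← add_assoc 3, e _ (lt_width (by omega)), (hb3 i i.2).2]
        rfl
    refine wp_ask hn hs₄ (by rwa [hq]) hW (by omega) ?_ ?_ <;> rw [hq]
    · intro hz
      exact h0 _ (hs₄.upd (by omega) (by simp)) (hF₄.upd (by simp) _ _) hz (by simp)
    · intro z hz
      refine h1 _ z ((hs₄.upd (by omega) ?_).upd (by omega) (hO z hz))
        ((hF₄.upd (by simp) _ _).upd (by simp) _ _) hz (by simp) (by simp)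
      rw [abs_one]
      exact one_lt_pow₀ (by norm_num) hW.ne'

end ThinLattice

/-! ### Copying vectors and row operations modulo the denominator -/

namespace ThinLattice

variable {n W : ℕ} {s : Store} {O : Query n → Option ℤ} {T : ℕ} {Q : Store → Prop}

/-- Copy a vector. -/
def copyP (dst src : ℕ) : Prog := forTo 11 dimE (put dst (sc 11) (rd src (sc 11)))

lemma cost_addrE (a : ℕ) (e : Arith) : (addrE a e).cost = 17 + e.cost := by
  simp only [addrE, Arith.cost, dimE]; ring

lemma cost_rd (a : ℕ) (e : Arith) : (rd a e).cost = 18 + e.cost := by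
  simp only [rd, Arith.cost, cost_addrE]; ring

lemma cost_sc (a : ℕ) : (sc a).cost = 19 := rfl

lemma wp_copyP {dst src : ℕ} (hn : (n : ℤ) < 2 ^ W) (hs : StoreFits W s) (hd : dst < 32)
    (hd' : dst ≠ 11) (hsrc : src ≠ 11) (hne : src ≠ dst) (hT : 1000 * (n + 1) ≤ T)
    (hQ : ∀ s', StoreFits W s' → Frame [11, dst] s s' → vec n s' dst = vec n s src → Q s') :
    Wp O W (copyP dst src) T Q s := by
  let I : ℕ → Store → Prop := fun k s' => Frame [11, dst] s s' ∧ ∀ l < k, s' dst l = s src l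
  refine wp_forTo (Tb := 100) I hn hs (by omega) hn (fun _ _ _ _ _ _ => value_dimE)
    ⟨(Frame.refl _ _).upd (by simp) _ _, by simp⟩ ?_ ?_ ?_
  · rintro k hk s' hs' hk' ⟨hF, h⟩
    have hF' : s' src = s src := hF src (by simp; omega)
    refine wp_put hn hs' hd (i := k) (x := s src k) (lt_width (by omega)) (by simpa using hk')
      (by rw [value_rd (i := k) (by simpa using hk') (lt_width (by omega)), hF']) (hs.bound _ _)
      ?_ ?_
    · rw [cost_addrE, cost_rd, cost_sc]; omega
    · refine ⟨by rwa [upd_ne hd'.symm], (hF.upd (by simp) _ _).upd (by simp) _ _, ?_⟩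
      intro l hl
      rw [upd_ne hd', upd_same]
      rcases Nat.lt_succ_iff_lt_or_eq.1 hl with hl | rfl
      · rw [Function.update_of_ne (by omega), h l hl]
      · rw [Function.update_self]
  · have : dimE.cost = 2 := rfl
    rw [this]
    ring_nf at hT ⊢
    omega
  · rintro s' hs' - ⟨hF, h⟩
    exact hQ s' hs' hF (funext fun i => h i i.2)

/-- `e` modulo the common denominator. -/
def modE (e : Arith) : Arith := .sub e (.mul (sc 7) (.div e (sc 7)))

/-- Add a multiple of a row of the basis matrix to the first entries of a vector, modulo the common
denominator. -/
def axpyP (dst : ℕ) (coef row bound : Arith) : Prog :=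
  forTo 11 bound (put dst (sc 11) (modE (.add (rd dst (sc 11))
    (.mul coef (rd 5 (.add (.mul (sc 11) dimE) row))))))

/-- Each entry is read before it is replaced, so the entries from k on are still the old ones.
Reduced entries are smaller than the denominator, which fits into a cell; hence the coefficient
needs no bound. -/
lemma wp_axpyP {dst j N D : ℕ} {c : ℤ} {coef row bound : Arith} (hn : (n : ℤ) < 2 ^ W)
    (hs : StoreFits W s) (hd : dst = 1 ∨ dst = 2) (hD : s 7 0 = D) (hD0 : 0 < D)
    (hN : N ≤ n) (hj : j < n)
    (hc : ∀ s', Frame [11, dst] s s' → coef.value (enc n s') = c)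
    (hrow : ∀ s', Frame [11, dst] s s' → row.value (enc n s') = j)
    (hbound : ∀ s', Frame [11, dst] s s' → bound.value (enc n s') = N)
    (hcc : coef.cost ≤ 100) (hcr : row.cost ≤ 100) (hcb : bound.cost ≤ 100)
    (hT : 2000 * (n + 1) ≤ T)
    (hQ : ∀ s', StoreFits W s' → Frame [11, dst] s s' →
      (∀ l < N, s' dst l = (s dst l + c * s 5 (l * n + j)) % D) → (∀ l, N ≤ l → s' dst l = s dst l) →
      Q s') :
    Wp O W (axpyP dst coef row bound) T Q s := by
  have hd32 : dst < 32 := by omega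
  have hd11 : dst ≠ 11 := by omega
  have hd7 : 7 ∉ [11, dst] := by simp; omega
  have hd5 : 5 ∉ [11, dst] := by simp; omega
  let I : ℕ → Store → Prop := fun k s' => Frame [11, dst] s s' ∧
    (∀ l < k, s' dst l = (s dst l + c * s 5 (l * n + j)) % D) ∧ ∀ l, k ≤ l → s' dst l = s dst l
  refine wp_forTo (N := N) (Tb := 1500) I hn hs (by omega)
    (lt_of_le_of_lt (by exact_mod_cast hN) hn) (fun _ _ s' _ _ h => hbound s' h.1)
    ⟨(Frame.refl _ _).upd (by simp) _ _, by simp, fun l _ => by rw [upd_ne hd11]⟩ ?_ ?_ ?_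
  · rintro k hk s' hs' hk' ⟨hF, h, h'⟩
    have hkn : k < n := by omega
    have e1 : (rd dst (sc 11)).value (enc n s') = s dst k := by
      rw [value_rd (i := k) (by simpa using hk') (lt_width (by omega)), h' k le_rfl]
    have e2 : (rd 5 (.add (.mul (sc 11) dimE) row)).value (enc n s') = s 5 (k * n + j) := by
      rw [value_rd (i := k * n + j) ?_ (mul_add_lt_width hkn hj), hF 5 hd5]
      simp [Arith.value, hk', hrow s' hF]
    have hb : |(s dst k + c * s 5 (k * n + j)) % (D : ℤ)| < 2 ^ W := by
      have h7 := hs.bound 7 0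
      rw [hD, abs_of_nonneg (by positivity)] at h7
      rw [abs_of_nonneg (Int.emod_nonneg _ (by omega))]
      exact (Int.emod_lt_of_pos _ (by omega)).trans h7
    refine wp_put hn hs' hd32 (i := k) (x := (s dst k + c * s 5 (k * n + j)) % (D : ℤ))
      (lt_width (by omega)) (by simpa using hk') ?_ hb ?_ ?_
    · simp only [modE, Arith.value, e1, e2, value_sc, hc s' hF, hF 7 hd7, hD]
      rw [Int.emod_def]
    · simp only [modE, cost_addrE, Arith.cost, cost_rd, cost_sc]
      have : dimE.cost = 2 := rfl
      omega
    · refine ⟨by rwa [upd_ne hd11.symm], (hF.upd (by simp) _ _).upd (by simp) _ _, ?_, ?_⟩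
      · intro l hl
        rw [upd_ne hd11, upd_same]
        rcases Nat.lt_succ_iff_lt_or_eq.1 hl with hl | rfl
        · rw [Function.update_of_ne (by omega), h l hl]
        · rw [Function.update_self]
      · intro l hl
        rw [upd_ne hd11, upd_same, Function.update_of_ne (by omega), h' l (by omega)]
  · calc _ ≤ 2000 * (N + 1) := Nat.mul_le_mul_right _ (by omega)
      _ ≤ T := le_trans (by omega) hT
  · rintro s' hs' - ⟨hF, h, h'⟩
    exact hQ s' hs' hF h h'

/-- Move the current point by a multiple of the basis vector of the current level. -/
def advP : Prog :=
  .seq (axpyP 1 (.mul (.lit 3) (sc 10)) (sc 6) (sc 6))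
    (put 1 (sc 6) (.add (rd 1 (sc 6))
      (.mul (.mul (.lit 3) (sc 10)) (rd 5 (.add (.mul (sc 6) dimE) (sc 6))))))

/-- Entries below j are still free and may be reduced. Entry j is the coordinate being enumerated,
so its exact value is kept and must be assumed to fit. The factor 3 adapts the matrix, whose
denominator is a third of that of the point. -/
lemma wp_advP {j D : ℕ} (hn : (n : ℤ) < 2 ^ W)
    (hs : StoreFits W s) (hD : s 7 0 = D) (hD0 : 0 < D) (hj : j < n) (hlev : s 6 0 = j)
    (hb : |s 1 j + 3 * s 10 0 * s 5 (j * n + j)| < 2 ^ W)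
    (hT : 4000 * (n + 1) ≤ T)
    (hQ : ∀ s', StoreFits W s' → Frame [11, 1] s s' →
      (∀ l < j, s' 1 l = (s 1 l + 3 * s 10 0 * s 5 (l * n + j)) % D) →
      s' 1 j = s 1 j + 3 * s 10 0 * s 5 (j * n + j) →
      (∀ l, j < l → s' 1 l = s 1 l) → Q s') :
    Wp O W advP T Q s := by
  refine Wp.seq (T₁ := 2000 * (n + 1)) (T₂ := 300) (wp_axpyP (c := 3 * s 10 0) (j := j) (N := j)
    (Q := fun s' => Frame [11, 1] s s' ∧
      (∀ l < j, s' 1 l = (s 1 l + 3 * s 10 0 * s 5 (l * n + j)) % D) ∧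
      (∀ l, j ≤ l → s' 1 l = s 1 l))
    hn hs (Or.inl rfl) hD hD0 hj.le hj ?_ ?_ ?_ (by decide) (by decide) (by decide) le_rfl
    (fun s' _ hF h h' => ⟨hF, h, h'⟩)) ?_ (by omega)
  · intro s' hF
    simp [Arith.value, hF 10 (by simp)]
  · intro s' hF
    simp [hF 6 (by simp), hlev]
  · intro s' hF
    simp [hF 6 (by simp), hlev]
  · rintro s' hs' ⟨hF, h, h'⟩
    have h6 : s' 6 0 = j := by rw [hF 6 (by simp), hlev]
    refine wp_put hn hs' (by omega) (i := j) (lt_width (by omega)) (by simpa using h6) ?_ hb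
      (by decide) ?_
    · simp only [Arith.value, value_sc]
      rw [value_rd (i := j) (by simpa using h6) (lt_width (by omega)), h' j le_rfl,
        value_rd (i := j * n + j) (by simp [Arith.value, h6]) (mul_add_lt_width hj hj),
        hF 5 (by simp), hF 10 (by simp)]
    · refine hQ _ (hs'.upd (by omega) hb) (hF.upd (by simp) _ _) ?_ ?_ ?_
      · intro l hl
        rw [upd_same, Function.update_of_ne hl.ne, h l hl]
      · simp
      · intro l hl
        rw [upd_same, Function.update_of_ne hl.ne', h' l hl.le]

end ThinLattice

namespace ThinLattice

/-! ## The search tree of the enumeration -/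

section Tree

variable {n : ℕ} {K : Set (E n)} {b : Fin n → E n} {D : ℕ} {ρ : ℝ}

lemma comb_eq_linearCombination (b : Fin n → E n) (w : Fin n → ℝ) :
    comb b w = Fintype.linearCombination ℝ b w := rfl

/-- The norm of the vector with coordinates `p / D`. -/
noncomputable def intNorm (K : Set (E n)) (b : Fin n → E n) (D : ℕ) (p : Fin n → ℤ) : ℝ :=
  gauge K (comb b fun i => (p i : ℝ) / D)

/-- The vector `p / D`, with its first `j` coordinates free, meets the ball of radius `ρ`. -/
def Feasible (K : Set (E n)) (b : Fin n → E n) (D : ℕ) (ρ : ℝ) (j : ℕ) (p : Fin n → ℤ) : Prop :=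
  ∃ w : Fin n → ℝ, (∀ i : Fin n, j ≤ (i : ℕ) → w i = (p i : ℝ) / D) ∧ gauge K (comb b w) ≤ ρ

/-- The possible values of coordinate `j` in the ball of radius `ρ`, for given later coordinates. -/
def fiber (K : Set (E n)) (b : Fin n → E n) (D : ℕ) (ρ : ℝ) (j : Fin n) (p : Fin n → ℤ) : Set ℝ :=
  {x | ∃ w : Fin n → ℝ, (∀ i, j < i → w i = (p i : ℝ) / D) ∧ gauge K (comb b w) ≤ ρ ∧ w j = x}

lemma feasible_zero {p : Fin n → ℤ} : Feasible K b D ρ 0 p ↔ intNorm K b D p ≤ ρ := by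
  constructor
  · rintro ⟨w, hw, h⟩
    rwa [show w = fun i => (p i : ℝ) / D from funext fun i => hw i (Nat.zero_le _)] at h
  · exact fun h => ⟨_, fun _ _ => rfl, h⟩

lemma Feasible.of_eq {j : ℕ} {p q : Fin n → ℤ} (h : Feasible K b D ρ j p)
    (hpq : ∀ i : Fin n, j ≤ (i : ℕ) → q i = p i) : Feasible K b D ρ j q := by
  obtain ⟨w, hw, h⟩ := h
  exact ⟨w, fun i hi => by rw [hw i hi, hpq i hi], h⟩

lemma Feasible.mono {i j : ℕ} {p : Fin n → ℤ} (h : Feasible K b D ρ i p) (hij : i ≤ j) :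
    Feasible K b D ρ j p := by
  obtain ⟨w, hw, h⟩ := h
  exact ⟨w, fun i hi => hw i (hij.trans hi), h⟩

lemma feasible_iff_mem_fiber {j : Fin n} {p q : Fin n → ℤ} (hpq : ∀ i, j < i → q i = p i) :
    Feasible K b D ρ j q ↔ (q j : ℝ) / D ∈ fiber K b D ρ j p := by
  constructor
  · rintro ⟨w, hw, h⟩
    exact ⟨w, fun i hi => by rw [hw i (le_of_lt hi), hpq i hi], h, hw j le_rfl⟩
  · rintro ⟨w, hw, h, hj⟩
    refine ⟨w, fun i hi => ?_, h⟩
    rcases eq_or_lt_of_le (Fin.le_def.2 hi) with rfl | hi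
    · exact hj
    · rw [hw i hi, hpq i hi]

lemma fiber_congr {j : Fin n} {p q : Fin n → ℤ} (hpq : ∀ i, j < i → q i = p i) :
    fiber K b D ρ j q = fiber K b D ρ j p := by
  ext x
  constructor
  · rintro ⟨w, hw, h⟩
    exact ⟨w, fun i hi => by rw [hw i hi, hpq i hi], h⟩
  · rintro ⟨w, hw, h⟩
    exact ⟨w, fun i hi => by rw [hw i hi, hpq i hi], h⟩

/-- The fiber is a linear image of a slice of a ball, hence an interval. Feasible siblings in the
search tree are therefore consecutive, and the first infeasible one beyond a point of the fiber ends
the list. -/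
lemma ordConnected_fiber (hK : IsSymmetricConvexBody K) (j : Fin n) (p : Fin n → ℤ) :
    (fiber K b D ρ j p).OrdConnected := by
  have h1 : Convex ℝ {w : Fin n → ℝ | (∀ i, j < i → w i = (p i : ℝ) / D) ∧
      gauge K (comb b w) ≤ ρ} := by
    rintro w ⟨hw, hw'⟩ v ⟨hv, hv'⟩ s t hs ht hst
    refine ⟨fun i hi => ?_, ?_⟩
    · simp only [Pi.add_apply, Pi.smul_apply, smul_eq_mul, hw i hi, hv i hi]
      rw [← add_mul, hst, one_mul]
    · rw [comb_eq_linearCombination] at *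
      rw [map_add, map_smul, map_smul]
      refine (hK.gauge_add_le _ _).trans ?_
      rw [hK.gauge_smul, hK.gauge_smul, abs_of_nonneg hs, abs_of_nonneg ht]
      calc _ ≤ s * ρ + t * ρ := by gcongr
        _ = ρ := by rw [← add_mul, hst, one_mul]
  have h2 := h1.linear_image (LinearMap.proj j : (Fin n → ℝ) →ₗ[ℝ] ℝ)
  have h3 : fiber K b D ρ j p = (LinearMap.proj j : (Fin n → ℝ) →ₗ[ℝ] ℝ) ''
      {w : Fin n → ℝ | (∀ i, j < i → w i = (p i : ℝ) / D) ∧ gauge K (comb b w) ≤ ρ} := by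
    ext x
    exact ⟨fun ⟨w, h, h', h''⟩ => ⟨w, ⟨h, h'⟩, h''⟩, fun ⟨w, ⟨h, h'⟩, h''⟩ => ⟨w, h, h', h''⟩⟩
  rw [h3]
  exact h2.ordConnected

/-- Forget the first `i` coordinates. -/
def trunc (i : ℕ) (p : Fin n → ℤ) : Fin n → ℤ := fun l => if (l : ℕ) < i then 0 else p l

lemma trunc_apply {i : ℕ} {p : Fin n → ℤ} {l : Fin n} (h : i ≤ (l : ℕ)) : trunc i p l = p l :=
  if_neg (not_lt.2 h)

/-- The nodes of level `i`. -/
def nodes (K : Set (E n)) (b : Fin n → E n) (D : ℕ) (ρ : ℝ) (C : Set (Fin n → ℤ)) (i : ℕ) :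
    Set (Fin n → ℤ) :=
  {q | ∃ p ∈ C, Feasible K b D ρ i p ∧ q = trunc i p}

/-- The proper descendants of a node of level `j`. -/
def below (K : Set (E n)) (b : Fin n → E n) (D : ℕ) (ρ : ℝ) (C : Set (Fin n → ℤ)) (j : ℕ)
    (P : Fin n → ℤ) : Set (ℕ × (Fin n → ℤ)) :=
  {x | ∃ p ∈ C, x.1 < j ∧ (∀ l : Fin n, j ≤ (l : ℕ) → p l = P l) ∧ Feasible K b D ρ x.1 p ∧
    x.2 = trunc x.1 p}

/-- The later siblings of a node of level `j`, with their descendants. -/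
def after (K : Set (E n)) (b : Fin n → E n) (D : ℕ) (ρ : ℝ) (C : Set (Fin n → ℤ)) (j : Fin n)
    (P : Fin n → ℤ) : Set (ℕ × (Fin n → ℤ)) :=
  {x | ∃ p ∈ C, x.1 ≤ j ∧ (∀ l, j < l → p l = P l) ∧ P j < p j ∧ Feasible K b D ρ x.1 p ∧
    x.2 = trunc x.1 p}

/-- A node of level `j` and its earlier siblings. -/
def upto (K : Set (E n)) (b : Fin n → E n) (D : ℕ) (ρ : ℝ) (C : Set (Fin n → ℤ)) (j : Fin n)
    (P : Fin n → ℤ) : Set (Fin n → ℤ) :=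
  {q | ∃ p ∈ C, (∀ l, j < l → p l = P l) ∧ p j ≤ P j ∧ Feasible K b D ρ j p ∧ q = trunc j p}

variable {C : Set (Fin n → ℤ)}

lemma below_subset (j : ℕ) (hj : j ≤ n) (P P' : Fin n → ℤ) :
    below K b D ρ C j P ⊆ below K b D ρ C n P' := by
  rintro x ⟨p, hp, h1, -, h3, h4⟩
  exact ⟨p, hp, h1.trans_le hj, fun l hl => absurd l.2 (not_lt.2 hl), h3, h4⟩

lemma after_subset (j : Fin n) (P P' : Fin n → ℤ) :
    after K b D ρ C j P ⊆ below K b D ρ C n P' := by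
  rintro x ⟨p, hp, h1, -, -, h3, h4⟩
  exact ⟨p, hp, h1.trans_lt j.2, fun l hl => absurd l.2 (not_lt.2 hl), h3, h4⟩

lemma finite_below_and_ncard_le {N : ℕ} (hfin : ∀ i < n, (nodes K b D ρ C i).Finite ∧
    (nodes K b D ρ C i).ncard ≤ N) (P : Fin n → ℤ) :
    (below K b D ρ C n P).Finite ∧ (below K b D ρ C n P).ncard ≤ n * N := by
  have hsub : below K b D ρ C n P ⊆
      ⋃ i ∈ Finset.range n, (fun q => (i, q)) '' nodes K b D ρ C i := by
    rintro ⟨i, q⟩ ⟨p, hp, h1, -, h3, h4⟩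
    simp only [Set.mem_iUnion, Finset.mem_range]
    exact ⟨i, h1, q, ⟨p, hp, h3, h4⟩, rfl⟩
  have hf : (⋃ i ∈ Finset.range n, (fun q => (i, q)) '' nodes K b D ρ C i).Finite :=
    (Finset.range n).finite_toSet.biUnion fun i hi => (hfin i (by simpa using hi)).1.image _
  refine ⟨hf.subset hsub, (Set.ncard_le_ncard hsub hf).trans
    ((Finset.set_ncard_biUnion_le _ _).trans ?_)⟩
  calc _ ≤ ∑ _i ∈ Finset.range n, N := Finset.sum_le_sum fun i hi =>
        (Set.ncard_image_le (hfin i (by simpa using hi)).1).trans (hfin i (by simpa using hi)).2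
    _ = n * N := by simp

/-- What comes after P contains three disjoint parts: the sibling P' itself, the nodes below P', and
what comes after P'. This recursion drives both the termination and the time bound of the search. -/
lemma ncard_after_step (hfin : ∀ P, (below K b D ρ C n P).Finite) {j : Fin n} {P P' : Fin n → ℤ}
    (hP' : P' ∈ C) (hf : Feasible K b D ρ j P') (hgt : ∀ l, j < l → P' l = P l) (hj : P j < P' j) :
    (below K b D ρ C j P').ncard + (after K b D ρ C j P').ncard + 1 ≤
      (after K b D ρ C j P).ncard := by
  have f1 := (hfin P).subset (below_subset (K := K) (b := b) (D := D) (ρ := ρ) (C := C) j j.2.le P' P)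
  have f2 := (hfin P).subset (after_subset (K := K) (b := b) (D := D) (ρ := ρ) (C := C) j P' P)
  have f3 := (hfin P).subset (after_subset (K := K) (b := b) (D := D) (ρ := ρ) (C := C) j P P)
  have hd : Disjoint (below K b D ρ C j P') (after K b D ρ C j P') := by
    rw [Set.disjoint_left]
    rintro ⟨i, q⟩ ⟨p, -, h1, h2, -, h4⟩ ⟨p', -, h1', -, h3', -, h4'⟩
    dsimp only at h1 h4 h4'
    have e1 : q j = P' j := by rw [h4, trunc_apply h1.le, h2 j le_rfl]
    have e2 : q j = p' j := by rw [h4', trunc_apply h1.le]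
    omega
  have hni : ((j : ℕ), trunc j P') ∉ below K b D ρ C j P' ∪ after K b D ρ C j P' := by
    rintro (⟨p, -, h1, -⟩ | ⟨p, -, -, -, h3, -, h4⟩)
    · exact absurd h1 (lt_irrefl _)
    · have := congrFun h4 j
      simp only [trunc_apply le_rfl] at this
      omega
  rw [← Set.ncard_union_eq hd f1 f2, ← Set.ncard_insert_of_notMem hni (f1.union f2)]
  refine Set.ncard_le_ncard ?_ f3
  rintro x (rfl | ⟨p, hp, h1, h2, h3, h4⟩ | ⟨p, hp, h1, h2, h3, h4, h5⟩)
  · exact ⟨P', hP', le_rfl, hgt, hj, hf, rfl⟩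
  · refine ⟨p, hp, h1.le, fun l hl => ?_, ?_, h3, h4⟩
    · rw [h2 l (le_of_lt hl), hgt l hl]
    · rw [h2 j le_rfl]; exact hj
  · exact ⟨p, hp, h1, fun l hl => by rw [h2 l hl, hgt l hl], hj.trans h3, h4, h5⟩

lemma after_subset_below {j : Fin n} {j' : ℕ} (hjj' : j' = j + 1) {P P' : Fin n → ℤ}
    (h : ∀ l : Fin n, j' ≤ (l : ℕ) → P l = P' l) :
    after K b D ρ C j P ⊆ below K b D ρ C j' P' := by
  rintro x ⟨p, hp, h1, h2, -, h4⟩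
  exact ⟨p, hp, by omega, fun l hl => by rw [h2 l (Fin.lt_def.2 (by omega)), h l hl], h4⟩

/-- Siblings are among the nodes below their parent, so a walk along them can be charged to those
nodes. -/
lemma ncard_upto_le (hfin : ∀ P, (below K b D ρ C n P).Finite) {j : Fin n} {j' : ℕ}
    (hjj' : j' = j + 1) {P P' : Fin n → ℤ}
    (h : ∀ l : Fin n, j' ≤ (l : ℕ) → P l = P' l) :
    (upto K b D ρ C j P).Finite ∧
      (upto K b D ρ C j P).ncard ≤ (below K b D ρ C j' P').ncard := by
  have hf := (hfin P).subset
    (below_subset (K := K) (b := b) (D := D) (ρ := ρ) (C := C) j' (by omega) P' P)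
  have hinj : Function.Injective fun q : Fin n → ℤ => ((j : ℕ), q) := fun q q' h => (Prod.ext_iff.1 h).2
  have hsub : (fun q => ((j : ℕ), q)) '' upto K b D ρ C j P ⊆ below K b D ρ C j' P' := by
    rintro _ ⟨q, ⟨p, hp, h1, -, h3, h4⟩, rfl⟩
    exact ⟨p, hp, by dsimp only; omega,
      fun l hl => by rw [h1 l (Fin.lt_def.2 (by omega)), h l hl], h3, h4⟩
  refine ⟨Set.Finite.of_finite_image (hf.subset hsub) hinj.injOn, ?_⟩
  rw [← Set.ncard_image_of_injective _ hinj]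
  exact Set.ncard_le_ncard hsub hf

lemma ncard_upto_step (hfin : (upto K b D ρ C j P).Finite) {P' : Fin n → ℤ}
    (hP : P ∈ C) (hf : Feasible K b D ρ j P) (hgt : ∀ l, j < l → P' l = P l) (hj : P' j < P j) :
    (upto K b D ρ C j P').ncard + 1 ≤ (upto K b D ρ C j P).ncard := by
  have hsub : upto K b D ρ C j P' ⊆ upto K b D ρ C j P := by
    rintro q ⟨p, hp, h1, h2, h3⟩
    exact ⟨p, hp, fun l hl => by rw [h1 l hl, hgt l hl], h2.trans hj.le, h3⟩
  have hni : trunc j P ∉ upto K b D ρ C j P' := by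
    rintro ⟨p, -, -, h2, -, h4⟩
    have := congrFun h4 j
    simp only [trunc_apply le_rfl] at this
    omega
  rw [← Set.ncard_insert_of_notMem hni (hfin.subset hsub)]
  refine Set.ncard_le_ncard ?_ hfin
  rintro q (rfl | hq)
  · exact ⟨P, hP, fun _ _ => rfl, le_rfl, hf, rfl⟩
  · exact hsub hq

end Tree

/-! ## Integer lattices with a triangular basis -/

/-- The rows of `t` form a lower triangular basis of `A`, which contains `D ℤⁿ`. -/
structure IsTriangular {n : ℕ} (D : ℕ) (A : AddSubgroup (Fin n → ℤ)) (t : Fin n → Fin n → ℤ) :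
    Prop where
  pos : 0 < D
  mem : ∀ j, t j ∈ A
  upper : ∀ j l, j < l → t j l = 0
  diag : ∀ j, 0 < t j j
  single : ∀ l, Pi.single l (D : ℤ) ∈ A
  dvd : ∀ u ∈ A, ∀ j, (∀ l, j < l → u l = 0) → t j j ∣ u j

lemma IsTriangular.diag_le {n D : ℕ} {A : AddSubgroup (Fin n → ℤ)} {t : Fin n → Fin n → ℤ}
    (h : IsTriangular D A t) (j : Fin n) : t j j ≤ D := by
  refine Int.le_of_dvd (by exact_mod_cast h.pos) ?_
  have := h.dvd _ (h.single j) j fun l hl => Pi.single_eq_of_ne hl.ne' _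
  simpa using this

/-- Such a vector is an integer combination of the D e_l. Thus coordinates can be reduced modulo D
without leaving a coset of A. -/
lemma IsTriangular.mem_of_dvd {n D : ℕ} {A : AddSubgroup (Fin n → ℤ)} {t : Fin n → Fin n → ℤ}
    (h : IsTriangular D A t) {u : Fin n → ℤ} (hu : ∀ l, (D : ℤ) ∣ u l) : u ∈ A := by
  have : u = ∑ l, (u l / D) • Pi.single l (D : ℤ) := by
    funext i
    rw [Finset.sum_apply, Finset.sum_eq_single i]
    · simp [Int.ediv_mul_cancel (hu i)]
    · intro l _ hl
      simp [Pi.single_eq_of_ne hl.symm]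
    · simp
  rw [this]
  exact A.sum_mem fun l _ => A.zsmul_mem (h.single l) _

end ThinLattice

namespace ThinLattice

/-! ## The enumeration program -/

/-- The data of an enumeration, stored in `s₀`: the points of the coset `C` of the lattice `A` in
the ball of radius `ρ`. -/
structure EnumEnv {n : ℕ} (W : ℕ) (K : Set (E n)) (b : Fin n → E n) (O : Query n → Option ℤ)
    (D : ℕ) (ρ R : ℝ) (A : AddSubgroup (Fin n → ℤ)) (C : Set (Fin n → ℤ))
    (t : Fin n → Fin n → ℤ) (s₀ : Store) : Prop where
  lt_W : (n : ℤ) < 2 ^ W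
  W_pos : 0 < W
  body : IsSymmetricConvexBody K
  oracle : IsOracle K b O
  tri : IsTriangular D A t
  coset_sub : ∀ p ∈ C, ∀ q ∈ C, p - q ∈ A
  coset_add : ∀ p ∈ C, ∀ u ∈ A, p + u ∈ C
  R_nonneg : 0 ≤ R
  coord_le : ∀ w, gauge K (comb b w) ≤ ρ → ∀ i, |w i| ≤ R
  bits : D * (R + 3) < (2 : ℝ) ^ W
  den : s₀ 7 0 = D
  rad : intNorm K b D (vec n s₀ 3) + (s₀ 8 0 : ℝ) / D = ρ
  basis : ∀ j l : Fin n, 3 * s₀ 5 (l * n + j) = t j l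
  fin : ∀ P, (below K b D ρ C n P).Finite

/-- The arrays modified by an enumeration. -/
abbrev scratch : List ℕ := [0, 1, 4, 6, 9, 10, 11, 13]

/-- The best non-zero point of `S` found so far, if any, is stored; it belongs to `G`. -/
def Best {n : ℕ} (K : Set (E n)) (b : Fin n → E n) (D : ℕ) (G S : Set (Fin n → ℤ)) (s : Store) :
    Prop :=
  (s 9 0 = 0 ∧ ∀ p ∈ S, p = 0) ∨ (s 9 0 = 1 ∧ vec n s 4 ∈ G ∧ vec n s 4 ≠ 0 ∧
    ∀ p ∈ S, p ≠ 0 → intNorm K b D (vec n s 4) ≤ intNorm K b D p)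

/-- The points of a coset in the ball of radius `ρ`. -/
def leaves {n : ℕ} (K : Set (E n)) (b : Fin n → E n) (D : ℕ) (ρ : ℝ) (C : Set (Fin n → ℤ)) :
    Set (Fin n → ℤ) := {p | p ∈ C ∧ intNorm K b D p ≤ ρ}

variable {n W : ℕ} {K : Set (E n)} {b : Fin n → E n} {O : Query n → Option ℤ} {D : ℕ} {ρ R : ℝ}
  {A : AddSubgroup (Fin n → ℤ)} {C G S : Set (Fin n → ℤ)} {t : Fin n → Fin n → ℤ} {s₀ s : Store}
  {T : ℕ} {Q : Store → Prop}

lemma Best.congr {s s' : Store} (h : Best K b D G S s) (h4 : s' 4 = s 4) (h9 : s' 9 = s 9) :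
    Best K b D G S s' := by
  have e : vec n s' 4 = vec n s 4 := by unfold vec; rw [h4]
  unfold Best
  rw [e, h9]
  exact h

lemma Best.mono {S' : Set (Fin n → ℤ)} (h : Best K b D G S s) (hS : S' ⊆ S) :
    Best K b D G S' s := by
  rcases h with ⟨h1, h2⟩ | ⟨h1, h2, h3, h4⟩
  · exact Or.inl ⟨h1, fun p hp => h2 p (hS hp)⟩
  · exact Or.inr ⟨h1, h2, h3, fun p hp => h4 p (hS hp)⟩

namespace EnumEnv

lemma abs_lt_pow (env : EnumEnv W K b O D ρ R A C t s₀) {z : ℤ}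
    (h : |(z : ℝ)| ≤ D * (R + 2) + 1) : |z| < 2 ^ W := by
  have h1 : |(z : ℝ)| < 2 ^ W := by
    have hD : (1 : ℝ) ≤ D := by exact_mod_cast env.tri.pos
    have := env.bits
    linarith
  exact_mod_cast h1

lemma abs_le_of_mem_fiber (env : EnumEnv W K b O D ρ R A C t s₀) {j : Fin n} {p : Fin n → ℤ}
    {x : ℝ} (h : x ∈ fiber K b D ρ j p) : |D * x| ≤ D * R := by
  obtain ⟨w, -, h, rfl⟩ := h
  rw [abs_mul, Nat.abs_cast]
  exact mul_le_mul_of_nonneg_left (env.coord_le w h j) (Nat.cast_nonneg _)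

lemma abs_floor_le (env : EnumEnv W K b O D ρ R A C t s₀) {j : Fin n} {p : Fin n → ℤ}
    {x : ℝ} (h : x ∈ fiber K b D ρ j p) : |((⌊D * x⌋ : ℤ) : ℝ)| ≤ D * R + 1 := by
  have h1 := abs_le.1 (env.abs_le_of_mem_fiber h)
  have h2 := Int.floor_le (D * x)
  have h3 := Int.lt_floor_add_one (D * x)
  rw [abs_le]
  constructor <;> linarith

/-- Ask whether the current node is feasible. -/
def _root_.ThinLattice.testP : Prog := askP (sc 6) (sc 8) 3

lemma wp_testP (env : EnumEnv W K b O D ρ R A C t s₀) (hs : StoreFits W s)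
    (hF : Frame scratch s₀ s) {j : ℕ} (hj : j ≤ n) (hlev : s 6 0 = j) (hT : 1000 * (n + 1) ≤ T)
    (h0 : ∀ s', StoreFits W s' → Frame [0, 11] s s' → s' 0 0 = 0 →
      ¬ Feasible K b D ρ j (vec n s 1) → Q s')
    (h1 : ∀ s', StoreFits W s' → Frame [0, 11] s s' → s' 0 0 = 1 →
      Feasible K b D ρ j (vec n s 1) →
      (∀ j' : Fin n, (j' : ℕ) + 1 = j → ∃ x ∈ fiber K b D ρ j' (vec n s 1), s' 0 1 = ⌊D * x⌋) →
      Q s') :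
    Wp O W testP T Q s := by
  have hV : vec n s 3 = vec n s₀ 3 := by unfold vec; rw [hF 3 (by simp)]
  have hρ : gauge K (comb b fun i => (vec n s 3 i : ℝ) / D) + ((s 8 0 : ℤ) : ℝ) / D = ρ := by
    have := env.rad
    rwa [← hV, ← hF 8 (by simp)] at this
  have horacle := env.oracle ⟨j, D, s 8 0, vec n s 1, vec n s 3⟩ hj env.tri.pos
  have hsol : ∀ w, Query.IsSolution K b ⟨j, D, s 8 0, vec n s 1, vec n s 3⟩ w ↔
      (∀ i : Fin n, j ≤ (i : ℕ) → w i = (vec n s 1 i : ℝ) / D) ∧ gauge K (comb b w) ≤ ρ := by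
    intro w
    rw [← hρ]
    rfl
  have hfib : ∀ z, O ⟨j, D, s 8 0, vec n s 1, vec n s 3⟩ = some z →
      Feasible K b D ρ j (vec n s 1) ∧ (j = 0 → z = 0) ∧
      ∀ j' : Fin n, (j' : ℕ) + 1 = j → ∃ x ∈ fiber K b D ρ j' (vec n s 1), z = ⌊D * x⌋ := by
    intro z hz
    obtain ⟨w, hw, hz0, hz1⟩ := horacle.2 z hz
    have hw' := (hsol w).1 hw
    refine ⟨⟨w, hw'⟩, hz0, fun j' hj' => ⟨w j', ⟨w, fun i hi => hw'.1 i ?_, hw'.2, rfl⟩, hz1 j' hj'⟩⟩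
    have := Fin.lt_def.1 hi
    omega
  refine wp_askP env.lt_W hs (Or.inl rfl) (by simpa using hlev) hj
    (by rw [hF 7 (by simp), env.den]) (r := s 8 0)
    (fun s' h => by simp [h 8 (by simp)]) (hs.bound _ _) (by decide) (by decide) ?_ env.W_pos hT ?_ ?_
  · intro z hz
    obtain ⟨-, hz0, hz1⟩ := hfib z hz
    rcases Nat.eq_zero_or_pos j with h | h
    · rw [hz0 h]; simp
    · obtain ⟨x, hx, rfl⟩ := hz1 ⟨j - 1, by omega⟩ (by simp; omega)
      refine env.abs_lt_pow ((env.abs_floor_le hx).trans ?_)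
      have hD : (0 : ℝ) ≤ D := Nat.cast_nonneg _
      linarith
  · intro s' hs' hF' hz hb
    refine h0 s' hs' hF' hb ?_
    rintro ⟨w, hw⟩
    exact horacle.1 hz w ((hsol w).2 hw)
  · intro s' z hs' hF' hz hb hb'
    obtain ⟨hf, -, hz1⟩ := hfib z hz
    exact h1 s' hs' hF' hb hf fun j' hj' => by
      obtain ⟨x, hx, hzx⟩ := hz1 j' hj'
      exact ⟨x, hx, hb'.trans hzx⟩

/-- The reduction of the lower entries changes the point by multiples of D only, which belong to A,
so the coset is preserved. The range 0, …, D - 1 of those entries is what the next descent relies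
on. -/
lemma wp_advP (env : EnumEnv W K b O D ρ R A C t s₀) (hs : StoreFits W s)
    (hF : Frame scratch s₀ s) {j : Fin n} (hlev : s 6 0 = (j : ℕ)) {e : ℤ} (he : s 10 0 = e)
    (hC : vec n s 1 ∈ C) (hb : |((vec n s 1 j + e * t j j : ℤ) : ℝ)| ≤ D * (R + 2) + 1)
    (hT : 4000 * (n + 1) ≤ T)
    (hQ : ∀ s', StoreFits W s' → Frame [11, 1] s s' → vec n s' 1 ∈ C →
      (∀ l, l < j → 0 ≤ vec n s' 1 l ∧ vec n s' 1 l < D) →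
      vec n s' 1 j = vec n s 1 j + e * t j j →
      (∀ l, j < l → vec n s' 1 l = vec n s 1 l) → Q s') :
    Wp O W ThinLattice.advP T Q s := by
  have hB : ∀ l : Fin n, 3 * s 10 0 * s 5 (l * n + j) = e * t j l := fun l => by
    rw [← env.basis j l, hF 5 (by simp), he]; ring
  have hDpos : (0 : ℤ) < D := by exact_mod_cast env.tri.pos
  refine ThinLattice.wp_advP env.lt_W hs (by rw [hF 7 (by simp), env.den]) env.tri.pos j.2 hlev ?_
    hT ?_
  · rw [hB j]
    exact env.abs_lt_pow hb
  · intro s' hs' hF' h1 h2 h3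
    have h1' : ∀ l, l < j → vec n s' 1 l = (vec n s 1 l + e * t j l) % D := fun l hl => by
      rw [← hB l]
      exact h1 l hl
    have h2' : vec n s' 1 j = vec n s 1 j + e * t j j := by
      rw [← hB j]
      exact h2
    have h3' : ∀ l, j < l → vec n s' 1 l = vec n s 1 l := fun l hl => h3 l hl
    refine hQ s' hs' hF' ?_ ?_ h2' h3'
    · have hmem : vec n s' 1 - (vec n s 1 + e • t j) ∈ A := by
        refine env.tri.mem_of_dvd fun l => ?_
        simp only [Pi.sub_apply, Pi.add_apply, Pi.smul_apply, smul_eq_mul]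
        rcases lt_trichotomy l j with hl | rfl | hl
        · rw [h1' l hl]
          exact (Int.mod_modEq _ _).symm.dvd
        · rw [h2']; simp
        · rw [h3' l hl, env.tri.upper j l hl]; simp
      have := env.coset_add _ (env.coset_add _ hC _ (A.zsmul_mem (env.tri.mem j) e)) _ hmem
      simpa using this
    · intro l hl
      rw [h1' l hl]
      exact ⟨Int.emod_nonneg _ hDpos.ne', Int.emod_lt_of_pos _ hDpos⟩

end EnumEnv

/-- A program without effect. -/
def skipP : Prog := set 13 (sc 13)

/-- Test whether the current point is non-zero. -/
def nonzeroP : Prog :=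
  .seq (set 13 (.lit 0)) (forTo 11 dimE
    (.ite (.mul (rd 1 (sc 11)) (rd 1 (sc 11))) (.lit 0) skipP (set 13 (.lit 1))))

/-- Store the current point if it is the best non-zero point so far. -/
def leafP : Prog :=
  .seq nonzeroP (.ite (sc 13) (.lit 0) skipP (.ite (sc 9) (.lit 0)
    (.seq (copyP 4 1) (set 9 (.lit 1)))
    (.seq (askP (.lit 0) (.lit 0) 4) (.ite (sc 0) (.lit 0) skipP (copyP 4 1)))))

lemma wp_skipP (hn : (n : ℤ) < 2 ^ W) (hs : StoreFits W s) (hT : 100 ≤ T)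
    (hQ : ∀ s', StoreFits W s' → (∀ a, s' a = s a) → Q s') : Wp O W skipP T Q s := by
  refine wp_set hn hs (by omega) (value_sc 13) (hs.bound _ _) (le_trans (by decide) hT)
    (hQ _ (hs.upd (by omega) (hs.bound _ _)) fun a => ?_)
  by_cases ha : a = 13
  · subst ha
    rw [upd_same, Function.update_eq_self]
  · rw [upd_ne ha]

lemma one_lt_pow_W (hW : 0 < W) : |(1 : ℤ)| < 2 ^ W := by
  rw [abs_one]
  exact one_lt_pow₀ (by norm_num) hW.ne'

lemma wp_nonzeroP (hn : (n : ℤ) < 2 ^ W) (hW : 0 < W) (hs : StoreFits W s)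
    (hT : 2000 * (n + 1) ≤ T)
    (hQ : ∀ s', StoreFits W s' → Frame [11, 13] s s' →
      ((s' 13 0 = 0 ∧ vec n s 1 = 0) ∨ (s' 13 0 = 1 ∧ vec n s 1 ≠ 0)) → Q s') :
    Wp O W nonzeroP T Q s := by
  let I : ℕ → Store → Prop := fun k s' => Frame [11, 13] s s' ∧
    ((s' 13 0 = 0 ∧ ∀ l < k, s 1 l = 0) ∨ (s' 13 0 = 1 ∧ vec n s 1 ≠ 0))
  refine Wp.seq (T₁ := 100) (T₂ := 1000 * (n + 1)) (Q' := fun s' => Frame [11, 13] s s' ∧ s' 13 0 = 0)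
    (wp_set hn hs (by omega) (x := 0) rfl (by simp) (by decide)
      ⟨(Frame.refl _ _).upd (by simp) _ _, by simp⟩) ?_ (by linarith)
  rintro s₁ hs₁ ⟨hF₁, h13⟩
  refine wp_forTo (Tb := 400) I hn hs₁ (by omega) hn (fun _ _ _ _ _ _ => value_dimE)
    ⟨hF₁.upd (by simp) _ _, Or.inl ⟨by simpa [upd_ne] using h13, by simp⟩⟩ ?_ ?_ ?_
  · rintro k hk s' hs' hk' ⟨hF, h⟩
    have e1 : (rd 1 (sc 11)).value (enc n s') = s 1 k := by
      rw [value_rd (i := k) (by simpa using hk') (lt_width (by omega)), hF 1 (by simp)]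
    refine wp_ite (T' := 100) (fun hle => ?_) (fun hlt => ?_) (by decide)
    · simp only [Arith.value, e1] at hle
      -- The tested condition is that the square of the entry is at most zero.
      have hz : s 1 k = 0 := by nlinarith
      refine wp_skipP hn hs' le_rfl fun s'' _ hs'' => ⟨by rw [hs'', hk'], fun a ha => ?_, ?_⟩
      · rw [upd_ne (by rintro rfl; simp at ha), hs'', hF a ha]
      · rw [upd_ne (by omega), hs'']
        refine h.imp_left fun ⟨h1, h2⟩ => ⟨h1, fun l hl => ?_⟩
        rcases Nat.lt_succ_iff_lt_or_eq.1 hl with hl | rfl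
        · exact h2 l hl
        · exact hz
    · simp only [Arith.value, e1] at hlt
      refine wp_set hn hs' (by omega) (x := 1) rfl (one_lt_pow_W hW) (by decide)
        ⟨by rwa [upd_ne (by omega)], (hF.upd (by simp) _ _).upd (by simp) _ _, Or.inr ⟨?_, ?_⟩⟩
      · rw [upd_ne (by omega)]; simp
      · intro h0
        have : s 1 k = 0 := congrFun h0 ⟨k, hk⟩
        rw [this] at hlt
        simp at hlt
  · have : dimE.cost = 2 := rfl
    rw [this]
    exact Nat.mul_le_mul_right _ (by omega)
  · rintro s' hs' - ⟨hF, h⟩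
    refine hQ s' hs' hF (h.imp_left fun ⟨h1, h2⟩ => ⟨h1, funext fun i => h2 i i.2⟩)

/-- The zero vector changes nothing, and the first non-zero leaf is stored. Afterwards a query of
level 0, with the best vector as reference and radius term 0, compares two norms exactly although
neither is known. -/
lemma EnumEnv.wp_leafP (env : EnumEnv W K b O D ρ R A C t s₀) (hs : StoreFits W s)
    (hF : Frame scratch s₀ s) (hG : vec n s 1 ∈ G) (hB : Best K b D G S s)
    (hT : 6000 * (n + 1) ≤ T)
    (hQ : ∀ s', StoreFits W s' → Frame [0, 4, 9, 11, 13] s s' →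
      Best K b D G (insert (vec n s 1) S) s' → Q s') :
    Wp O W leafP T Q s := by
  have hn := env.lt_W
  have hW := env.W_pos
  refine Wp.seq (T₁ := 2000 * (n + 1)) (T₂ := 4000 * (n + 1)) (Q' := fun s' => Frame [11, 13] s s' ∧
      ((s' 13 0 = 0 ∧ vec n s 1 = 0) ∨ (s' 13 0 = 1 ∧ vec n s 1 ≠ 0)))
    (wp_nonzeroP hn hW hs le_rfl fun s' _ h1 h2 => ⟨h1, h2⟩) ?_ (by linarith)
  rintro s₁ hs₁ ⟨hF₁, h13⟩
  have hF₁' : Frame [0, 4, 9, 11, 13] s s₁ := hF₁.mono (by simp)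
  have hB₁ : Best K b D G S s₁ := hB.congr (hF₁ 4 (by simp)) (hF₁ 9 (by simp))
  have hP₁ : vec n s₁ 1 = vec n s 1 := by unfold vec; rw [hF₁ 1 (by simp)]
  refine wp_ite (T' := 3500 * (n + 1)) (fun hle => ?_) (fun hlt => ?_) (by
    simp only [cost_sc, Arith.cost]; linarith)
  · simp only [Arith.value, value_sc] at hle
    obtain ⟨-, h0⟩ := h13.resolve_right (by omega)
    refine wp_skipP hn hs₁ (by omega) fun s' hs' he => hQ s' hs' ?_ ?_
    · exact fun a ha => by rw [he, hF₁' a ha]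
    · have hB' := hB₁.congr (he 4) (he 9)
      rw [h0]
      rcases hB' with ⟨h1, h2⟩ | ⟨h1, h2, h3, h4⟩
      · exact Or.inl ⟨h1, fun p hp => hp.elim id (h2 p)⟩
      · exact Or.inr ⟨h1, h2, h3, fun p hp hp0 => h4 p (hp.resolve_left hp0) hp0⟩
  · simp only [Arith.value, value_sc] at hlt
    obtain ⟨-, hne⟩ := h13.resolve_left (by omega)
    have hcopy : ∀ s', Frame [0, 4, 9, 11, 13] s s' → s' 9 0 = 1 → vec n s' 4 = vec n s 1 →
        (∀ p ∈ S, p ≠ 0 → intNorm K b D (vec n s 1) ≤ intNorm K b D p) →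
        Best K b D G (insert (vec n s 1) S) s' := by
      intro s' _ h9 h4 hle
      refine Or.inr ⟨h9, by rwa [h4], by rwa [h4], ?_⟩
      rw [h4]
      rintro p (rfl | hp) hp0
      · exact le_rfl
      · exact hle p hp hp0
    refine wp_ite (T' := 3000 * (n + 1)) (fun hle => ?_) (fun hlt => ?_) (by
      simp only [cost_sc, Arith.cost]; linarith)
    · simp only [Arith.value, value_sc] at hle
      refine Wp.seq (T₁ := 1000 * (n + 1)) (T₂ := 100)
        (Q' := fun s' => Frame [11, 4] s₁ s' ∧ vec n s' 4 = vec n s₁ 1)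
        (wp_copyP hn hs₁ (by omega) (by omega) (by omega) (by omega) le_rfl
          fun s' _ h1 h2 => ⟨h1, h2⟩) ?_ (by omega)
      rintro s₂ hs₂ ⟨hF₂, h4⟩
      have hF₃ : Frame [0, 4, 9, 11, 13] s (upd s₂ 9 0 1) :=
        (hF₁'.trans (hF₂.mono (by simp))).upd (by simp) _ _
      have hall : ∀ p ∈ S, p = 0 := by
        rcases hB₁ with h | h
        · exact h.2
        · omega
      refine wp_set hn hs₂ (by omega) (x := 1) rfl (one_lt_pow_W hW) (by decide)
        (hQ _ (hs₂.upd (by omega) (one_lt_pow_W hW)) hF₃ (hcopy _ hF₃ (by simp) ?_ ?_))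
      · rw [← hP₁, ← h4]
        unfold vec
        rw [upd_ne (by omega)]
      · exact fun p hp hp0 => absurd (hall p hp) hp0
    · simp only [Arith.value, value_sc] at hlt
      obtain ⟨h9, hG4, h40, hmin⟩ := hB₁.resolve_left (by omega)
      have horacle := env.oracle ⟨0, D, 0, vec n s₁ 1, vec n s₁ 4⟩ (Nat.zero_le _) env.tri.pos
      have hsol : ∀ w, Query.IsSolution K b ⟨0, D, 0, vec n s₁ 1, vec n s₁ 4⟩ w →
          intNorm K b D (vec n s₁ 1) ≤ intNorm K b D (vec n s₁ 4) := by
        rintro w ⟨hw, hle⟩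
        rw [show w = fun i => (vec n s₁ 1 i : ℝ) / D from funext fun i => hw i (Nat.zero_le _)]
          at hle
        simpa [intNorm] using hle
      have hsol' : intNorm K b D (vec n s₁ 1) ≤ intNorm K b D (vec n s₁ 4) →
          Query.IsSolution K b ⟨0, D, 0, vec n s₁ 1, vec n s₁ 4⟩
            (fun i => (vec n s₁ 1 i : ℝ) / D) :=
        fun h => ⟨fun i _ => rfl, by simpa [intNorm] using h⟩
      refine Wp.seq (T₁ := 1000 * (n + 1)) (T₂ := 1500 * (n + 1)) (Q' := fun s' =>
        Frame [0, 11] s₁ s' ∧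
          ((s' 0 0 = 0 ∧ ¬ intNorm K b D (vec n s₁ 1) ≤ intNorm K b D (vec n s₁ 4)) ∨
          (s' 0 0 = 1 ∧ intNorm K b D (vec n s₁ 1) ≤ intNorm K b D (vec n s₁ 4))))
        (wp_askP (j := 0) (D := D) (r := 0) hn hs₁ (Or.inr rfl) (by simp [Arith.value])
          (Nat.zero_le _)
          (by rw [hF₁ 7 (by simp), hF 7 (by simp), env.den]) (by simp [Arith.value]) (by simp)
          (by decide) (by decide) ?_ hW le_rfl ?_ ?_) ?_ (by linarith)
      · intro z hz
        obtain ⟨w, -, hz0, -⟩ := horacle.2 z hz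
        rw [hz0 rfl]; simp
      · intro s' _ h1 hz hb
        exact ⟨h1, Or.inl ⟨hb, fun hle => horacle.1 hz _ (hsol' hle)⟩⟩
      · intro s' z _ h1 hz hb _
        obtain ⟨w, hw, -⟩ := horacle.2 z hz
        exact ⟨h1, Or.inr ⟨hb, hsol w hw⟩⟩
      rintro s₂ hs₂ ⟨hF₂, hb⟩
      have hF₂' : Frame [0, 4, 9, 11, 13] s s₂ := hF₁'.trans (hF₂.mono (by simp))
      have h4₂ : vec n s₂ 4 = vec n s₁ 4 := by unfold vec; rw [hF₂ 4 (by simp)]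
      have h9₂ : s₂ 9 0 = 1 := by rw [hF₂ 9 (by simp), h9]
      refine wp_ite (T' := 1200 * (n + 1)) (fun hle => ?_) (fun hlt => ?_) (by
        simp only [cost_sc, Arith.cost]; linarith)
      · simp only [Arith.value, value_sc] at hle
        obtain ⟨-, hnle⟩ := hb.resolve_right (by omega)
        refine wp_skipP hn hs₂ (by omega) fun s' hs' he => hQ s' hs' ?_ ?_
        · exact fun a ha => by rw [he, hF₂' a ha]
        · have e4 : vec n s' 4 = vec n s₁ 4 := by rw [← h4₂]; unfold vec; rw [he]
          refine Or.inr ⟨by rw [he, h9₂], by rwa [e4], by rwa [e4], ?_⟩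
          rw [e4]
          rintro p (rfl | hp) hp0
          · rw [← hP₁]
            exact (not_le.1 hnle).le
          · exact hmin p hp hp0
      · simp only [Arith.value, value_sc] at hlt
        obtain ⟨-, hle⟩ := hb.resolve_left (by omega)
        refine wp_copyP hn hs₂ (by omega) (by omega) (by omega) (by omega) (by omega)
          fun s' hs' h1 h2 => ?_
        have hF₃ : Frame [0, 4, 9, 11, 13] s s' := hF₂'.trans (h1.mono (by simp))
        refine hQ s' hs' hF₃ (hcopy s' hF₃ (by rw [h1 9 (by simp), h9₂]) ?_ ?_)
        · rw [h2, ← hP₁]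
          unfold vec
          rw [hF₂ 1 (by simp)]
        · intro p hp hp0
          rw [← hP₁]
          exact hle.trans (hmin p hp hp0)

end ThinLattice

/-! ### Descending to the first feasible child -/

namespace ThinLattice

variable {n W : ℕ} {K : Set (E n)} {b : Fin n → E n} {O : Query n → Option ℤ} {D : ℕ} {ρ R : ℝ}
  {A : AddSubgroup (Fin n → ℤ)} {C G S : Set (Fin n → ℤ)} {t : Fin n → Fin n → ℤ} {s₀ s : Store}
  {T : ℕ} {Q : Store → Prop}

/-- Move down while the current node is feasible. -/
def downP : Prog := .loop (.lit 1) (sc 0) (.seq (set 10 (.lit (-1))) (.seq advP testP))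

/-- Pass to the level below, in front of the first feasible child of the current node. -/
def pushP : Prog :=
  .seq (set 6 (.sub (sc 6) (.lit 1))) <|
  .seq (set 10 (.div (.sub (rd 0 (.lit 1)) (rd 1 (sc 6)))
    (.mul (.lit 3) (rd 5 (.add (.mul (sc 6) dimE) (sc 6)))))) <|
  .seq advP <| .seq testP downP

/-- Some point of the fiber lies between the current point and the next one. -/
def Mid (K : Set (E n)) (b : Fin n → E n) (D : ℕ) (ρ : ℝ) (t : Fin n → Fin n → ℤ) (j : Fin n)
    (P : Fin n → ℤ) : Prop :=
  ∃ x ∈ fiber K b D ρ j P, (P j : ℝ) ≤ D * x ∧ D * x ≤ P j + t j j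

namespace EnumEnv

lemma abs_le_of_feasible (env : EnumEnv W K b O D ρ R A C t s₀) {j : Fin n} {p : Fin n → ℤ}
    (h : Feasible K b D ρ j p) : |(p j : ℝ)| ≤ D * R := by
  have := env.abs_le_of_mem_fiber ((feasible_iff_mem_fiber fun _ _ => rfl).1 h)
  have hD : (D : ℝ) ≠ 0 := by exact_mod_cast env.tri.pos.ne'
  rwa [mul_div_cancel₀ _ hD] at this

lemma diag_le (env : EnumEnv W K b O D ρ R A C t s₀) (j : Fin n) : (t j j : ℝ) ≤ D := by
  exact_mod_cast env.tri.diag_le j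

lemma mid_of_feasible (env : EnumEnv W K b O D ρ R A C t s₀) {j : Fin n} {p q : Fin n → ℤ}
    (h : Feasible K b D ρ j p) (hpq : ∀ l, j < l → q l = p l) (h1 : q j ≤ p j)
    (h2 : p j ≤ q j + t j j) : Mid K b D ρ t j q := by
  have hD : (D : ℝ) ≠ 0 := by exact_mod_cast env.tri.pos.ne'
  refine ⟨(p j : ℝ) / D, ?_, ?_⟩
  · rw [fiber_congr hpq]
    exact (feasible_iff_mem_fiber fun _ _ => rfl).1 h
  · rw [mul_div_cancel₀ _ hD]
    exact ⟨by exact_mod_cast h1, by exact_mod_cast h2⟩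

lemma feasible_of_between (env : EnumEnv W K b O D ρ R A C t s₀) {j : Fin n} {P q : Fin n → ℤ}
    {x y : ℝ} (hx : x ∈ fiber K b D ρ j P) (hy : y ∈ fiber K b D ρ j P)
    (hq : ∀ l, j < l → q l = P l) (h1 : D * x ≤ q j) (h2 : (q j : ℝ) ≤ D * y) :
    Feasible K b D ρ j q := by
  have hD : (0 : ℝ) < D := by exact_mod_cast env.tri.pos
  rw [feasible_iff_mem_fiber hq]
  refine (ordConnected_fiber env.body j P).out hx hy ⟨?_, ?_⟩
  · rw [le_div_iff₀ hD]; linarith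
  · rw [div_le_iff₀ hD]; linarith

/-- N bounds the number of feasible siblings up to the current one, and every round uses up one. On
exit the current point is infeasible but has a point of the fiber on its right, by `Mid`; a feasible
sibling at or before it would contradict convexity. -/
lemma wp_downP (env : EnumEnv W K b O D ρ R A C t s₀) {j : Fin n} (N : ℕ) :
    ∀ s, StoreFits W s → Frame scratch s₀ s → s 6 0 = (j : ℕ) → vec n s 1 ∈ C →
      Mid K b D ρ t j (vec n s 1) →
      ((s 0 0 = 0 ∧ ¬ Feasible K b D ρ j (vec n s 1)) ∨
        (s 0 0 = 1 ∧ Feasible K b D ρ j (vec n s 1))) →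
      (upto K b D ρ C j (vec n s 1)).ncard ≤ N →
      (∀ s', StoreFits W s' → Frame [0, 1, 10, 11] s s' → vec n s' 1 ∈ C →
        Mid K b D ρ t j (vec n s' 1) →
        (∀ p ∈ C, (∀ l, j < l → p l = vec n s' 1 l) → Feasible K b D ρ j p →
          vec n s' 1 j < p j) →
        (∀ l, j < l → vec n s' 1 l = vec n s 1 l) → Q s') →
      Wp O W downP (6000 * (n + 1) * N + 100) Q s := by
  have hD : (0 : ℝ) < D := by exact_mod_cast env.tri.pos
  induction N with
  | zero =>
    intro s hs hF h6 hC hM h0 hN hQ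
    rcases h0 with ⟨h0, hnf⟩ | ⟨-, hf⟩
    · refine wp_loop_stop env.lt_W hs (by simp [Arith.value, h0]) (by simp [Arith.cost, cost_sc])
        (hQ s hs (Frame.refl _ _) hC hM ?_ fun _ _ => rfl)
      intro p hp hpl hpf
      by_contra! hle
      obtain ⟨x, hx, hx1, -⟩ := hM
      refine hnf (env.feasible_of_between ((feasible_iff_mem_fiber hpl).1 hpf) hx (fun _ _ => rfl)
        ?_ hx1)
      rw [mul_div_cancel₀ _ hD.ne']
      exact_mod_cast hle
    · exfalso
      have hfin := (ncard_upto_le env.fin (j := j) rfl (P := vec n s 1) (P' := vec n s 1)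
        fun _ _ => rfl).1
      have : trunc j (vec n s 1) ∈ upto K b D ρ C j (vec n s 1) :=
        ⟨_, hC, fun _ _ => rfl, le_rfl, hf, rfl⟩
      exact absurd ((Set.ncard_pos hfin).2 ⟨_, this⟩) (by omega)
  | succ N ih =>
    intro s hs hF h6 hC hM h0 hN hQ
    rcases h0 with ⟨h0, hnf⟩ | ⟨h0, hf⟩
    · refine wp_loop_stop env.lt_W hs (by simp [Arith.value, h0]) (by simp [Arith.cost, cost_sc])
        (hQ s hs (Frame.refl _ _) hC hM ?_ fun _ _ => rfl)
      intro p hp hpl hpf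
      by_contra! hle
      obtain ⟨x, hx, hx1, -⟩ := hM
      refine hnf (env.feasible_of_between ((feasible_iff_mem_fiber hpl).1 hpf) hx (fun _ _ => rfl)
        ?_ hx1)
      rw [mul_div_cancel₀ _ hD.ne']
      exact_mod_cast hle
    · have hfin := (ncard_upto_le env.fin (j := j) rfl (P := vec n s 1) (P' := vec n s 1)
        fun _ _ => rfl).1
      have hbody : Wp O W (.seq (set 10 (.lit (-1))) (.seq advP testP)) (5500 * (n + 1))
          (fun s' => Frame [0, 1, 10, 11] s s' ∧ vec n s' 1 ∈ C ∧
            vec n s' 1 j = vec n s 1 j - t j j ∧ (∀ l, j < l → vec n s' 1 l = vec n s 1 l) ∧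
            ((s' 0 0 = 0 ∧ ¬ Feasible K b D ρ j (vec n s' 1)) ∨
              (s' 0 0 = 1 ∧ Feasible K b D ρ j (vec n s' 1)))) s := by
        have hm1 : |(-1 : ℤ)| < 2 ^ W := by rw [abs_neg]; exact one_lt_pow_W env.W_pos
        have hs1 := hs.upd (a := 10) (i := 0) (by omega) hm1
        have hv1 : vec n (upd s 10 0 (-1)) 1 = vec n s 1 := by
          unfold vec; rw [upd_ne (by omega)]
        refine Wp.seq (T₁ := 100) (T₂ := 5000 * (n + 1))
          (Q' := fun s' => s' = upd s 10 0 (-1))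
          (wp_set env.lt_W hs (by omega) (x := -1) rfl hm1 (by decide) rfl) ?_ (by linarith)
        rintro s1 - rfl
        refine Wp.seq (T₁ := 4000 * (n + 1)) (T₂ := 1000 * (n + 1))
          (Q' := fun s' => Frame [11, 1] (upd s 10 0 (-1)) s' ∧ vec n s' 1 ∈ C ∧
            vec n s' 1 j = vec n s 1 j - t j j ∧ (∀ l, j < l → vec n s' 1 l = vec n s 1 l))
          (env.wp_advP hs1 (hF.upd (by simp) _ _) (j := j) (by rwa [upd_ne (by omega)])
            (e := -1) (by simp) (by rwa [hv1]) ?_ le_rfl ?_) ?_ (by linarith)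
        · rw [hv1]
          have h1 := abs_le.1 (env.abs_le_of_feasible hf)
          have h2 := env.diag_le j
          have h3 : (0 : ℝ) < t j j := by exact_mod_cast env.tri.diag j
          push_cast
          rw [abs_le]
          constructor <;> linarith
        · intro s' hs' hF' hC' _ hj' hl'
          rw [hv1] at hj' hl'
          exact ⟨hF', hC', by rw [hj']; ring, hl'⟩
        rintro s2 hs2 ⟨hF2, hC2, hj2, hl2⟩
        have hF2' : Frame [0, 1, 10, 11] s s2 :=
          ((Frame.refl _ _).upd (by simp) _ _).trans (hF2.mono (by simp))
        refine env.wp_testP hs2 (hF.trans (hF2'.mono (by simp))) j.2.le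
          (by rw [hF2' 6 (by simp), h6]) le_rfl ?_ ?_
        · intro s' _ hF' hb hnf
          have e : vec n s' 1 = vec n s2 1 := by unfold vec; rw [hF' 1 (by simp)]
          rw [e]
          exact ⟨hF2'.trans (hF'.mono (by simp)), hC2, hj2, hl2, Or.inl ⟨hb, hnf⟩⟩
        · intro s' _ hF' hb hf' _
          have e : vec n s' 1 = vec n s2 1 := by unfold vec; rw [hF' 1 (by simp)]
          rw [e]
          exact ⟨hF2'.trans (hF'.mono (by simp)), hC2, hj2, hl2, Or.inr ⟨hb, hf'⟩⟩
      refine wp_loop_step (by simp [Arith.value, h0]) hbody (T₂ := 6000 * (n + 1) * N + 100) ?_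
        (by simp only [Arith.cost, cost_sc]; linarith)
      rintro s' hs' ⟨hF', hC', hj', hl', h0'⟩
      have htpos := env.tri.diag j
      refine ih s' hs' (hF.trans (hF'.mono (by simp))) (by rw [hF' 6 (by simp), h6]) hC'
        (env.mid_of_feasible hf hl' (by omega) (by omega)) h0' ?_ ?_
      · have := ncard_upto_step hfin hC hf hl' (by omega)
        omega
      · intro s'' hs'' hF'' hC'' hM'' hgt'' hl''
        exact hQ s'' hs'' (hF'.trans hF'') hC'' hM'' hgt'' fun l hl => by rw [hl'' l hl, hl' l hl]

/-- The oracle's answer to the test at the parent rounds some value x in the fiber of coordinate j.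
One jump puts the current point just to the left of x, and the walk of `downP` then moves in front
of all feasible children; its length is at most the number of nodes below the parent. -/
lemma wp_pushP (env : EnumEnv W K b O D ρ R A C t s₀) {j : Fin n} (hs : StoreFits W s)
    (hF : Frame scratch s₀ s) (h6 : s 6 0 = (j : ℕ) + 1) (hC : vec n s 1 ∈ C)
    (hx : ∃ x ∈ fiber K b D ρ j (vec n s 1), s 0 1 = ⌊D * x⌋)
    (hP0 : 0 ≤ vec n s 1 j) (hPD : vec n s 1 j < D)
    (hT : 6000 * (n + 1) * (below K b D ρ C (j + 1) (vec n s 1)).ncard + 6000 * (n + 1) ≤ T)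
    (hQ : ∀ s', StoreFits W s' → Frame [0, 1, 6, 10, 11] s s' → s' 6 0 = (j : ℕ) → vec n s' 1 ∈ C →
      Mid K b D ρ t j (vec n s' 1) →
      (∀ p ∈ C, (∀ l, j < l → p l = vec n s' 1 l) → Feasible K b D ρ j p →
        vec n s' 1 j < p j) →
      (∀ l, j < l → vec n s' 1 l = vec n s 1 l) → Q s') :
    Wp O W pushP T Q s := by
  obtain ⟨x, hx, hz⟩ := hx
  have hn := env.lt_W
  have hfl := env.abs_floor_le hx
  have htpos := env.tri.diag j
  have htD := env.diag_le j
  set N := (below K b D ρ C (j + 1) (vec n s 1)).ncard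
  have hjW : |((j : ℕ) : ℤ)| < 2 ^ W := abs_natCast_lt j.2.le hn
  refine Wp.seq (T₁ := 100) (T₂ := 6000 * (n + 1) * N + 5800 * (n + 1))
    (Q' := fun s' => s' = upd s 6 0 (j : ℕ))
    (wp_set hn hs (by omega) (x := (j : ℕ)) (by simp [Arith.value, h6]) hjW (by decide) rfl)
    ?_ (by linarith)
  rintro s1 hs1 rfl
  have hv1 : vec n (upd s 6 0 (j : ℕ)) 1 = vec n s 1 := by unfold vec; rw [upd_ne (by omega)]
  -- The number of steps of length `t j j` from the current entry to the last admissible value not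
  -- exceeding ⌊D x⌋. It fits into a cell because the entry lies between 0 and D.
  set e : ℤ := (s 0 1 - s 1 j) / t j j with he
  have hP : s 1 j = vec n s 1 j := rfl
  have heb : |e| < 2 ^ W := by
    refine env.abs_lt_pow ?_
    have h1 : |e| ≤ |s 0 1 - s 1 j| := by
      rw [he, abs_le]
      have h2 := Int.ediv_mul_le (s 0 1 - s 1 j) htpos.ne'
      have h3 := Int.lt_ediv_add_one_mul_self (s 0 1 - s 1 j) htpos
      have h4 := neg_abs_le (s 0 1 - s 1 j)
      have h5 := le_abs_self (s 0 1 - s 1 j)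
      have h6 := abs_nonneg (s 0 1 - s 1 j)
      constructor
      · by_contra! hlt
        nlinarith
      · by_contra! hlt
        nlinarith
    have h2 : |(e : ℝ)| ≤ |(s 0 1 : ℝ) - s 1 j| := by exact_mod_cast h1
    refine h2.trans ((abs_sub _ _).trans ?_)
    have h3 : |(s 1 j : ℝ)| ≤ D := by
      rw [hP, abs_of_nonneg (by exact_mod_cast hP0)]
      exact_mod_cast hPD.le
    rw [hz]
    have hD : (0 : ℝ) ≤ D := Nat.cast_nonneg _
    linarith
  refine Wp.seq (T₁ := 300) (T₂ := 6000 * (n + 1) * N + 5500 * (n + 1))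
    (Q' := fun s' => s' = upd (upd s 6 0 (j : ℕ)) 10 0 e)
    (wp_set hn hs1 (by omega) (x := e) ?_ heb (by decide) rfl) ?_ (by linarith)
  · have e1 : (rd 1 (sc 6)).value (enc n (upd s 6 0 (j : ℕ))) = s 1 j := by
      rw [value_rd (i := j) (by simp) (lt_width (by omega)), upd_ne (by omega)]
    have e2 : (rd 0 (.lit 1)).value (enc n (upd s 6 0 (j : ℕ))) = s 0 1 := by
      rw [value_rd (i := 1) (by simp [Arith.value]) (lt_width (by omega)), upd_ne (by omega)]
    have e3 : (rd 5 (.add (.mul (sc 6) dimE) (sc 6))).value (enc n (upd s 6 0 (j : ℕ))) =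
        s 5 (j * n + j) := by
      rw [value_rd (i := j * n + j) (by simp [Arith.value]) (mul_add_lt_width j.2 j.2),
        upd_ne (by omega)]
    simp only [Arith.value, e1, e2, e3]
    rw [he, ← env.basis j j, hF 5 (by simp)]
  rintro s2 hs2 rfl
  have hv2 : vec n (upd (upd s 6 0 (j : ℕ)) 10 0 e) 1 = vec n s 1 := by
    unfold vec; rw [upd_ne (by omega), upd_ne (by omega)]
  have hF2 : Frame [0, 1, 6, 10, 11] s (upd (upd s 6 0 (j : ℕ)) 10 0 e) :=
    ((Frame.refl _ _).upd (by simp) _ _).upd (by simp) _ _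
  have hle : vec n s 1 j + e * t j j ≤ ⌊D * x⌋ := by
    have := Int.ediv_mul_le (s 0 1 - s 1 j) htpos.ne'
    rw [← hz, ← hP]
    linarith
  have hlt : ⌊D * x⌋ < vec n s 1 j + e * t j j + t j j := by
    have := Int.lt_ediv_add_one_mul_self (s 0 1 - s 1 j) htpos
    rw [← hz, ← hP]
    linarith
  have hleR : ((vec n s 1 j + e * t j j : ℤ) : ℝ) ≤ D * x :=
    (Int.cast_le.2 hle).trans (Int.floor_le _)
  -- The entries are integers, so the strict inequality for ⌊D x⌋ leaves room for the fractional
  -- part of D x.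
  have hltR : D * x ≤ ((vec n s 1 j + e * t j j : ℤ) : ℝ) + t j j := by
    have h1 := Int.lt_floor_add_one (D * x)
    have h2 : ((⌊D * x⌋ : ℤ) : ℝ) + 1 ≤ ((vec n s 1 j + e * t j j : ℤ) : ℝ) + t j j := by
      exact_mod_cast hlt
    linarith
  refine Wp.seq (T₁ := 4000 * (n + 1)) (T₂ := 6000 * (n + 1) * N + 1500 * (n + 1))
    (Q' := fun s' => Frame [11, 1] (upd (upd s 6 0 (j : ℕ)) 10 0 e) s' ∧ vec n s' 1 ∈ C ∧
      vec n s' 1 j = vec n s 1 j + e * t j j ∧ (∀ l, j < l → vec n s' 1 l = vec n s 1 l))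
    (env.wp_advP hs2 (hF.trans (hF2.mono (by simp))) (j := j) (by simp [upd_ne])
      (e := e) (by simp) (by rwa [hv2]) ?_ le_rfl ?_) ?_ (by linarith)
  · rw [hv2]
    have h1 := abs_le.1 (env.abs_le_of_mem_fiber hx)
    have hD : (0 : ℝ) ≤ D := Nat.cast_nonneg _
    rw [abs_le]
    constructor <;> linarith
  · intro s' hs' hF' hC' _ hj' hl'
    rw [hv2] at hj' hl'
    exact ⟨hF', hC', hj', hl'⟩
  rintro s3 hs3 ⟨hF3, hC3, hj3, hl3⟩
  have hF3' : Frame [0, 1, 6, 10, 11] s s3 := hF2.trans (hF3.mono (by simp))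
  have h63 : s3 6 0 = (j : ℕ) := by rw [hF3 6 (by simp)]; simp [upd_ne]
  have hM3 : Mid K b D ρ t j (vec n s3 1) := by
    refine ⟨x, ?_, ?_, ?_⟩
    · rwa [fiber_congr hl3]
    · rw [hj3]; exact hleR
    · rw [hj3]; exact hltR
  refine Wp.seq (T₁ := 1000 * (n + 1)) (T₂ := 6000 * (n + 1) * N + 100)
    (Q' := fun s' => Frame [0, 11] s3 s' ∧ ((s' 0 0 = 0 ∧ ¬ Feasible K b D ρ j (vec n s3 1)) ∨
        (s' 0 0 = 1 ∧ Feasible K b D ρ j (vec n s3 1))))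
    (env.wp_testP hs3 (hF.trans (hF3'.mono (by simp))) j.2.le h63 le_rfl
      (fun s' _ h1 h2 h3 => ⟨h1, Or.inl ⟨h2, h3⟩⟩) (fun s' _ h1 h2 h3 _ => ⟨h1, Or.inr ⟨h2, h3⟩⟩))
    ?_ (by linarith)
  rintro s4 hs4 ⟨hF4, h04⟩
  have hF4' : Frame [0, 1, 6, 10, 11] s s4 := hF3'.trans (hF4.mono (by simp))
  have hv4 : vec n s4 1 = vec n s3 1 := by unfold vec; rw [hF4 1 (by simp)]
  refine env.wp_downP N s4 hs4 (hF.trans (hF4'.mono (by simp))) (by rw [hF4 6 (by simp), h63])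
    (by rwa [hv4]) (by rwa [hv4]) (by rwa [hv4]) ?_ ?_
  · rw [hv4]
    exact (ncard_upto_le env.fin rfl fun l hl => hl3 l (Fin.lt_def.2 (by omega))).2
  · intro s' hs' hF' hC' hM' hgt' hl'
    refine hQ s' hs' (hF4'.trans (hF'.mono (by simp))) ?_ hC' hM' hgt' fun l hl => ?_
    · rw [hF' 6 (by simp), hF4 6 (by simp), h63]
    · rw [hl' l hl, hv4, hl3 l hl]

end EnumEnv

end ThinLattice

/-! ### The depth first search -/

namespace ThinLattice

variable {n W : ℕ} {K : Set (E n)} {b : Fin n → E n} {O : Query n → Option ℤ} {D : ℕ} {ρ R : ℝ}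
  {A : AddSubgroup (Fin n → ℤ)} {C G S : Set (Fin n → ℤ)} {t : Fin n → Fin n → ℤ} {s₀ s : Store}
  {T : ℕ} {Q : Store → Prop}

/-- One step of the depth first search. -/
def iterP : Prog :=
  .seq (set 10 (.lit 1)) <| .seq advP <| .seq testP <|
  .ite (sc 0) (.lit 0) (set 6 (.add (sc 6) (.lit 1))) (.ite (sc 6) (.lit 0) leafP pushP)

/-- The depth first search. -/
def searchP : Prog := .loop (.add (sc 6) (.lit 1)) dimE iterP

/-- Find the shortest non-zero vector in the coset of the current point, inside the ball. -/
def enumP : Prog :=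
  .seq (set 9 (.lit 0)) <| .seq (set 6 dimE) <| .seq testP <|
  .seq (.ite (sc 0) (.lit 0) skipP pushP) searchP

/-- The points of the ball below the later siblings of a node of level `j`. -/
def leavesAfter (K : Set (E n)) (b : Fin n → E n) (D : ℕ) (ρ : ℝ) (C : Set (Fin n → ℤ))
    (j : Fin n) (P : Fin n → ℤ) : Set (Fin n → ℤ) :=
  {p | p ∈ leaves K b D ρ C ∧ (∀ l, j < l → p l = P l) ∧ P j < p j}

lemma feasible_of_mem_leaves {p : Fin n → ℤ} (h : p ∈ leaves K b D ρ C) (j : ℕ) :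
    Feasible K b D ρ j p :=
  (feasible_zero.2 h.2).mono (Nat.zero_le j)

lemma leaf_cost_le (x y T : ℕ) {a : ℕ} (hy : y = 80000 * (a + 1)) :
    19 + 1 + 1 + 2 + 1 + 15000 * (a + 1) + (T + x + 20000 * (a + 1)) ≤
      T + (x + y) + 20000 * (a + 1) := by
  subst hy
  linarith

lemma node_cost_le (x y z T : ℕ) {a B w : ℕ} (hw : 20000 * (a + 1) * 5 ≤ w)
    (h : x + y + 20000 * (a + 1) * B + w ≤ z) :
    19 + 1 + 1 + 2 + 1 + (6000 * (a + 1) * B + 12000 * (a + 1)) +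
      (T + x + 20000 * (a + 1) + y + 20000 * (a + 1)) ≤ T + z + 20000 * (a + 1) := by
  have : 0 ≤ (a + 1) * B := Nat.zero_le _
  linarith

namespace EnumEnv

/-- The difference of the two points lies in A and vanishes after j, so the diagonal entry divides
its coordinate j: siblings have spacing at least `t j j`. -/
lemma add_diag_le (env : EnumEnv W K b O D ρ R A C t s₀) {j : Fin n} {P p : Fin n → ℤ}
    (hP : P ∈ C) (hp : p ∈ C) (h : ∀ l, j < l → p l = P l) (hj : P j < p j) :
    P j + t j j ≤ p j := by
  have := env.tri.dvd _ (env.coset_sub p hp P hP) j fun l hl => by simp [h l hl]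
  have := Int.le_of_dvd (by simpa using hj) this
  simp only [Pi.sub_apply] at this
  linarith

/-- Strong induction on the number of nodes still to come. The statement is in continuation form: if
the search resumed one level up takes time T, then the search from here takes T plus the cost of
these nodes. No stack is needed, because the machine remembers only the current point and the level.
`Mid` keeps the next entry bounded and ensures that, if the next sibling is infeasible, all later
ones are. The weight j + 4 of a node drops by one on descending; the difference, summed over the
nodes below, pays for the walk in `pushP`. -/
lemma wp_searchP (env : EnumEnv W K b O D ρ R A C t s₀) (N : ℕ) :
    ∀ (j : Fin n) (S : Set (Fin n → ℤ)) (s : Store), StoreFits W s → Frame scratch s₀ s →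
      s 6 0 = (j : ℕ) → vec n s 1 ∈ C → Mid K b D ρ t j (vec n s 1) →
      Best K b D (leaves K b D ρ C) S s → (after K b D ρ C j (vec n s 1)).ncard ≤ N →
      ∀ (T : ℕ) (Q : Store → Prop),
      (∀ s', StoreFits W s' → Frame scratch s₀ s' → s' 6 0 = (j : ℕ) + 1 → vec n s' 1 ∈ C →
        (∀ l, j < l → vec n s' 1 l = vec n s 1 l) →
        Best K b D (leaves K b D ρ C) (S ∪ leavesAfter K b D ρ C j (vec n s 1)) s' →
        Wp O W searchP T Q s') →
      Wp O W searchP (T + 20000 * (n + 1) * (j + 4) * N + 20000 * (n + 1)) Q s := by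
  induction N using Nat.strong_induction_on with
  | _ N ih =>
  intro j S s hs hF h6 hC hM hB hN T Q hQ
  have hn := env.lt_W
  have hD : (0 : ℝ) < D := by exact_mod_cast env.tri.pos
  have htpos := env.tri.diag j
  have hcond : (Arith.add (sc 6) (.lit 1)).value (enc n s) ≤ dimE.value (enc n s) := by
    simp only [Arith.value, value_sc, value_dimE, h6]
    have := j.2
    omega
  -- advance and test
  have hadv : Wp O W (.seq (set 10 (.lit 1)) <| .seq advP testP) (5500 * (n + 1))
      (fun s' => Frame [0, 1, 10, 11] s s' ∧ vec n s' 1 ∈ C ∧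
        (∀ l, l < j → 0 ≤ vec n s' 1 l ∧ vec n s' 1 l < D) ∧
        vec n s' 1 j = vec n s 1 j + t j j ∧ (∀ l, j < l → vec n s' 1 l = vec n s 1 l) ∧
        ((s' 0 0 = 0 ∧ ¬ Feasible K b D ρ j (vec n s' 1)) ∨
          (s' 0 0 = 1 ∧ Feasible K b D ρ j (vec n s' 1) ∧
          (∀ j' : Fin n, (j' : ℕ) + 1 = j →
            ∃ x ∈ fiber K b D ρ j' (vec n s' 1), s' 0 1 = ⌊D * x⌋)))) s := by
    have h1 := one_lt_pow_W env.W_pos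
    have hs1 := hs.upd (a := 10) (i := 0) (by omega) h1
    have hv1 : vec n (upd s 10 0 1) 1 = vec n s 1 := by
      unfold vec; rw [upd_ne (by omega)]
    refine Wp.seq (T₁ := 100) (T₂ := 5000 * (n + 1))
      (Q' := fun s' => s' = upd s 10 0 1)
      (wp_set hn hs (by omega) (x := 1) rfl h1 (by decide) rfl) ?_ (by linarith)
    rintro s1 - rfl
    refine Wp.seq (T₁ := 4000 * (n + 1)) (T₂ := 1000 * (n + 1))
      (Q' := fun s' => Frame [11, 1] (upd s 10 0 1) s' ∧ vec n s' 1 ∈ C ∧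
        (∀ l, l < j → 0 ≤ vec n s' 1 l ∧ vec n s' 1 l < D) ∧
        vec n s' 1 j = vec n s 1 j + t j j ∧ (∀ l, j < l → vec n s' 1 l = vec n s 1 l))
      (env.wp_advP hs1 (hF.upd (by simp) _ _) (j := j) (by rwa [upd_ne (by omega)])
        (e := 1) (by simp) (by rwa [hv1]) ?_ le_rfl ?_) ?_ (by linarith)
    · rw [hv1]
      obtain ⟨x, hx, hx1, hx2⟩ := hM
      have h1 := abs_le.1 (env.abs_le_of_mem_fiber hx)
      have h2 := env.diag_le j
      have h3 : (0 : ℝ) < t j j := by exact_mod_cast htpos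
      push_cast
      rw [abs_le]
      constructor <;> linarith
    · intro s' hs' hF' hC' hb' hj' hl'
      rw [hv1] at hj' hl'
      exact ⟨hF', hC', hb', by rw [hj']; ring, hl'⟩
    rintro s2 hs2 ⟨hF2, hC2, hb2, hj2, hl2⟩
    have hF2' : Frame [0, 1, 10, 11] s s2 :=
      ((Frame.refl _ _).upd (by simp) _ _).trans (hF2.mono (by simp))
    refine env.wp_testP hs2 (hF.trans (hF2'.mono (by simp))) j.2.le
      (by rw [hF2' 6 (by simp), h6]) le_rfl ?_ ?_
    · intro s' _ hF' hb hnf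
      have e : vec n s' 1 = vec n s2 1 := by unfold vec; rw [hF' 1 (by simp)]
      rw [e]
      exact ⟨hF2'.trans (hF'.mono (by simp)), hC2, hb2, hj2, hl2, Or.inl ⟨hb, hnf⟩⟩
    · intro s' _ hF' hb hf' hx'
      have e : vec n s' 1 = vec n s2 1 := by unfold vec; rw [hF' 1 (by simp)]
      rw [e]
      exact ⟨hF2'.trans (hF'.mono (by simp)), hC2, hb2, hj2, hl2, Or.inr ⟨hb, hf', hx'⟩⟩
  have hstep : ∀ Tb T2 Q2, (∀ s', StoreFits W s' → Frame [0, 1, 10, 11] s s' → vec n s' 1 ∈ C →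
        (∀ l, l < j → 0 ≤ vec n s' 1 l ∧ vec n s' 1 l < D) →
        vec n s' 1 j = vec n s 1 j + t j j → (∀ l, j < l → vec n s' 1 l = vec n s 1 l) →
        ((s' 0 0 = 0 ∧ ¬ Feasible K b D ρ j (vec n s' 1)) ∨
          (s' 0 0 = 1 ∧ Feasible K b D ρ j (vec n s' 1) ∧
          (∀ j' : Fin n, (j' : ℕ) + 1 = j →
            ∃ x ∈ fiber K b D ρ j' (vec n s' 1), s' 0 1 = ⌊D * x⌋))) →
        Wp O W (.ite (sc 0) (.lit 0) (set 6 (.add (sc 6) (.lit 1)))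
          (.ite (sc 6) (.lit 0) leafP pushP)) T2 Q2 s') → 5500 * (n + 1) + T2 ≤ Tb →
      Wp O W iterP Tb Q2 s := by
    intro Tb T2 Q2 h hTb
    obtain ⟨s', t', hr, ht, hs', hF', hC', hb', hj', hl', h0'⟩ := hadv
    obtain ⟨s'', t'', hr'', ht'', hs'', hq⟩ := h s' hs' hF' hC' hb' hj' hl' h0'
    -- In `iterP` the commands are nested to the right, whereas `hadv` treats the first three as one
    -- block; the run is taken apart and reassembled.
    cases hr with
    | seq _ _ _ m₂ _ t1 t2 r1 r2 =>
      cases r2 with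
      | seq _ _ _ m₃ _ t3 t4 r3 r4 =>
        exact ⟨s'', _, .seq _ _ _ _ _ _ _ r1 (.seq _ _ _ _ _ _ _ r3 (.seq _ _ _ _ _ _ _ r4 hr'')),
          by omega, hs'', hq⟩
  obtain ⟨s1, t1, -, -, hs1, hF1, hC1, hb1, hj1, hl1, h01⟩ := id hadv
  clear hs1 hF1 hC1 hb1 hj1 hl1 h01 s1 t1
  by_cases hfeas : ∃ p ∈ C, (∀ l, j < l → p l = vec n s 1 l) ∧ vec n s 1 j + t j j = p j ∧
      Feasible K b D ρ j p
  · obtain ⟨p₀, hp₀, hp₀l, hp₀j, hp₀f⟩ := hfeas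
    have hsib : ∀ s', vec n s' 1 j = vec n s 1 j + t j j → (∀ l, j < l → vec n s' 1 l = vec n s 1 l) →
        Feasible K b D ρ j (vec n s' 1) := by
      intro s' h h'
      refine hp₀f.of_eq fun i hi => ?_
      rcases eq_or_lt_of_le (Fin.le_def.2 hi) with rfl | hi
      · rw [h, hp₀j]
      · rw [h' i hi, hp₀l i hi]
    have hsplit : ∀ s', vec n s' 1 ∈ C → vec n s' 1 j = vec n s 1 j + t j j →
        (∀ l, j < l → vec n s' 1 l = vec n s 1 l) →
        (below K b D ρ C j (vec n s' 1)).ncard + (after K b D ρ C j (vec n s' 1)).ncard + 1 ≤ N := by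
      intro s' h1 h2 h3
      exact (ncard_after_step env.fin h1 (hsib s' h2 h3) h3 (by omega)).trans hN
    rcases Nat.eq_zero_or_pos (j : ℕ) with hj0 | hjpos
    · -- a leaf
      refine wp_loop_step hcond (T₁ := 15000 * (n + 1)) (T₂ := T + 20000 * (n + 1) * (j + 4) * (N - 1)
          + 20000 * (n + 1)) (Q' := fun s' => Frame scratch s₀ s' ∧ s' 6 0 = (j : ℕ) ∧
          vec n s' 1 ∈ C ∧ vec n s' 1 j = vec n s 1 j + t j j ∧
          (∀ l, j < l → vec n s' 1 l = vec n s 1 l) ∧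
          Best K b D (leaves K b D ρ C) (insert (vec n s' 1) S) s')
        (hstep _ (9000 * (n + 1)) _ ?_ (by linarith)) ?_ ?_
      · intro s1 hs1 hF1 hC1 hb1 hj1 hl1 h01
        have hf1 := hsib s1 hj1 hl1
        obtain ⟨h01, -, -⟩ := h01.resolve_left fun h => h.2 hf1
        have h61 : s1 6 0 = (j : ℕ) := by rw [hF1 6 (by simp), h6]
        refine wp_ite (T' := 8000 * (n + 1)) (fun hle => ?_) (fun _ => ?_)
          (by simp only [Arith.cost, cost_sc]; linarith)
        · simp [Arith.value, h01] at hle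
        refine wp_ite (T' := 7000 * (n + 1)) (fun _ => ?_) (fun hlt => ?_)
          (by simp only [Arith.cost, cost_sc]; linarith)
        · have hG1 : vec n s1 1 ∈ leaves K b D ρ C := by
            refine ⟨hC1, feasible_zero.1 ?_⟩
            rwa [hj0] at hf1
          refine env.wp_leafP hs1 (hF.trans (hF1.mono (by simp))) hG1
            (hB.congr (hF1 4 (by simp)) (hF1 9 (by simp))) (by linarith) ?_
          intro s2 hs2 hF2 hB2
          have hv2 : vec n s2 1 = vec n s1 1 := by unfold vec; rw [hF2 1 (by simp)]
          refine ⟨(hF.trans (hF1.mono (by simp))).trans (hF2.mono (by simp)), ?_, ?_⟩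
          · rw [hF2 6 (by simp), h61]
          · rw [hv2]
            exact ⟨hC1, hj1, hl1, hB2⟩
        · simp [Arith.value, h61, hj0] at hlt
      · rintro s1 hs1 ⟨hF1, h61, hC1, hj1, hl1, hB1⟩
        have hsp := hsplit s1 hC1 hj1 hl1
        refine ih (N - 1) (by omega) j _ s1 hs1 hF1 h61 hC1
          (env.mid_of_feasible (hsib s1 hj1 hl1) (fun _ _ => rfl) le_rfl (by omega)) hB1 (by omega)
          T Q ?_
        intro s' hs' hF' h6' hC' hl' hB'
        refine hQ s' hs' hF' h6' hC' (fun l hl => by rw [hl' l hl, hl1 l hl]) (hB'.mono ?_)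
        rintro p (hp | ⟨hp1, hp2, hp3⟩)
        · exact Or.inl (Or.inr hp)
        · have hge := env.add_diag_le hC hp1.1 hp2 hp3
          rcases hge.eq_or_lt with he | hlt
          · refine Or.inl (Or.inl ?_)
            funext l
            rcases eq_or_lt_of_le (Fin.le_def.2 (by omega : (j : ℕ) ≤ (l : ℕ))) with rfl | hl
            · rw [← he, hj1]
            · rw [hp2 l hl, hl1 l hl]
          · exact Or.inr ⟨hp1, fun l hl => by rw [hp2 l hl, hl1 l hl], by rw [hj1]; exact hlt⟩
      · have hNpos : 1 ≤ N := by
          have h1 : 0 < (after K b D ρ C j (vec n s 1)).ncard := by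
            refine (Set.ncard_pos ((env.fin 0).subset (after_subset j _ _))).2 ⟨((j : ℕ), trunc j p₀), ?_⟩
            exact ⟨p₀, hp₀, le_rfl, hp₀l, by omega, hp₀f, rfl⟩
          omega
        obtain ⟨M, rfl⟩ : ∃ M, N = M + 1 := ⟨N - 1, by omega⟩
        simp only [Arith.cost, cost_sc, Nat.add_sub_cancel]
        have : dimE.cost = 2 := rfl
        rw [this, hj0]
        rw [mul_add_one (20000 * (n + 1) * (0 + 4)) M]
        exact leaf_cost_le _ _ _ (by ring)
    · -- an inner node
      obtain ⟨j', hj'⟩ : ∃ j' : Fin n, (j' : ℕ) + 1 = j := ⟨⟨j - 1, by omega⟩, by simp; omega⟩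
      have hjj' : j' < j := Fin.lt_def.2 (by omega)
      set B := (below K b D ρ C j p₀).ncard with hBdef
      set c := (after K b D ρ C j p₀).ncard with hcdef
      have hBC : B + c + 1 ≤ N :=
        (ncard_after_step env.fin hp₀ hp₀f hp₀l (by omega)).trans hN
      have hagree : ∀ s', vec n s' 1 j = vec n s 1 j + t j j →
          (∀ l, j < l → vec n s' 1 l = vec n s 1 l) → ∀ l : Fin n, (j : ℕ) ≤ l →
          vec n s' 1 l = p₀ l := by
        intro s' h h' l hl
        rcases eq_or_lt_of_le (Fin.le_def.2 hl) with rfl | hl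
        · rw [h, hp₀j]
        · rw [h' l hl, hp₀l l hl]
      have hbelow : ∀ s', vec n s' 1 j = vec n s 1 j + t j j →
          (∀ l, j < l → vec n s' 1 l = vec n s 1 l) → below K b D ρ C j (vec n s' 1) =
          below K b D ρ C j p₀ := by
        intro s' h h'
        ext x
        constructor
        · rintro ⟨p, hp, h1, h2, h3⟩
          exact ⟨p, hp, h1, fun l hl => by rw [h2 l hl, hagree s' h h' l hl], h3⟩
        · rintro ⟨p, hp, h1, h2, h3⟩
          exact ⟨p, hp, h1, fun l hl => by rw [h2 l hl, hagree s' h h' l hl], h3⟩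
      have hafter : ∀ s', vec n s' 1 j = vec n s 1 j + t j j →
          (∀ l, j < l → vec n s' 1 l = vec n s 1 l) → after K b D ρ C j (vec n s' 1) =
          after K b D ρ C j p₀ := by
        intro s' h h'
        ext x
        constructor
        · rintro ⟨p, hp, h1, h2, h3, h4⟩
          exact ⟨p, hp, h1, fun l hl => by rw [h2 l hl, hagree s' h h' l hl.le],
            by rwa [← hagree s' h h' j le_rfl], h4⟩
        · rintro ⟨p, hp, h1, h2, h3, h4⟩
          exact ⟨p, hp, h1, fun l hl => by rw [h2 l hl, hagree s' h h' l hl.le],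
            by rwa [hagree s' h h' j le_rfl], h4⟩
      refine wp_loop_step hcond (T₁ := 6000 * (n + 1) * B + 12000 * (n + 1))
        (T₂ := (T + 20000 * (n + 1) * (j + 4) * c + 20000 * (n + 1)) +
          20000 * (n + 1) * (j' + 4) * B + 20000 * (n + 1))
        (Q' := fun s' => Frame scratch s₀ s' ∧ s' 6 0 = (j' : ℕ) ∧
          vec n s' 1 ∈ C ∧ Mid K b D ρ t j' (vec n s' 1) ∧
          (∀ p ∈ C, (∀ l, j' < l → p l = vec n s' 1 l) → Feasible K b D ρ j' p →
            vec n s' 1 j' < p j') ∧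
          vec n s' 1 j = vec n s 1 j + t j j ∧ (∀ l, j < l → vec n s' 1 l = vec n s 1 l) ∧
          Best K b D (leaves K b D ρ C) S s')
        (hstep _ (6000 * (n + 1) * B + 6500 * (n + 1)) _ ?_ (by linarith)) ?_ ?_
      · intro s1 hs1 hF1 hC1 hb1 hj1 hl1 h01
        have hf1 := hsib s1 hj1 hl1
        obtain ⟨h01, -, hx1⟩ := h01.resolve_left fun h => h.2 hf1
        have h61 : s1 6 0 = (j : ℕ) := by rw [hF1 6 (by simp), h6]
        refine wp_ite (T' := 6000 * (n + 1) * B + 6300 * (n + 1)) (fun hle => ?_) (fun _ => ?_)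
          (by simp only [Arith.cost, cost_sc]; linarith)
        · simp [Arith.value, h01] at hle
        refine wp_ite (T' := 6000 * (n + 1) * B + 6000 * (n + 1)) (fun hle => ?_) (fun hlt => ?_)
          (by simp only [Arith.cost, cost_sc]; linarith)
        · simp only [Arith.value, value_sc, h61] at hle
          omega
        · refine env.wp_pushP (j := j') hs1 (hF.trans (hF1.mono (by simp))) ?_ hC1 (hx1 j' hj')
            (hb1 j' hjj').1 (hb1 j' hjj').2 ?_ ?_
          · rw [h61, ← hj']; push_cast; ring
          · rw [hj', hbelow s1 hj1 hl1]
          · intro s2 hs2 hF2 h62 hC2 hM2 hgt2 hl2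
            exact ⟨(hF.trans (hF1.mono (by simp))).trans (hF2.mono (by simp)), h62, hC2, hM2, hgt2,
              by rw [hl2 j hjj', hj1], fun l hl => by rw [hl2 l (hjj'.trans hl), hl1 l hl],
              hB.congr ((hF2 4 (by simp)).trans (hF1 4 (by simp)))
                ((hF2 9 (by simp)).trans (hF1 9 (by simp)))⟩
      · rintro s1 hs1 ⟨hF1, h61, hC1, hM1, hgt1, hj1, hl1, hB1⟩
        have hN1 : (after K b D ρ C j' (vec n s1 1)).ncard ≤ B := by
          rw [hBdef, ← hbelow s1 hj1 hl1]
          exact Set.ncard_le_ncard (after_subset_below hj'.symm fun _ _ => rfl)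
            ((env.fin 0).subset (below_subset _ j.2.le _ _))
        -- The children are searched first, and the continuation is the search among the later
        -- siblings of their parent. Both searches have fewer nodes to come than the present one.
        refine ih B (by omega) j' S s1 hs1 hF1 h61 hC1 hM1 hB1 hN1 _ Q ?_
        intro s2 hs2 hF2 h62 hC2 hl2 hB2
        have hj2 : vec n s2 1 j = vec n s 1 j + t j j := by rw [hl2 j hjj', hj1]
        have hl2' : ∀ l, j < l → vec n s2 1 l = vec n s 1 l := fun l hl => by
          rw [hl2 l (hjj'.trans hl), hl1 l hl]
        refine ih c (by omega) j _ s2 hs2 hF2 (by rw [h62, ← hj']; push_cast; ring) hC2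
          (env.mid_of_feasible (hsib s2 hj2 hl2') (fun _ _ => rfl) le_rfl (by omega)) hB2
          (by rw [hafter s2 hj2 hl2']) T Q ?_
        intro s' hs' hF' h6' hC' hl' hB'
        refine hQ s' hs' hF' h6' hC' (fun l hl => by rw [hl' l hl, hl2' l hl]) (hB'.mono ?_)
        rintro p (hp | ⟨hp1, hp2, hp3⟩)
        · exact Or.inl (Or.inl hp)
        · have hge := env.add_diag_le hC hp1.1 hp2 hp3
          rcases hge.eq_or_lt with he | hlt
          · refine Or.inl (Or.inr ?_)
            have hpl : ∀ l, j' < l → p l = vec n s1 1 l := by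
              intro l hl
              rcases eq_or_lt_of_le (Fin.le_def.2 (by have := Fin.lt_def.1 hl; omega :
                (j : ℕ) ≤ (l : ℕ))) with rfl | hl
              · rw [← he, hj1]
              · rw [hp2 l hl, hl1 l hl]
            exact ⟨hp1, hpl, hgt1 p hp1.1 hpl (feasible_of_mem_leaves hp1 _)⟩
          · exact Or.inr ⟨hp1, fun l hl => by rw [hp2 l hl, hl2' l hl], by rw [hj2]; exact hlt⟩
      · simp only [Arith.cost, cost_sc]
        have h2 : dimE.cost = 2 := rfl
        rw [h2]
        have e1 : 20000 * (n + 1) * (j + 4) * (B + c + 1) ≤ 20000 * (n + 1) * ((j : ℕ) + 4) * N :=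
          Nat.mul_le_mul_left _ hBC
        have e2 : (j : ℕ) = j' + 1 := hj'.symm
        rw [e2] at e1 ⊢
        have e4 : 20000 * (n + 1) * (j' + 1 + 4) * (B + c + 1) =
            20000 * (n + 1) * (j' + 1 + 4) * c + 20000 * (n + 1) * (j' + 4) * B +
              20000 * (n + 1) * B + 20000 * (n + 1) * (j' + 5) := by ring
        rw [e4] at e1
        exact node_cost_le _ _ _ _ (Nat.mul_le_mul_left _ (by omega)) e1
  · -- no further sibling
    refine wp_loop_step hcond (T₁ := 6000 * (n + 1)) (T₂ := T)
      (Q' := fun s' => Frame scratch s₀ s' ∧ s' 6 0 = (j : ℕ) + 1 ∧ vec n s' 1 ∈ C ∧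
        (∀ l, j < l → vec n s' 1 l = vec n s 1 l) ∧ Best K b D (leaves K b D ρ C) S s')
      (hstep _ 300 _ ?_ (by linarith)) ?_ ?_
    · intro s1 hs1 hF1 hC1 hb1 hj1 hl1 h01
      have hnf : ¬ Feasible K b D ρ j (vec n s1 1) := fun hf =>
        hfeas ⟨_, hC1, hl1, hj1.symm, hf⟩
      obtain ⟨h01, -⟩ := h01.resolve_right fun h => hnf h.2.1
      have h61 : s1 6 0 = (j : ℕ) := by rw [hF1 6 (by simp), h6]
      refine wp_ite (T' := 100) (fun _ => ?_) (fun hlt => ?_) (by decide)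
      · refine wp_set hn hs1 (by omega) (x := ((j + 1 : ℕ) : ℤ)) (by simp [Arith.value, h61])
          (abs_natCast_lt j.2 hn) (by decide) ⟨?_, by simp, ?_⟩
        · exact (hF.trans (hF1.mono (by simp))).upd (by simp) _ _
        · have hv : vec n (upd s1 6 0 ((j + 1 : ℕ) : ℤ)) 1 = vec n s1 1 := by
            unfold vec; rw [upd_ne (by omega)]
          rw [hv]
          refine ⟨hC1, hl1, hB.congr ?_ ?_⟩
          · rw [upd_ne (by omega), hF1 4 (by simp)]
          · rw [upd_ne (by omega), hF1 9 (by simp)]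
      · simp [Arith.value, h01] at hlt
    · rintro s1 hs1 ⟨hF1, h61, hC1, hl1, hB1⟩
      refine hQ s1 hs1 hF1 h61 hC1 hl1 (hB1.mono ?_)
      rintro p (hp | ⟨hp1, hp2, hp3⟩)
      · exact hp
      · exfalso
        have hge := env.add_diag_le hC hp1.1 hp2 hp3
        obtain ⟨x, hx, hx1, hx2⟩ := hM
        -- The next candidate lies between the point of the fiber given by `Mid` and the coordinate
        -- of the supposed later leaf, so convexity makes it feasible, contrary to the case
        -- assumption.
        have hq : Feasible K b D ρ j (vec n s 1 + t j) := by
          have hpf := (feasible_iff_mem_fiber hp2).1 (feasible_of_mem_leaves hp1 j)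
          refine env.feasible_of_between hx hpf (fun l hl => ?_) ?_ ?_
          · simp [env.tri.upper j l hl]
          · simpa using hx2
          · rw [mul_div_cancel₀ _ hD.ne']
            exact_mod_cast hge
        exact hfeas ⟨_, env.coset_add _ hC _ (env.tri.mem j),
          fun l hl => by simp [env.tri.upper j l hl], by simp, hq⟩
    · simp only [Arith.cost, cost_sc]
      have : dimE.cost = 2 := rfl
      rw [this]
      have : 0 ≤ 20000 * (n + 1) * ((j : ℕ) + 4) * N := Nat.zero_le _
      linarith

/-- At level n all coordinates are free, so the first query asks only whether the ball is non-empty,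
and its answer locates the last coordinate. The search is over as soon as the level is n again. -/
theorem wp_enumP (env : EnumEnv W K b O D ρ R A C t s₀) (hn0 : 0 < n) (hs : StoreFits W s₀)
    (hC : vec n s₀ 1 ∈ C) (hb : ∀ i, 0 ≤ vec n s₀ 1 i ∧ vec n s₀ 1 i < D) {N : ℕ}
    (hN : ∀ P, (below K b D ρ C n P).ncard ≤ N)
    (hT : 20000 * (n + 1) * (n + 6) * (N + 1) ≤ T)
    (hQ : ∀ s', StoreFits W s' → Frame scratch s₀ s' →
      Best K b D (leaves K b D ρ C) (leaves K b D ρ C) s' → Q s') :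
    Wp O W enumP T Q s₀ := by
  have hn := env.lt_W
  have hU : 6000 * (n + 1) * N + 7000 * (n + 1) +
      (20000 * (n + 1) * (n + 5) * N + 21000 * (n + 1)) + 1000 * (n + 1) + 200 ≤ T := by
    have e1 : 20000 * (n + 1) * (n + 6) * (N + 1) =
        20000 * (n + 1) * (n + 5) * N + 20000 * (n + 1) * N + 20000 * (n + 1) * (n + 6) := by ring
    have e2 : 20000 * (n + 1) * 6 ≤ 20000 * (n + 1) * (n + 6) := Nat.mul_le_mul_left _ (by linarith)
    have e3 : 0 ≤ (n + 1) * N := Nat.zero_le _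
    linarith
  set U := 6000 * (n + 1) * N + 7000 * (n + 1) + (20000 * (n + 1) * (n + 5) * N + 21000 * (n + 1))
    with hUdef
  let last : Fin n := ⟨n - 1, by omega⟩
  have hlast : (last : ℕ) + 1 = n := by simp [last]; omega
  refine Wp.seq (T₁ := 100) (T₂ := U + 1000 * (n + 1) + 100) (Q' := fun s' => Frame scratch s₀ s' ∧ s' 9 0 = 0 ∧
      vec n s' 1 = vec n s₀ 1)
    (wp_set hn hs (by omega) (x := 0) rfl (by simp) (by decide)
      ⟨(Frame.refl _ _).upd (by simp) _ _, by simp, ?_⟩) ?_ (by linarith)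
  · unfold vec; rw [upd_ne (by omega)]
  rintro s1 hs1 ⟨hF1, h91, hv1⟩
  refine Wp.seq (T₁ := 100) (T₂ := U + 1000 * (n + 1)) (Q' := fun s' => Frame scratch s₀ s' ∧ s' 9 0 = 0 ∧
      vec n s' 1 = vec n s₀ 1 ∧ s' 6 0 = n)
    (wp_set hn hs1 (by omega) (x := n) value_dimE (by simpa using hn) (by decide)
      ⟨hF1.upd (by simp) _ _, by rwa [upd_ne (by omega)], ?_, by simp⟩) ?_ (by linarith)
  · rw [← hv1]; unfold vec; rw [upd_ne (by omega)]
  rintro s2 hs2 ⟨hF2, h92, hv2, h62⟩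
  refine Wp.seq (T₁ := 1000 * (n + 1)) (T₂ := U)
    (Q' := fun s' => Frame scratch s₀ s' ∧ s' 9 0 = 0 ∧
      vec n s' 1 = vec n s₀ 1 ∧ s' 6 0 = n ∧
      ((s' 0 0 = 0 ∧ ¬ Feasible K b D ρ n (vec n s' 1)) ∨
        (s' 0 0 = 1 ∧ ∃ x ∈ fiber K b D ρ last (vec n s' 1), s' 0 1 = ⌊D * x⌋)))
    (env.wp_testP hs2 hF2 le_rfl h62 le_rfl ?_ ?_) ?_ (by linarith)
  · intro s' _ hF' h0 hnf
    have e : vec n s' 1 = vec n s2 1 := by unfold vec; rw [hF' 1 (by simp)]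
    rw [e]
    exact ⟨hF2.trans (hF'.mono (by simp)), by rw [hF' 9 (by simp), h92], hv2,
      by rw [hF' 6 (by simp), h62], Or.inl ⟨h0, hnf⟩⟩
  · intro s' _ hF' h0 _ hx
    have e : vec n s' 1 = vec n s2 1 := by unfold vec; rw [hF' 1 (by simp)]
    rw [e]
    exact ⟨hF2.trans (hF'.mono (by simp)), by rw [hF' 9 (by simp), h92], hv2,
      by rw [hF' 6 (by simp), h62], Or.inr ⟨h0, hx last hlast⟩⟩
  rintro s3 hs3 ⟨hF3, h93, hv3, h63, h03⟩
  have hagree : ∀ p : Fin n → ℤ, ∀ l, last < l → p l = vec n s3 1 l := fun p l hl => by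
    have := Fin.lt_def.1 hl
    omega
  refine Wp.seq (T₁ := 6000 * (n + 1) * N + 7000 * (n + 1))
    (T₂ := 20000 * (n + 1) * (n + 5) * N + 21000 * (n + 1))
    (Q' := fun s' => (Frame scratch s₀ s' ∧ s' 6 0 = n ∧ s' 9 0 = 0 ∧
        ¬ Feasible K b D ρ n (vec n s3 1)) ∨ (Frame scratch s₀ s' ∧ s' 6 0 = (last : ℕ) ∧ s' 9 0 = 0 ∧
        vec n s' 1 ∈ C ∧ Mid K b D ρ t last (vec n s' 1) ∧
        (∀ p ∈ C, (∀ l, last < l → p l = vec n s' 1 l) → Feasible K b D ρ last p →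
        vec n s' 1 last < p last)))
    (wp_ite (T' := 6000 * (n + 1) * N + 6500 * (n + 1)) (fun hle => ?_) (fun hlt => ?_) ?_) ?_ ?_
  · simp only [Arith.value, value_sc] at hle
    obtain ⟨-, hnf⟩ := h03.resolve_right (by omega)
    refine wp_skipP hn hs3 (le_trans (by omega) (Nat.le_add_left (6500 * (n + 1)) _)) fun s' _ he => Or.inl ⟨fun a ha => ?_, ?_, ?_, hnf⟩
    · rw [he, hF3 a ha]
    · rw [he, h63]
    · rw [he, h93]
  · simp only [Arith.value, value_sc] at hlt
    obtain ⟨-, hx⟩ := h03.resolve_left (by omega)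
    refine env.wp_pushP (j := last) hs3 hF3 (by rw [h63]; exact_mod_cast hlast.symm) (by rwa [hv3])
      hx (by rw [hv3]; exact (hb last).1) (by rw [hv3]; exact (hb last).2) ?_ ?_
    · have : (below K b D ρ C (last + 1) (vec n s3 1)).ncard ≤ N := by
        rw [hlast]; exact hN _
      have := Nat.mul_le_mul_left (6000 * (n + 1)) this
      linarith
    · intro s' _ hF' h6' hC' hM' hgt' _
      exact Or.inr ⟨hF3.trans (hF'.mono (by simp)), h6', by rw [hF' 9 (by simp), h93], hC', hM', hgt'⟩
  · simp only [Arith.cost, cost_sc]; linarith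
  · rintro s4 hs4 (⟨hF4, h64, h94, hnf⟩ | ⟨hF4, h64, h94, hC4, hM4, hgt4⟩)
    · refine wp_loop_stop hn hs4 (by simp [Arith.value, h64]) ?_ (hQ s4 hs4 hF4 ?_)
      · have : dimE.cost = 2 := rfl
        simp only [Arith.cost, cost_sc, this]
        exact le_trans (by omega) (Nat.le_add_left (21000 * (n + 1)) _)
      · refine Or.inl ⟨h94, fun p hp => absurd ?_ hnf⟩
        exact (feasible_of_mem_leaves hp n).of_eq fun i hi => absurd i.2 (not_lt.2 hi)
    · have hle : (after K b D ρ C last (vec n s4 1)).ncard ≤ N :=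
        (Set.ncard_le_ncard (after_subset last _ (vec n s4 1)) (env.fin _)).trans (hN _)
      have hB4 : Best K b D (leaves K b D ρ C) ∅ s4 := Or.inl ⟨h94, by simp⟩
      refine (env.wp_searchP N last ∅ s4 hs4 hF4 h64 hC4 hM4 hB4 hle 100 Q ?_).mono ?_
        fun _ _ h => h
      · intro s' hs' hF' h6' _ hl' hB'
        refine wp_loop_stop hn hs' ?_ ?_ (hQ s' hs' hF' (hB'.mono ?_))
        · simp only [Arith.value, value_sc, value_dimE, h6']
          have : ((last : ℕ) : ℤ) + 1 = n := by exact_mod_cast hlast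
          omega
        · have : dimE.cost = 2 := rfl
          simp only [Arith.cost, cost_sc, this]
          omega
        · intro p hp
          have hpl : ∀ l, last < l → p l = vec n s4 1 l := fun l hl => by
            have := Fin.lt_def.1 hl
            omega
          exact Or.inr ⟨hp, hpl, hgt4 p hp.1 hpl (feasible_of_mem_leaves hp _)⟩
      · have e : (last : ℕ) + 4 ≤ n + 5 := by omega
        have := Nat.mul_le_mul_right N (Nat.mul_le_mul_left (20000 * (n + 1)) e)
        linarith
  · exact hUdef.ge

end EnumEnv

end ThinLattice

namespace ThinLattice

/-! ## Rational bases in integer coordinates -/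

variable {n : ℕ} {K : Set (E n)} {b : Fin n → E n} {D : ℕ} {B : Fin n → Fin n → ℤ}

/-- The vector with coordinates `u / D`. -/
noncomputable def scaled (b : Fin n → E n) (D : ℕ) : (Fin n → ℤ) →+ E n where
  toFun u := comb b fun i => (u i : ℝ) / D
  map_zero' := by simp [comb]
  map_add' u v := by simp [comb, add_div, add_smul, Finset.sum_add_distrib]

lemma scaled_apply (b : Fin n → E n) (D : ℕ) (u : Fin n → ℤ) :
    scaled b D u = comb b fun i => (u i : ℝ) / D := rfl

lemma intNorm_eq (p : Fin n → ℤ) : intNorm K b D p = gauge K (scaled b D p) := rfl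

lemma comb_injective (hb : LinearIndependent ℝ b) : Function.Injective (comb b) := by
  have := LinearIndependent.fintypeLinearCombination_injective hb
  exact this

lemma scaled_injective (hb : LinearIndependent ℝ b) (hD : 0 < D) :
    Function.Injective (scaled b D) := fun u v h => by
  have h1 := comb_injective hb h
  funext i
  have h2 := congrFun h1 i
  have hD' : (D : ℝ) ≠ 0 := by exact_mod_cast hD.ne'
  rw [div_left_inj' hD'] at h2
  exact_mod_cast h2

lemma scaled_mul {m : ℕ} (hm : 0 < m) (u : Fin n → ℤ) :
    scaled b (m * D) ((m : ℤ) • u) = scaled b D u := by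
  rw [scaled_apply, scaled_apply]
  congr 1
  funext i
  have : (m : ℝ) ≠ 0 := by exact_mod_cast hm.ne'
  simp only [Pi.smul_apply, smul_eq_mul]
  push_cast
  exact mul_div_mul_left _ _ this

lemma scaled_single (hD : 0 < D) (l : Fin n) : scaled b D (Pi.single l (D : ℤ)) = b l := by
  have hD' : (D : ℝ) ≠ 0 := by exact_mod_cast hD.ne'
  rw [scaled_apply, comb, Finset.sum_eq_single l]
  · simp [hD']
  · intro i _ hi
    simp [Pi.single_eq_of_ne hi]
  · simp

/-- The vectors with coordinates `B j / D`. -/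
noncomputable def ratBasis (b : Fin n → E n) (D : ℕ) (B : Fin n → Fin n → ℤ) : Fin n → E n :=
  fun j => scaled b D (B j)

/-- The integer coordinates, with denominator `3 D`, of the lattice spanned by `ratBasis b D B`. -/
noncomputable def coordGroup (b : Fin n → E n) (D : ℕ) (B : Fin n → Fin n → ℤ) :
    AddSubgroup (Fin n → ℤ) :=
  (lat (ratBasis b D B)).toAddSubgroup.comap (scaled b (3 * D))

lemma mem_coordGroup {u : Fin n → ℤ} :
    u ∈ coordGroup b D B ↔ scaled b (3 * D) u ∈ lat (ratBasis b D B) := Iff.rfl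

lemma scaled_three (u : Fin n → ℤ) : scaled b (3 * D) ((3 : ℤ) • u) = scaled b D u :=
  scaled_mul (m := 3) (by norm_num) u

lemma sum_smul_ratBasis (a : Fin n → ℤ) :
    ∑ i, (a i : ℝ) • ratBasis b D B i = scaled b (3 * D) (∑ i, a i • (3 : ℤ) • B i) := by
  rw [map_sum]
  refine Finset.sum_congr rfl fun i _ => ?_
  rw [map_zsmul, scaled_three, Int.cast_smul_eq_zsmul]
  rfl

lemma mem_coordGroup_iff (hb : LinearIndependent ℝ b) (hD : 0 < D) {u : Fin n → ℤ} :
    u ∈ coordGroup b D B ↔ ∃ a : Fin n → ℤ, u = ∑ i, a i • (3 : ℤ) • B i := by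
  rw [mem_coordGroup, mem_lat_iff]
  refine exists_congr fun a => ?_
  rw [sum_smul_ratBasis]
  exact (scaled_injective hb (by omega)).eq_iff

lemma exists_scaled_eq {y : E n} (hy : y ∈ lat (ratBasis b D B)) :
    ∃ u ∈ coordGroup b D B, scaled b (3 * D) u = y := by
  obtain ⟨a, rfl⟩ := mem_lat_iff.1 hy
  exact ⟨_, by rw [mem_coordGroup, ← sum_smul_ratBasis]; exact hy, (sum_smul_ratBasis a).symm⟩

/-- Back substitution from the last coordinate downwards. P is an upward closed set of indices,
since both strict and weak final segments occur. -/
lemma coeff_eq_zero (hup : ∀ j l, j < l → B j l = 0) (hdiag : ∀ j, 0 < B j j) {a : Fin n → ℤ}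
    {P : Fin n → Prop} (hP : ∀ i j, i ≤ j → P i → P j)
    (h : ∀ l, P l → (∑ i, a i • (3 : ℤ) • B i) l = 0) (l : Fin n) (hl : P l) : a l = 0 := by
  induction hm : n - (l : ℕ) using Nat.strong_induction_on generalizing l with
  | _ m ih =>
  have h1 := h l hl
  rw [Finset.sum_apply, Finset.sum_eq_single l] at h1
  · have := (hdiag l).ne'
    simpa [this] using h1
  · intro i _ hi
    rcases lt_or_gt_of_ne hi with hlt | hgt
    · simp [hup i l hlt]
    · have := Fin.lt_def.1 hgt
      rw [ih (n - i) (by omega) i (hP l i hgt.le hl) rfl]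
      simp
  · simp

/-- The lattice spanned by `ratBasis b D B` is reached by the densification of `lat b`, and the
matrix `B` is lower triangular and reduced. -/
structure IsReached (K : Set (E n)) (b : Fin n → E n) (D : ℕ) (B : Fin n → Fin n → ℤ) : Prop where
  pos : 0 < D
  upper : ∀ j l, j < l → B j l = 0
  diag : ∀ j, 0 < B j j
  bound : ∀ j l, 0 ≤ B j l ∧ B j l ≤ D
  reach : Relation.ReflTransGen (RogersStep K) (lat b) (lat (ratBasis b D B))
  dir : IsDirectionalBasis (ratBasis b D B) (lat (ratBasis b D B)) b
  le_index : D ≤ index (lat (ratBasis b D B)) (lat b)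

lemma ratBasis_one (b : Fin n → E n) : ratBasis b 1 (fun j => Pi.single j 1) = b := by
  funext j
  have := scaled_single (b := b) (D := 1) one_pos j
  rw [Nat.cast_one] at this
  exact this

lemma isReached_one (hb : LinearIndependent ℝ b) :
    IsReached K b 1 (fun j => Pi.single j 1) := by
  have h := ratBasis_one b
  refine ⟨one_pos, fun j l hl => Pi.single_eq_of_ne hl.ne' _, fun j => by simp, fun j l => ?_, ?_,
    ?_, ?_⟩
  · by_cases hl : l = j
    · subst hl; simp
    · rw [Pi.single_eq_of_ne hl]; simp
  · rw [h]
  · rw [h]; exact .refl hb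
  · rw [h, index, AddSubgroup.relIndex_self]

namespace IsReached

lemma le (h : IsReached K b D B) (hK : IsSymmetricConvexBody K) (hn : 0 < n)
    (hb : LinearIndependent ℝ b) : lat b ≤ lat (ratBasis b D B) :=
  (rogers_reach hK hn hb h.reach).1

lemma minDist_eq (h : IsReached K b D B) (hK : IsSymmetricConvexBody K) (hn : 0 < n)
    (hb : LinearIndependent ℝ b) : minDist K (lat (ratBasis b D B)) = minDist K (lat b) :=
  (rogers_reach hK hn hb h.reach).2.1

/-- The lattice contains that of b, whose vectors have coordinates 3D in the present scale; this
gives the multiples of 3D. If the coordinates after j vanish, so do the coefficients after j, and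
coordinate j is a multiple of the diagonal entry. -/
lemma isTriangular (h : IsReached K b D B) (hK : IsSymmetricConvexBody K) (hn : 0 < n)
    (hb : LinearIndependent ℝ b) :
    IsTriangular (3 * D) (coordGroup b D B) (fun j => (3 : ℤ) • B j) := by
  have hpos := h.pos
  refine ⟨by omega, fun j => ?_, fun j l hl => by simp [h.upper j l hl],
    fun j => by simpa using h.diag j, fun l => ?_, fun u hu j hj => ?_⟩
  · rw [mem_coordGroup, scaled_three]
    exact Submodule.subset_span ⟨j, rfl⟩
  · rw [mem_coordGroup, scaled_single (by omega)]
    exact h.le hK hn hb (Submodule.subset_span ⟨l, rfl⟩)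
  · obtain ⟨a, rfl⟩ := (mem_coordGroup_iff hb hpos).1 hu
    have ha := coeff_eq_zero (P := fun l => j < l) h.upper h.diag
      (fun i l hil hi => hi.trans_le hil) hj
    rw [Finset.sum_apply, Finset.sum_eq_single j]
    · exact ⟨a j, by simp [mul_comm]⟩
    · intro i _ hi
      rcases lt_or_gt_of_ne hi with hlt | hgt
      · simp [h.upper i j hlt]
      · simp [ha i hgt]
    · simp

lemma scaled_third (j : Fin n) (z : Fin n → ℤ) :
    thirdVec (ratBasis b D B) j z = scaled b (3 * D) (B j + ∑ i ∈ Finset.Iio j, z i • B i) := by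
  have h3 : (3 : ℤ) • thirdVec (ratBasis b D B) j z =
      (3 : ℤ) • scaled b (3 * D) (B j + ∑ i ∈ Finset.Iio j, z i • B i) := by
    rw [three_smul_thirdVec, ← map_zsmul, scaled_three, map_add, map_sum]
    simp only [map_zsmul]
    rfl
  rw [← Int.cast_smul_eq_zsmul ℝ, ← Int.cast_smul_eq_zsmul ℝ] at h3
  exact smul_right_injective _ (by norm_num : ((3 : ℤ) : ℝ) ≠ 0) h3

/-- A vector congruent to a combination of basis vectors. -/
lemma exists_thirdVec (h : IsReached K b D B) (hK : IsSymmetricConvexBody K) (hn : 0 < n)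
    (hb : LinearIndependent ℝ b) {j : Fin n} {z X : Fin n → ℤ}
    (hX : ∀ l, ((3 * D : ℕ) : ℤ) ∣ X l - (B j + ∑ i ∈ Finset.Iio j, z i • B i) l)
    (hX' : ∀ l, j ≤ l → X l = B j l) :
    ∃ a : Fin n → ℤ, scaled b (3 * D) X = thirdVec (ratBasis b D B) j (fun i => z i + 3 * a i) := by
  have hmem := (h.isTriangular hK hn hb).mem_of_dvd (u := X - (B j + ∑ i ∈ Finset.Iio j, z i • B i)) hX
  obtain ⟨a, ha⟩ := (mem_coordGroup_iff hb h.pos).1 hmem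
  have hz : ∀ l, j ≤ l → (∑ i ∈ Finset.Iio j, z i • B i) l = 0 := by
    intro l hl
    rw [Finset.sum_apply]
    refine Finset.sum_eq_zero fun i hi => ?_
    simp [h.upper i l ((Finset.mem_Iio.1 hi).trans_le hl)]
  -- The difference vanishes from coordinate j on, so it involves only rows before j, and these
  -- enter with coefficients divisible by 3. Hence the reduced vector has again the form `thirdVec`,
  -- with shifted digits, and can itself become the new basis vector.
  have ha0 := coeff_eq_zero (a := a) (P := fun l => j ≤ l) h.upper h.diag
    (fun i l hil hi => hi.trans hil) fun l hl => by
      rw [← ha, Pi.sub_apply, Pi.add_apply, hX' l hl, hz l hl]; ring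
  refine ⟨a, ?_⟩
  rw [scaled_third]
  congr 1
  have e : ∑ i, a i • (3 : ℤ) • B i = ∑ i ∈ Finset.Iio j, a i • (3 : ℤ) • B i := by
    refine (Finset.sum_subset (Finset.subset_univ _) fun i _ hi => ?_).symm
    rw [ha0 i (by simpa using hi), zero_smul]
  rw [e, sub_eq_iff_eq_add] at ha
  rw [ha, add_comm, add_assoc, ← Finset.sum_add_distrib]
  congr 1
  refine Finset.sum_congr rfl fun i _ => ?_
  rw [add_smul, smul_smul, mul_comm (a i)]

end IsReached

lemma thirdVec_sub_mem {v : Fin n → E n} (j : Fin n) {z z' : Fin n → ℤ}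
    (h : ∀ i, i < j → ∃ a, z' i = z i + 3 * a) : thirdVec v j z' - thirdVec v j z ∈ lat v := by
  choose! a ha using h
  have : thirdVec v j z' - thirdVec v j z = ∑ i ∈ Finset.Iio j, a i • v i := by
    rw [thirdVec, thirdVec, ← smul_sub, add_sub_add_left_eq_sub, ← Finset.sum_sub_distrib,
      Finset.smul_sum]
    refine Finset.sum_congr rfl fun i hi => ?_
    rw [← sub_smul, smul_smul, ha i (Finset.mem_Iio.1 hi), ← Int.cast_smul_eq_zsmul ℝ]
    congr 1
    push_cast
    ring
  rw [this]
  exact Submodule.sum_mem _ fun i _ => Submodule.smul_mem _ _ (Submodule.subset_span ⟨i, rfl⟩)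

lemma latDist_thirdVec {v : Fin n → E n} (j : Fin n) {z z' : Fin n → ℤ}
    (h : ∀ i, i < j → ∃ a, z' i = z i + 3 * a) :
    latDist K (lat v) (thirdVec v j z') = latDist K (lat v) (thirdVec v j z) := by
  rw [← latDist_add_mem (x := thirdVec v j z) (thirdVec_sub_mem j h), add_sub_cancel]

/-- The class of x has order 3 in the quotient of the two lattices, so 3 divides its order. -/
lemma three_mul_index_le {v v' : Fin n → E n} (hv : LinearIndependent ℝ v)
    (hv' : LinearIndependent ℝ v') (hle : lat v ≤ lat v') {M : Submodule ℤ (E n)} (hM : M ≤ lat v)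
    {x : E n} (hx : x ∈ lat v') (hx' : x ∉ lat v) (h3 : (3 : ℤ) • x ∈ lat v) :
    3 * index (lat v) M ≤ index (lat v') M := by
  have h1 : index (lat v) M * index (lat v') (lat v) = index (lat v') M :=
    AddSubgroup.relIndex_mul_relIndex _ _ _ (by exact hM) (by exact hle)
  rw [← h1, mul_comm]
  refine Nat.mul_le_mul_left _ (Nat.le_of_dvd (index_pos hv hv' hle) ?_)
  let H := (lat v).toAddSubgroup.addSubgroupOf (lat v').toAddSubgroup
  let q : (lat v').toAddSubgroup ⧸ H := QuotientAddGroup.mk ⟨x, hx⟩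
  have hq : addOrderOf q = 3 := by
    have : Fact (Nat.Prime 3) := ⟨Nat.prime_three⟩
    refine addOrderOf_eq_prime ?_ ?_
    · rw [← QuotientAddGroup.mk_nsmul, QuotientAddGroup.eq_zero_iff, AddSubgroup.mem_addSubgroupOf]
      have : (((3 : ℕ) • (⟨x, hx⟩ : (lat v').toAddSubgroup) : (lat v').toAddSubgroup) : E n) =
          (3 : ℤ) • x := by
        simp only [AddSubgroup.coe_nsmul]
        norm_cast
      rw [this]
      exact h3
    · rw [Ne, QuotientAddGroup.eq_zero_iff, AddSubgroup.mem_addSubgroupOf]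
      exact hx'
  rw [← hq]
  exact addOrderOf_dvd_natCard q

end ThinLattice

/-! ### Cosets: counting nodes, and one densification step in coordinates -/

namespace ThinLattice

variable {n : ℕ} {K : Set (E n)} {b : Fin n → E n} {D : ℕ} {B : Fin n → Fin n → ℤ}

/-- The coset of `X`. -/
def coset (A : AddSubgroup (Fin n → ℤ)) (X : Fin n → ℤ) : Set (Fin n → ℤ) := {p | p - X ∈ A}

/-- The kernel of the projection is the span of the first i basis vectors, so a projected vector and
its remaining coordinates determine each other. A node q goes to the projection of q - X. This lies
in the projected lattice, because p - X does for a point p of the coset above q, and in a projected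
ball centred at -X, because the free coordinates can be completed inside the ball. -/
lemma nodes_finite_and_ncard_le (hK : IsSymmetricConvexBody K) (hb : LinearIndependent ℝ b)
    (hD : 0 < D) (X : Fin n → ℤ) {α ρ : ℝ} (hρ : 0 ≤ ρ)
    (hidx : index (lat (ratBasis b D B)) (lat b) ≠ 0)
    (hse : IsSE K b α) {i : ℕ} (hi : i < n) :
    (nodes K b (3 * D) ρ (coset (coordGroup b D B) X) i).Finite ∧
    ((nodes K b (3 * D) ρ (coset (coordGroup b D B) X) i).ncard : ℝ) ≤
      index (lat (ratBasis b D B)) (lat b) * (α * (ρ + 1) ^ n) := by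
  let i' : Fin n := ⟨i, hi⟩
  have key := card_le_of_se_of_index hK (gsProjL b i') hidx (hse i') hρ (-scaled b (3 * D) X)
  set S := gsProjL b i' '' {x | gauge K (x - -scaled b (3 * D) X) ≤ ρ} ∩
    gsProjL b i' '' (lat (ratBasis b D B) : Set (E n))
  let f : (Fin n → ℤ) → E n := fun q => gsProjL b i' (scaled b (3 * D) q - scaled b (3 * D) X)
  have hsupp : ∀ w : Fin n → ℝ, (∀ l : Fin n, i ≤ (l : ℕ) → w l = 0) →
      comb b w ∈ Submodule.span ℝ (b '' Set.Iio i') := by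
    intro w hw
    refine Submodule.sum_mem _ fun l _ => ?_
    by_cases hl : (l : ℕ) < i
    · exact Submodule.smul_mem _ _ (Submodule.subset_span ⟨l, Fin.lt_def.2 hl, rfl⟩)
    · rw [hw l (by omega), zero_smul]
      exact Submodule.zero_mem _
  have hsub : ∀ w w' : Fin n → ℝ, comb b w - comb b w' = comb b (w - w') := fun w w' => by
    simp only [comb_eq_linearCombination, map_sub]
  have hcomb : ∀ w w' : Fin n → ℝ, (∀ l : Fin n, i ≤ (l : ℕ) → w l = w' l) →
      gsProjL b i' (comb b w) = gsProjL b i' (comb b w') := by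
    intro w w' h
    rw [coe_gsProjL, gsProj_eq_iff, hsub]
    exact hsupp _ fun l hl => by simp [h l hl]
  have hmaps : Set.MapsTo f (nodes K b (3 * D) ρ (coset (coordGroup b D B) X) i) S := by
    rintro _ ⟨p, hp, ⟨w, hw, hwρ⟩, rfl⟩
    have e1 : f (trunc i p) = gsProjL b i' (scaled b (3 * D) (p - X)) := by
      simp only [f, map_sub]
      congr 1
      refine hcomb _ _ fun l hl => ?_
      rw [trunc_apply hl]
    have e2 : f (trunc i p) = gsProjL b i' (comb b w - scaled b (3 * D) X) := by
      simp only [f, map_sub]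
      congr 1
      refine hcomb _ _ fun l hl => ?_
      rw [trunc_apply hl, hw l hl]
    exact ⟨⟨_, by simpa using hwρ, e2.symm⟩, ⟨_, hp, e1.symm⟩⟩
  have hinj : Set.InjOn f (nodes K b (3 * D) ρ (coset (coordGroup b D B) X) i) := by
    rintro _ ⟨p, -, -, rfl⟩ _ ⟨p', -, -, rfl⟩ h
    simp only [f, coe_gsProjL] at h
    rw [gsProj_eq_iff, sub_sub_sub_cancel_right, scaled_apply, scaled_apply, hsub] at h
    funext l
    by_cases hl : (l : ℕ) < i
    · simp [trunc, hl]
    · have hnot := (realBasis hb).mem_span_image (m := comb b ((fun l => (trunc i p l : ℝ) / (3 * D : ℕ)) -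
          fun l => (trunc i p' l : ℝ) / (3 * D : ℕ))) (s := Set.Iio i')
      rw [coe_realBasis] at hnot
      have h1 := hnot.1 h
      have h2 : (realBasis hb).repr (comb b ((fun l => (trunc i p l : ℝ) / (3 * D : ℕ)) -
          fun l => (trunc i p' l : ℝ) / (3 * D : ℕ))) l = 0 := by
        by_contra hne
        have := h1 (Finsupp.mem_support_iff.2 hne)
        exact hl (Fin.lt_def.1 this)
      have h3 : comb b ((fun l => (trunc i p l : ℝ) / (3 * D : ℕ)) -
          fun l => (trunc i p' l : ℝ) / (3 * D : ℕ)) = ∑ l, ((fun l => (trunc i p l : ℝ) / (3 * D : ℕ)) -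
          fun l => (trunc i p' l : ℝ) / (3 * D : ℕ)) l • realBasis hb l := by
        rw [coe_realBasis]; rfl
      rw [h3, Module.Basis.repr_sum_self] at h2
      simp only [Pi.sub_apply] at h2
      have hD' : ((3 * D : ℕ) : ℝ) ≠ 0 := by exact_mod_cast (by omega : 3 * D ≠ 0)
      rw [sub_eq_zero, div_left_inj' hD'] at h2
      exact_mod_cast h2
  refine ⟨Set.Finite.of_injOn hmaps hinj key.1, le_trans ?_ key.2⟩
  exact_mod_cast Set.ncard_le_ncard_of_injOn f hmaps hinj key.1

namespace IsReached

/-- Tripling the old rows rewrites them over the denominator 3D, to which the new row already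
refers. The index grows at least threefold together with the denominator, so the denominator remains
bounded by the index. -/
lemma extend (h : IsReached K b D B) (hK : IsSymmetricConvexBody K) (hn : 0 < n)
    (hb : LinearIndependent ℝ b) {j : Fin n} {X z : Fin n → ℤ}
    (hX : scaled b (3 * D) X = thirdVec (ratBasis b D B) j z) (hX' : ∀ l, j ≤ l → X l = B j l)
    (hXb : ∀ l, 0 ≤ X l ∧ X l ≤ (3 * D : ℕ))
    (hd : minDist K (lat (ratBasis b D B)) < latDist K (lat (ratBasis b D B)) (scaled b (3 * D) X)) :
    IsReached K b (3 * D) (Function.update (fun i => (3 : ℤ) • B i) j X) := by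
  have hv := h.dir.linearIndependent
  have e : ratBasis b (3 * D) (Function.update (fun i => (3 : ℤ) • B i) j X) =
      Function.update (ratBasis b D B) j (thirdVec (ratBasis b D B) j z) := by
    funext i
    by_cases hi : i = j
    · subst hi
      rw [ratBasis, Function.update_self, Function.update_self, hX]
    · rw [ratBasis, Function.update_of_ne hi, Function.update_of_ne hi, scaled_three]
      rfl
  have hdir := isDirectionalBasis_update hv j z
  have h3 : (3 : ℤ) • scaled b (3 * D) X ∈ lat (ratBasis b D B) := by
    rw [hX, three_smul_thirdVec]
    exact Submodule.add_mem _ (Submodule.subset_span ⟨j, rfl⟩) (Submodule.sum_mem _ fun i _ =>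
      Submodule.smul_mem _ _ (Submodule.subset_span ⟨i, rfl⟩))
  have hnot : scaled b (3 * D) X ∉ lat (ratBasis b D B) := fun hmem => by
    have h1 := latDist_le (K := K) (x := scaled b (3 * D) X) hmem
    rw [sub_self, gauge_zero] at h1
    linarith [minDist_nonneg (K := K) (L := lat (ratBasis b D B))]
  have hle : lat (ratBasis b D B) ≤
      lat (Function.update (ratBasis b D B) j (thirdVec (ratBasis b D B) j z)) := by
    rw [hdir.lat_eq]; exact le_sup_left
  have hpos := h.pos
  refine ⟨by omega, fun i l hl => ?_, fun i => ?_, fun i l => ?_, ?_, ?_, ?_⟩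
  · by_cases hi : i = j
    · subst hi
      rw [Function.update_self, hX' l hl.le, h.upper i l hl]
    · rw [Function.update_of_ne hi, Pi.smul_apply, h.upper i l hl, smul_zero]
  · by_cases hi : i = j
    · subst hi
      rw [Function.update_self, hX' i le_rfl]
      exact h.diag i
    · rw [Function.update_of_ne hi]
      simpa using h.diag i
  · by_cases hi : i = j
    · subst hi
      rw [Function.update_self]
      exact hXb l
    · rw [Function.update_of_ne hi]
      have := h.bound i l
      simp only [Pi.smul_apply, smul_eq_mul]
      push_cast
      omega
  · rw [e, hdir.lat_eq]
    refine h.reach.tail ⟨scaled b (3 * D) X, h3, hd, by rw [hX]⟩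
  · rw [e]
    refine ⟨hdir.linearIndependent, rfl, fun i => ?_⟩
    rw [hdir.span_eq, h.dir.span_eq]
  · rw [e]
    refine (Nat.mul_le_mul_left 3 h.le_index).trans (three_mul_index_le hv hdir.linearIndependent
      hle (h.le hK hn hb) (x := scaled b (3 * D) X) ?_ hnot h3)
    rw [hdir.lat_eq, ← hX]
    exact (le_sup_right : _ ≤ lat (ratBasis b D B) ⊔ _) (Submodule.mem_span_singleton_self _)

/-- A lattice point u within r of X makes X - u a point of the coset in the ball, hence zero. But X
is not in the lattice: it vanishes after j, and its entry `B j j` is not divisible by `3 * B j j`.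
-/
lemma lt_latDist (h : IsReached K b D B) (hK : IsSymmetricConvexBody K) (hn : 0 < n)
    (hb : LinearIndependent ℝ b) {j : Fin n} {X : Fin n → ℤ} (hX : ∀ l, j ≤ l → X l = B j l) {r : ℝ}
    (hno : ∀ p ∈ leaves K b (3 * D) r (coset (coordGroup b D B) X), p = 0) :
    r < latDist K (lat (ratBasis b D B)) (scaled b (3 * D) X) := by
  by_contra! hle
  obtain ⟨y, hy, hyx⟩ := exists_latDist_eq hK h.dir.linearIndependent (scaled b (3 * D) X)
  obtain ⟨u, hu, rfl⟩ := exists_scaled_eq hy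
  have h0 := hno (X - u) ⟨?_, ?_⟩
  · have hmem : X ∈ coordGroup b D B := by rwa [sub_eq_zero.1 h0]
    have hd := (h.isTriangular hK hn hb).dvd X hmem j fun l hl => by rw [hX l hl.le, h.upper j l hl]
    have hpos := h.diag j
    rw [hX j le_rfl] at hd
    have := Int.le_of_dvd hpos hd
    simp only [Pi.smul_apply, smul_eq_mul] at this
    omega
  · have : X - u - X ∈ coordGroup b D B := by
      rw [show X - u - X = -u by abel]
      exact neg_mem hu
    exact this
  · rw [intNorm_eq, map_sub, hK.gauge_sub_comm, hyx]
    exact hle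

lemma latDist_le_of_mem (hK : IsSymmetricConvexBody K) {X p : Fin n → ℤ} {r : ℝ}
    (hp : p ∈ leaves K b (3 * D) r (coset (coordGroup b D B) X)) :
    latDist K (lat (ratBasis b D B)) (scaled b (3 * D) X) ≤ r := by
  have h1 : scaled b (3 * D) (p - X) ∈ lat (ratBasis b D B) := hp.1
  refine (latDist_le (neg_mem h1)).trans ?_
  rw [map_sub, ← hK.gauge_neg]
  have : -(-(scaled b (3 * D) p - scaled b (3 * D) X) - scaled b (3 * D) X) = scaled b (3 * D) p := by
    abel
  rw [this]
  exact hp.2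

/-- If all classes modulo three are close to the lattice then the densification stops. -/
lemma isRogersOutput (h : IsReached K b D B) (hK : IsSymmetricConvexBody K)
    (hclose : ∀ (j : Fin n) (z : Fin n → ℤ), (∀ i, 0 ≤ z i ∧ z i < 3) →
      latDist K (lat (ratBasis b D B)) (thirdVec (ratBasis b D B) j z) ≤
        minDist K (lat (ratBasis b D B))) :
    IsRogersOutput K (lat b) (lat (ratBasis b D B)) := by
  refine ⟨h.reach, ?_⟩
  rintro _ ⟨x, hx, hlt, -⟩
  set v := ratBasis b D B
  rcases mem_or_exists_thirdVec hx with hx | ⟨j, z, hz, hx⟩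
  · have h1 := latDist_le (K := K) (x := x) hx
    rw [sub_self, gauge_zero] at h1
    linarith [minDist_nonneg (K := K) (L := lat v)]
  · have hc := hclose j z hz
    refine absurd hlt (not_lt.2 ?_)
    rcases hx with hx | hx
    · rw [← latDist_add_mem (K := K) (x := thirdVec v j z) hx] at hc
      simpa using hc
    · rw [← latDist_add_mem (K := K) (x := thirdVec v j z) hx] at hc
      rw [← latDist_neg hK]
      simpa using hc

end IsReached

/-- Guarantees that the numbers q below 3^j run through all digit vectors of length j, so no class
is missed. -/
lemma exists_digits (j : ℕ) (z : ℕ → ℤ) (hz : ∀ i, 0 ≤ z i ∧ z i < 3) :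
    ∃ q : ℕ, q < 3 ^ j ∧ ∀ i < j, ((q / 3 ^ i % 3 : ℕ) : ℤ) = z i := by
  induction j generalizing z with
  | zero => exact ⟨0, by simp, by simp⟩
  | succ j ih =>
    obtain ⟨q, hq, hqz⟩ := ih (fun i => z (i + 1)) fun i => hz (i + 1)
    obtain ⟨d, hd⟩ := Int.eq_ofNat_of_zero_le (hz 0).1
    have hd3 : d < 3 := by have := (hz 0).2; omega
    refine ⟨3 * q + d, by rw [pow_succ]; omega, fun i hi => ?_⟩
    rcases i with _ | i
    · rw [hd]; simp; omega
    · rw [← hqz i (by omega), pow_succ', ← Nat.div_div_eq_div_mul]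
      congr 3
      omega

end ThinLattice

namespace ThinLattice

/-! ## The densification program -/

variable {n W : ℕ} {K : Set (E n)} {b : Fin n → E n} {O : Query n → Option ℤ} {c R : ℝ} {N : ℕ}
  {s : Store} {T : ℕ} {Q : Store → Prop}

/-- The matrix stored in array `5`. -/
def bas (n : ℕ) (s : Store) : Fin n → Fin n → ℤ := fun j l => s 5 (l * n + j)

/-- The standing assumptions on the input, with bounds `R` on coordinates and `N` on the number of
nodes of an enumeration. -/
structure Setup {n : ℕ} (W : ℕ) (K : Set (E n)) (b : Fin n → E n) (O : Query n → Option ℤ)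
    (c R : ℝ) (N : ℕ) : Prop where
  n_pos : 0 < n
  lt_W : ((3 ^ (n + 1) : ℕ) : ℤ) < 2 ^ W
  body : IsSymmetricConvexBody K
  oracle : IsOracle K b O
  indep : LinearIndependent ℝ b
  se : IsSE K b (c ^ n)
  one_le : 1 ≤ minDist K (lat b)
  le_c : minDist K (lat b) ≤ c
  five_le : 5 ≤ c
  index_le : ∀ b', LinearIndependent ℝ b' → lat b ≤ lat b' →
    minDist K (lat b') = minDist K (lat b) →
    (index (lat b') (lat b) : ℝ) ≤ (c / minDist K (lat b)) ^ n
  R_nonneg : 0 ≤ R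
  coord_le : ∀ w, gauge K (comb b w) ≤ c + 1 → ∀ i, |w i| ≤ R
  bits : 9 * c ^ n * (R + 3) < (2 : ℝ) ^ W
  count : n * ⌊(2 * c ^ 2) ^ n⌋₊ ≤ N

/-- The bit bound imposed for the counters of size 3^(n+1) thereby also covers the loop bounds n and
n * n. -/
lemma sq_le_three_pow (n : ℕ) : n * n + 2 * n ≤ 3 ^ (n + 1) := by
  induction n with
  | zero => simp
  | succ n ih =>
    have h : n < 3 ^ n := Nat.lt_pow_self (by norm_num)
    rw [pow_succ, pow_succ]
    rw [pow_succ] at ih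
    nlinarith

namespace Setup

lemma sq_lt (S : Setup W K b O c R N) : ((n * n + 2 * n : ℕ) : ℤ) < 2 ^ W := by
  refine lt_of_le_of_lt ?_ S.lt_W
  exact_mod_cast sq_le_three_pow n

lemma n_lt (S : Setup W K b O c R N) : (n : ℤ) < 2 ^ W :=
  lt_of_le_of_lt (by norm_cast; nlinarith) S.sq_lt

lemma W_pos (S : Setup W K b O c R N) : 0 < W := by
  have := S.lt_W
  by_contra! h
  rw [Nat.le_zero.1 h] at this
  have h1 : 0 < 3 ^ (n + 1) := by positivity
  push_cast at this
  have h2 : (1 : ℤ) ≤ 3 ^ (n + 1) := one_le_pow₀ (by norm_num)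
  omega

lemma abs_lt (S : Setup W K b O c R N) {z : ℤ} (h : |(z : ℝ)| ≤ 9 * c ^ n * (R + 3)) :
    |z| < 2 ^ W := by
  have h1 : |(z : ℝ)| < 2 ^ W := h.trans_lt S.bits
  exact_mod_cast h1

variable {D : ℕ} {B : Fin n → Fin n → ℤ}

lemma index_le_of_reached (S : Setup W K b O c R N) (h : IsReached K b D B) :
    (index (lat (ratBasis b D B)) (lat b) : ℝ) ≤ (c / minDist K (lat b)) ^ n :=
  S.index_le _ h.dir.linearIndependent (h.le S.body S.n_pos S.indep)
    (h.minDist_eq S.body S.n_pos S.indep)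

/-- The denominator is at most the index, which is at most (c/λ)^n with λ ≥ 1. This controls the
size of the numbers, and also the number of extensions, because the denominator is tripled by each
of them. -/
lemma le_pow (S : Setup W K b O c R N) (h : IsReached K b D B) : (D : ℝ) ≤ c ^ n := by
  have h1 : (D : ℝ) ≤ index (lat (ratBasis b D B)) (lat b) := by exact_mod_cast h.le_index
  have hc := S.five_le
  have hl := S.one_le
  have hl' : 0 < minDist K (lat b) := by linarith
  refine h1.trans ((S.index_le_of_reached h).trans ?_)
  gcongr
  exact div_le_self (by linarith) hl

lemma three_mul_lt (S : Setup W K b O c R N) (h : IsReached K b D B) {m : ℕ} (hm : m ≤ 27) :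
    |((m * D : ℕ) : ℤ)| < 2 ^ W := by
  refine S.abs_lt ?_
  have h1 := S.le_pow h
  have h2 := S.R_nonneg
  have h3 : (m : ℝ) ≤ 27 := by exact_mod_cast hm
  have h4 : 0 ≤ c ^ n := (Nat.cast_nonneg _).trans h1
  push_cast
  rw [abs_of_nonneg (by positivity)]
  calc (m : ℝ) * D ≤ 27 * c ^ n := by gcongr
    _ ≤ _ := by nlinarith

/-- The bounds on the number of nodes, for the two kinds of enumerations. -/
lemma count_of_eq (S : Setup W K b O c R N) (h : IsReached K b D B) :
    (index (lat (ratBasis b D B)) (lat b) : ℝ) * (c ^ n * (minDist K (lat b) + 1) ^ n) ≤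
      (2 * c ^ 2) ^ n := by
  have hc := S.five_le
  have hl := S.one_le
  have hl' : 0 < minDist K (lat b) := by linarith
  -- As λ ≥ 1, λ + 1 is at most 2λ, and the λ cancels the denominator of the index bound.
  calc _ ≤ (c / minDist K (lat b)) ^ n * (c ^ n * (2 * minDist K (lat b)) ^ n) := by
        gcongr
        · exact S.index_le_of_reached h
        · linarith
    _ = (2 * c ^ 2) ^ n := by
        rw [← mul_pow, ← mul_pow]
        congr 1
        field_simp

/-- For the search of a shortest vector the lattice is M itself, with index 1, and the radius may
exceed λ: c (c + 2) ≤ 2c². -/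
lemma count_of_le (S : Setup W K b O c R N) {ρ : ℝ} (h0 : 0 ≤ ρ) (hρ : ρ ≤ c + 1) :
    c ^ n * (ρ + 1) ^ n ≤ (2 * c ^ 2) ^ n := by
  have hc := S.five_le
  rw [← mul_pow]
  refine pow_le_pow_left₀ (by positivity) ?_ n
  nlinarith

/-- The enumeration of a coset. -/
lemma enumEnv (S : Setup W K b O c R N) (h : IsReached K b D (bas n s)) (h7 : s 7 0 = (3 * D : ℕ))
    {ρ : ℝ} (h0 : 0 ≤ ρ) (hρ : ρ ≤ c + 1)
    (hcount : (index (lat (ratBasis b D (bas n s))) (lat b) : ℝ) * (c ^ n * (ρ + 1) ^ n) ≤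
      (2 * c ^ 2) ^ n)
    (hrad : intNorm K b (3 * D) (vec n s 3) + (s 8 0 : ℝ) / (3 * D : ℕ) = ρ) (X : Fin n → ℤ) :
    EnumEnv W K b O (3 * D) ρ R (coordGroup b D (bas n s)) (coset (coordGroup b D (bas n s)) X)
      (fun j => (3 : ℤ) • bas n s j) s ∧
    ∀ P, (below K b (3 * D) ρ (coset (coordGroup b D (bas n s)) X) n P).ncard ≤ N := by
  have hidx : index (lat (ratBasis b D (bas n s))) (lat b) ≠ 0 :=
    (h.pos.trans_le h.le_index).ne'
  have hnodes : ∀ i < n, (nodes K b (3 * D) ρ (coset (coordGroup b D (bas n s)) X) i).Finite ∧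
      (nodes K b (3 * D) ρ (coset (coordGroup b D (bas n s)) X) i).ncard ≤ ⌊(2 * c ^ 2) ^ n⌋₊ := by
    intro i hi
    have key := nodes_finite_and_ncard_le S.body S.indep h.pos X h0 hidx S.se hi
    exact ⟨key.1, Nat.le_floor (key.2.trans hcount)⟩
  have hbelow := finite_below_and_ncard_le hnodes
  refine ⟨⟨S.n_lt, S.W_pos, S.body, S.oracle, h.isTriangular S.body S.n_pos S.indep, ?_, ?_,
    S.R_nonneg, fun w hw => S.coord_le w (hw.trans hρ), ?_, h7, hrad, fun _ _ => rfl,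
    fun P => (hbelow P).1⟩, fun P => (hbelow P).2.trans S.count⟩
  · intro p hp q hq
    have := sub_mem (show p - X ∈ coordGroup b D (bas n s) from hp)
      (show q - X ∈ coordGroup b D (bas n s) from hq)
    rwa [sub_sub_sub_cancel_right] at this
  · intro p hp u hu
    have : p + u - X ∈ coordGroup b D (bas n s) := by
      rw [add_sub_right_comm]
      exact add_mem hp hu
    exact this
  · refine lt_of_le_of_lt ?_ S.bits
    have h1 := S.le_pow h
    have h2 := S.R_nonneg
    have h4 : 0 ≤ c ^ n := (Nat.cast_nonneg _).trans h1
    push_cast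
    gcongr
    nlinarith

end Setup

/-! ### Building a representative of a class -/

/-- Compute a representative of the class with number `(j, q)`, where `j`, `q` are stored in
`14`, `15`, in array `2`. -/
def buildP : Prog :=
  .seq (forTo 11 dimE (put 2 (sc 11) (rd 5 (.add (.mul (sc 11) dimE) (sc 14))))) <|
  .seq (set 17 (sc 15)) <|
  forTo 18 (sc 14) <| .seq (set 19 (.sub (sc 17) (.mul (.lit 3) (.div (sc 17) (.lit 3))))) <|
  .seq (set 17 (.div (sc 17) (.lit 3))) (axpyP 2 (sc 19) (sc 18) (.add (sc 18) (.lit 1)))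

/-- The digits of `q`. -/
def digits (n q : ℕ) : Fin n → ℤ := fun i => ((q / 3 ^ (i : ℕ) % 3 : ℕ) : ℤ)

lemma sum_range_eq_sum_Iio {j : ℕ} (hj : j < n) (f : ℕ → ℤ) :
    ∑ i ∈ Finset.range j, f i = ∑ i ∈ Finset.Iio (⟨j, hj⟩ : Fin n), f i := by
  have : Finset.range j = (Finset.Iio (⟨j, hj⟩ : Fin n)).map Fin.valEmbedding := by
    ext x
    simp only [Finset.mem_range, Finset.mem_map, Finset.mem_Iio, Fin.valEmbedding_apply]
    exact ⟨fun h => ⟨⟨x, h.trans hj⟩, Fin.lt_def.2 h, rfl⟩, by rintro ⟨i, hi, rfl⟩; exact hi⟩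
  rw [this, Finset.sum_map]
  rfl

/-- The base 3 digits of q are split off from the lowest on, and after k rounds the vector is
congruent to the partial sum. Row k has entries only up to position k, so the entries from j on
remain those of row j. The division by 3 in the representative is implicit: rows with denominator D
are read over the stored denominator 3D. -/
lemma wp_buildP {D j q : ℕ} (hn : (n : ℤ) < 2 ^ W) (hW : 1 < W) (hs : StoreFits W s)
    (h7 : s 7 0 = D) (hD : 0 < D)
    (hj : j < n) (h14 : s 14 0 = j) (h15 : s 15 0 = q)
    (hup : ∀ i l, i < l → l < n → s 5 (l * n + i) = 0)
    (hb : ∀ l < n, 0 ≤ s 5 (l * n + j) ∧ s 5 (l * n + j) < D) (hT : 10000 * (n + 1) * (n + 1) ≤ T)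
    (hQ : ∀ s', StoreFits W s' → Frame [2, 11, 17, 18, 19] s s' →
      (∀ l, (D : ℤ) ∣ vec n s' 2 l -
        (bas n s ⟨j, hj⟩ + ∑ i ∈ Finset.Iio ⟨j, hj⟩, digits n q i • bas n s i) l) →
      (∀ l, ⟨j, hj⟩ ≤ l → vec n s' 2 l = bas n s ⟨j, hj⟩ l) →
      (∀ l, 0 ≤ vec n s' 2 l ∧ vec n s' 2 l < D) → Q s') :
    Wp O W buildP T Q s := by
  have hT' : 1000 * (n + 1) + (100 + 9000 * (n + 1) * (n + 1)) ≤ T := by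
    refine le_trans ?_ hT
    nlinarith [Nat.zero_le (n * n)]
  have h15W : (q : ℤ) < 2 ^ W := by
    have := hs.bound 15 0
    rwa [h15, abs_of_nonneg (by positivity)] at this
  refine Wp.seq (T₁ := 1000 * (n + 1)) (T₂ := 100 + 9000 * (n + 1) * (n + 1))
    (Q' := fun s' => Frame [2, 11, 17, 18, 19] s s' ∧ ∀ l < n, s' 2 l = s 5 (l * n + j)) ?_ ?_ hT'
  · let I : ℕ → Store → Prop := fun k s' => Frame [2, 11, 17, 18, 19] s s' ∧
      ∀ l < k, s' 2 l = s 5 (l * n + j)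
    refine wp_forTo (Tb := 200) I hn hs (by omega) hn (fun _ _ _ _ _ _ => value_dimE)
      ⟨(Frame.refl _ _).upd (by simp) _ _, by simp⟩ ?_ ?_ fun s' _ _ h => h
    · rintro k hk s' hs' hk' ⟨hF, h⟩
      refine wp_put hn hs' (by omega) (i := k) (x := s 5 (k * n + j)) (lt_width (by omega))
        (by simpa using hk') ?_ (hs.bound _ _) (by decide) ?_
      · rw [value_rd (i := k * n + j) ?_ (mul_add_lt_width hk hj), hF 5 (by simp)]
        simp [Arith.value, hk', hF 14 (by simp), h14]
      · refine ⟨by rwa [upd_ne (by omega)], (hF.upd (by simp) _ _).upd (by simp) _ _, ?_⟩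
        intro l hl
        rw [upd_ne (by omega), upd_same]
        rcases Nat.lt_succ_iff_lt_or_eq.1 hl with hl | rfl
        · rw [Function.update_of_ne (by omega), h l hl]
        · rw [Function.update_self]
    · have : dimE.cost = 2 := rfl
      rw [this]
      exact Nat.mul_le_mul_right _ (by norm_num)
  rintro s₁ hs₁ ⟨hF₁, h2₁⟩
  refine Wp.seq (T₁ := 100) (T₂ := 9000 * (n + 1) * (n + 1))
    (Q' := fun s' => Frame [2, 11, 17, 18, 19] s s' ∧ (∀ l < n, s' 2 l = s 5 (l * n + j)) ∧
      s' 17 0 = q)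
    (wp_set hn hs₁ (by omega) (x := q) (by simp [hF₁ 15 (by simp), h15])
      (by rwa [abs_of_nonneg (by positivity)]) (by decide) ⟨hF₁.upd (by simp) _ _, fun l hl => by
        rw [upd_ne (by omega), h2₁ l hl], by simp⟩) ?_ le_rfl
  rintro s₂ hs₂ ⟨hF₂, h2₂, h17₂⟩
  let I : ℕ → Store → Prop := fun k s' => Frame [2, 11, 17, 18, 19] s s' ∧
    s' 17 0 = (q / 3 ^ k : ℕ) ∧
    (∀ l < n, (D : ℤ) ∣ s' 2 l - (s 5 (l * n + j) +
      ∑ i ∈ Finset.range k, ((q / 3 ^ i % 3 : ℕ) : ℤ) * s 5 (l * n + i))) ∧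
    (∀ l < n, k ≤ l → s' 2 l = s 5 (l * n + j)) ∧ (∀ l < n, 0 ≤ s' 2 l ∧ s' 2 l < D)
  have hjW : (j : ℤ) < 2 ^ W := lt_of_le_of_lt (by exact_mod_cast hj.le) hn
  refine wp_forTo (N := j) (Tb := 2000 * (n + 1) + 300) I hn hs₂ (by omega) hjW
    (fun k _ s' _ _ h => by simp [h.1 14 (by simp), h14])
    ⟨hF₂.upd (by simp) _ _, by simpa [upd_ne] using h17₂, fun l hl => by
      rw [upd_ne (by omega), h2₂ l hl]; simp, fun l hl _ => by rw [upd_ne (by omega), h2₂ l hl],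
      fun l hl => by rw [upd_ne (by omega), h2₂ l hl]; exact hb l hl⟩ ?_ ?_ ?_
  · rintro k hk s' hs' hk' ⟨hF, h17, hdvd, hge, hbd⟩
    have hz : |((q / 3 ^ k % 3 : ℕ) : ℤ)| < 2 ^ W := by
      rw [abs_of_nonneg (by positivity)]
      have h1 : (2 : ℤ) ^ 2 ≤ 2 ^ W := pow_le_pow_right₀ (by norm_num) hW
      have h2 : q / 3 ^ k % 3 < 3 := Nat.mod_lt _ (by norm_num)
      have h3 : ((q / 3 ^ k % 3 : ℕ) : ℤ) < 3 := by exact_mod_cast h2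
      linarith
    refine Wp.seq (T₁ := 150) (T₂ := 150 + 2000 * (n + 1))
      (Q' := fun s'' => s'' = upd s' 19 0 ((q / 3 ^ k % 3 : ℕ) : ℤ))
      (wp_set hn hs' (by omega) ?_ hz (by decide) rfl) ?_ (by linarith)
    · simp only [Arith.value, value_sc, h17]
      push_cast
      rw [← Int.emod_def]
    rintro s'' hs'' rfl
    have hq' : |((q / 3 ^ (k + 1) : ℕ) : ℤ)| < 2 ^ W :=
      abs_natCast_lt (Nat.div_le_self _ _) h15W
    refine Wp.seq (T₁ := 150) (T₂ := 2000 * (n + 1))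
      (Q' := fun s₃ => s₃ = upd (upd s' 19 0 ((q / 3 ^ k % 3 : ℕ) : ℤ)) 17 0
        ((q / 3 ^ (k + 1) : ℕ) : ℤ))
      (wp_set hn hs'' (by omega) ?_ hq' (by decide) rfl) ?_ le_rfl
    · simp only [Arith.value, value_sc, upd_ne (show (17 : ℕ) ≠ 19 by omega), h17]
      rw [pow_succ, ← Nat.div_div_eq_div_mul]
      push_cast
      rfl
    rintro s₃ hs₃ hs₃e
    have hF₃ : Frame [2, 11, 17, 18, 19] s s₃ := by
      rw [hs₃e]
      exact (hF.upd (by simp) _ _).upd (by simp) _ _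
    have h2₃ : s₃ 2 = s' 2 := by rw [hs₃e, upd_ne (by omega), upd_ne (by omega)]
    have h18₃ : s₃ 18 0 = k := by rw [hs₃e, upd_ne (by omega), upd_ne (by omega), hk']
    have h19₃ : s₃ 19 0 = ((q / 3 ^ k % 3 : ℕ) : ℤ) := by rw [hs₃e, upd_ne (by omega)]; simp
    have h17₃ : s₃ 17 0 = ((q / 3 ^ (k + 1) : ℕ) : ℤ) := by rw [hs₃e]; simp
    have h5₃ : s₃ 5 = s 5 := hF₃ 5 (by simp)
    refine wp_axpyP (j := k) (N := k + 1) (c := ((q / 3 ^ k % 3 : ℕ) : ℤ)) hn hs₃ (Or.inr rfl)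
      (by rw [hF₃ 7 (by simp), h7]) hD (by omega) (by omega) ?_ ?_ ?_ (by decide) (by decide)
      (by decide) le_rfl ?_
    · intro s₄ h; simp [h 19 (by simp), h19₃]
    · intro s₄ h; simp [h 18 (by simp), h18₃]
    · intro s₄ h; simp [Arith.value, h 18 (by simp), h18₃]
    · intro s₄ hs₄ hF₄ hlt hge'
      rw [h2₃, h5₃] at hlt
      rw [h2₃] at hge'
      refine ⟨by rw [hF₄ 18 (by simp), h18₃], ((hF₃.trans (hF₄.mono (by simp))).upd (by simp) _ _),
        ?_, ?_, ?_, ?_⟩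
      · rw [upd_ne (by omega), hF₄ 17 (by simp), h17₃]
      · intro l hl
        rw [upd_ne (by omega), Finset.sum_range_succ, ← add_assoc]
        rcases lt_or_ge l (k + 1) with h | h
        · rw [hlt l h]
          obtain ⟨e₁, h1⟩ := hdvd l hl
          obtain ⟨e₂, h2⟩ : (D : ℤ) ∣ (s' 2 l + ((q / 3 ^ k % 3 : ℕ) : ℤ) * s 5 (l * n + k)) % D -
            (s' 2 l + ((q / 3 ^ k % 3 : ℕ) : ℤ) * s 5 (l * n + k)) := (Int.mod_modEq _ _).symm.dvd
          exact ⟨e₁ + e₂, by linear_combination h1 + h2⟩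
        · rw [hge' l h, hup k l (by omega) hl, mul_zero, add_zero]
          exact hdvd l hl
      · intro l hl hkl
        rw [upd_ne (by omega), hge' l hkl, hge l hl (by omega)]
      · intro l hl
        rw [upd_ne (by omega)]
        rcases lt_or_ge l (k + 1) with h | h
        · rw [hlt l h]
          exact ⟨Int.emod_nonneg _ (by omega), Int.emod_lt_of_pos _ (by omega)⟩
        · rw [hge' l h]
          exact hbd l hl
  · rw [cost_sc]
    refine Nat.mul_le_mul ?_ (by omega)
    linarith
  · rintro s' hs' - ⟨hF, -, hdvd, hge, hbd⟩
    refine hQ s' hs' hF (fun l => ?_) (fun l hl => hge l l.2 hl) fun l => hbd l l.2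
    have := hdvd l l.2
    rw [sum_range_eq_sum_Iio hj] at this
    simpa [vec, bas, digits, Finset.sum_apply] using this

end ThinLattice

/-! ### Running through the classes and updating the lattice -/

namespace ThinLattice

variable {n W : ℕ} {O : Query n → Option ℤ} {s : Store} {T : ℕ} {Q : Store → Prop}

/-- Write three times the first entries of an array to an array. -/
def tripleP (dst src : ℕ) (bound : Arith) : Prog :=
  forTo 18 bound (put dst (sc 18) (.mul (.lit 3) (rd src (sc 18))))

lemma wp_tripleP {dst src N : ℕ} {bound : Arith} (hn : (n : ℤ) < 2 ^ W) (hs : StoreFits W s)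
    (hd : dst < 32) (hd' : dst ≠ 18) (hsrc : src ≠ 18) (hN : N < width n) (hNW : (N : ℤ) < 2 ^ W)
    (hb : ∀ s', bound.value (enc n s') = N) (hcb : bound.cost ≤ 100)
    (h3 : ∀ i < N, |3 * s src i| < 2 ^ W) (hT : 1000 * (N + 1) ≤ T)
    (hQ : ∀ s', StoreFits W s' → Frame [18, dst] s s' → (∀ i < N, s' dst i = 3 * s src i) →
      Q s') :
    Wp O W (tripleP dst src bound) T Q s := by
  let I : ℕ → Store → Prop := fun k s' => Frame [18, dst] s s' ∧
    (∀ i < k, s' dst i = 3 * s src i) ∧ ∀ i, k ≤ i → s' dst i = s dst i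
  refine wp_forTo (N := N) (Tb := 200) I hn hs (by omega) hNW (fun _ _ s' _ _ _ => hb s')
    ⟨(Frame.refl _ _).upd (by simp) _ _, by simp, fun i _ => by rw [upd_ne hd']⟩ ?_ ?_
    fun s' hs' _ h => hQ s' hs' h.1 h.2.1
  · rintro k hk s' hs' hk' ⟨hF, h, h'⟩
    -- The arrays may coincide; then entry k has not been overwritten yet.
    have hsk : s' src k = s src k := by
      by_cases hsd : src = dst
      · rw [hsd, h' k le_rfl]
      · rw [hF src (by simp [hsrc, hsd])]
    refine wp_put hn hs' hd (i := k) (x := 3 * s src k) (by omega) (by simpa using hk') ?_ (h3 k hk)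
      ?_ ?_
    · rw [Arith.value, value_rd (i := k) (by simpa using hk') (by omega), hsk]
      rfl
    · simp only [Arith.cost, cost_addrE, cost_rd, cost_sc]; omega
    · refine ⟨by rwa [upd_ne hd'.symm], (hF.upd (by simp) _ _).upd (by simp) _ _, ?_, ?_⟩
      · intro i hi
        rw [upd_ne hd', upd_same]
        rcases Nat.lt_succ_iff_lt_or_eq.1 hi with hi | rfl
        · rw [Function.update_of_ne (by omega), h i hi]
        · rw [Function.update_self]
      · intro i hi
        rw [upd_ne hd', upd_same, Function.update_of_ne (by omega), h' i (by omega)]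
  · refine le_trans (Nat.mul_le_mul_right _ ?_) hT
    omega

/-- Go to the next class. -/
def nextP : Prog :=
  .seq (set 15 (.add (sc 15) (.lit 1))) <|
  .ite (sc 16) (sc 15) (.seq (set 15 (.lit 0)) (.seq (set 14 (.add (sc 14) (.lit 1)))
    (set 16 (.mul (.lit 3) (sc 16))))) skipP

/-- Classes are pairs (j, q) with q < 3^j, in lexicographic order. The power 3^j is kept in a cell,
so the end of a block is found by one comparison. -/
lemma wp_nextP {j q : ℕ} (hn : (n : ℤ) < 2 ^ W) (h3 : ((3 ^ (n + 1) : ℕ) : ℤ) < 2 ^ W)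
    (hs : StoreFits W s)
    (hj : j < n) (h14 : s 14 0 = j) (h15 : s 15 0 = q) (h16 : s 16 0 = (3 ^ j : ℕ))
    (hq : q < 3 ^ j) (hT : 1000 ≤ T)
    (hQ : ∀ s' j' q', StoreFits W s' → Frame [14, 15, 16] s s' → s' 14 0 = (j' : ℕ) →
      s' 15 0 = (q' : ℕ) → s' 16 0 = (3 ^ j' : ℕ) → q' < 3 ^ j' →
      ((j' = j ∧ q' = q + 1) ∨ (j' = j + 1 ∧ q' = 0 ∧ q + 1 = 3 ^ j)) → Q s') :
    Wp O W nextP T Q s := by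
  have hp : ∀ {k}, k ≤ 3 ^ (n + 1) → |((k : ℕ) : ℤ)| < 2 ^ W := fun hk => abs_natCast_lt hk h3
  have hj3 : 3 ^ (j + 1) ≤ 3 ^ (n + 1) := Nat.pow_le_pow_right (by norm_num) (by omega)
  have hj3' : 3 ^ (j + 1) = 3 * 3 ^ j := pow_succ' 3 j
  refine Wp.seq (T₁ := 100) (T₂ := 900) (Q' := fun s' => Frame [14, 15, 16] s s' ∧
      s' 14 0 = j ∧ s' 15 0 = (q + 1 : ℕ) ∧ s' 16 0 = (3 ^ j : ℕ))
    (wp_set hn hs (by omega) (x := (q + 1 : ℕ)) (by simp [Arith.value, h15]) (hp (by omega))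
      (by decide) ⟨(Frame.refl _ _).upd (by simp) _ _, by rwa [upd_ne (by omega)], by simp,
        by rwa [upd_ne (by omega)]⟩) ?_ hT
  rintro s₁ hs₁ ⟨hF₁, h14₁, h15₁, h16₁⟩
  refine wp_ite (T' := 600) (fun hle => ?_) (fun hlt => ?_) (by
    simp only [cost_sc]; omega)
  · simp only [value_sc, h15₁, h16₁] at hle
    have hq1 : q + 1 = 3 ^ j := by
      have : 3 ^ j ≤ q + 1 := by exact_mod_cast hle
      omega
    refine Wp.seq (T₁ := 100) (T₂ := 500) (Q' := fun s' => Frame [14, 15, 16] s s' ∧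
        s' 14 0 = j ∧ s' 15 0 = 0 ∧ s' 16 0 = (3 ^ j : ℕ))
      (wp_set hn hs₁ (by omega) (x := 0) rfl (by simp)
        (by decide) ⟨hF₁.upd (by simp) _ _, by rwa [upd_ne (by omega)], by simp,
          by rwa [upd_ne (by omega)]⟩) ?_ le_rfl
    rintro s₂ hs₂ ⟨hF₂, h14₂, h15₂, h16₂⟩
    refine Wp.seq (T₁ := 100) (T₂ := 400) (Q' := fun s' => Frame [14, 15, 16] s s' ∧
        s' 14 0 = (j + 1 : ℕ) ∧ s' 15 0 = 0 ∧ s' 16 0 = (3 ^ j : ℕ))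
      (wp_set hn hs₂ (by omega) (x := (j + 1 : ℕ)) (by simp [Arith.value, h14₂])
        (abs_natCast_lt (by omega) hn)
        (by decide) ⟨hF₂.upd (by simp) _ _, by simp, by rwa [upd_ne (by omega)],
          by rwa [upd_ne (by omega)]⟩) ?_ le_rfl
    rintro s₃ hs₃ ⟨hF₃, h14₃, h15₃, h16₃⟩
    refine wp_set hn hs₃ (by omega) (x := (3 ^ (j + 1) : ℕ)) ?_
        (hp hj3) (by decide) (hQ _ (j + 1) 0 (hs₃.upd (by omega) (hp hj3)) (hF₃.upd (by simp) _ _)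
          (by rwa [upd_ne (by omega)]) (by rw [upd_ne (by omega), h15₃]; rfl) (by simp)
          (by positivity) (Or.inr ⟨rfl, rfl, hq1⟩))
    simp only [Arith.value, value_sc, h16₃]
    rw [hj3']
    push_cast
    ring
  · simp only [value_sc, h15₁, h16₁] at hlt
    refine wp_skipP hn hs₁ (by omega) fun s' hs' he => hQ s' j (q + 1) hs' (fun a ha => by
      rw [he, hF₁ a ha]) (by rw [he, h14₁]) (by rw [he, h15₁]) (by rw [he, h16₁])
      (by exact_mod_cast hlt) (Or.inl ⟨rfl, rfl⟩)

/-- Adjoin the vector in array `2` to the lattice, and restart the list of classes. -/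
def extendP : Prog :=
  .seq (tripleP 5 5 (.mul dimE dimE)) <|
  .seq (forTo 11 dimE (put 5 (.add (.mul (sc 11) dimE) (sc 14)) (rd 2 (sc 11)))) <|
  .seq (tripleP 3 3 dimE) <|
  .seq (set 7 (.mul (.lit 3) (sc 7))) <|
  .seq (set 14 (.lit 0)) <| .seq (set 15 (.lit 0)) (set 16 (.lit 1))

/-- The column of the new vector is overwritten after the matrix has been tripled, as this vector
already has the new denominator. The reference vector is tripled too, so that its norm is unchanged.
-/
lemma wp_extendP {j D : ℕ} (hn : (n : ℤ) < 2 ^ W) (hnn : ((n * n : ℕ) : ℤ) < 2 ^ W) (hW : 0 < W)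
    (hs : StoreFits W s) (hj : j < n) (h14 : s 14 0 = j) (h7 : s 7 0 = D)
    (hD : |((3 * D : ℕ) : ℤ)| < 2 ^ W)
    (h5 : ∀ i < n * n, |3 * s 5 i| < 2 ^ W) (h3 : ∀ i < n, |3 * s 3 i| < 2 ^ W)
    (hT : 4000 * (n + 1) * (n + 1) ≤ T)
    (hQ : ∀ s', StoreFits W s' → Frame [3, 5, 7, 11, 14, 15, 16, 18] s s' →
      bas n s' = Function.update (fun i => (3 : ℤ) • bas n s i) ⟨j, hj⟩ (vec n s 2) →
      vec n s' 3 = (3 : ℤ) • vec n s 3 → s' 7 0 = (3 * D : ℕ) → s' 14 0 = 0 → s' 15 0 = 0 →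
      s' 16 0 = 1 → Q s') :
    Wp O W extendP T Q s := by
  have hT' : 1000 * (n * n + 1) + (1000 * (n + 1) + (1000 * (n + 1) + 400)) ≤ T := by
    refine le_trans ?_ hT
    nlinarith [Nat.zero_le (n * n)]
  refine Wp.seq (T₁ := 1000 * (n * n + 1)) (T₂ := 1000 * (n + 1) + (1000 * (n + 1) + 400))
    (Q' := fun s' => Frame [3, 5, 7, 11, 14, 15, 16, 18] s s' ∧ (∀ i < n * n, s' 5 i = 3 * s 5 i) ∧
      s' 3 = s 3 ∧ s' 7 0 = D ∧ s' 14 0 = j)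
    (wp_tripleP (N := n * n) hn hs (by omega) (by omega) (by omega) (by unfold width; omega) hnn
      (fun s' => by simp [Arith.value]) (by decide) h5 le_rfl
      fun s' _ h h' => ⟨h.mono (by simp), h', h 3 (by simp), by rw [h 7 (by simp), h7],
        by rw [h 14 (by simp), h14]⟩) ?_ hT'
  rintro s₁ hs₁ ⟨hF₁, h5₁, h3₁, h7₁, h14₁⟩
  have h2₁ : s₁ 2 = s 2 := hF₁ 2 (by simp)
  refine Wp.seq (T₁ := 1000 * (n + 1)) (T₂ := 1000 * (n + 1) + 400)
    (Q' := fun s' => Frame [3, 5, 7, 11, 14, 15, 16, 18] s s' ∧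
      bas n s' = Function.update (fun i => (3 : ℤ) • bas n s i) ⟨j, hj⟩ (vec n s 2) ∧
      s' 3 = s 3 ∧ s' 7 0 = D) ?_ ?_ le_rfl
  · let I : ℕ → Store → Prop := fun k s' => Frame [5, 11] s₁ s' ∧
      (∀ l i, l < n → i < n → s' 5 (l * n + i) =
        if i = j ∧ l < k then s 2 l else 3 * s 5 (l * n + i))
    refine wp_forTo (Tb := 300) I hn hs₁ (by omega) hn (fun _ _ _ _ _ _ => value_dimE)
      ⟨(Frame.refl _ _).upd (by simp) _ _, fun l i hl hi => ?_⟩ ?_ ?_ ?_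
    · rw [upd_ne (by omega), h5₁ _ (mul_add_lt hl hi)]; simp
    · rintro k hk s' hs' hk' ⟨hF, h⟩
      refine wp_put hn hs' (by omega) (i := k * n + j) (x := s 2 k) (mul_add_lt_width hk hj)
        (by simp [Arith.value, hk', hF 14 (by simp), h14₁]) ?_ (hs.bound _ _) (by decide) ?_
      · rw [value_rd (i := k) (by simpa using hk') (lt_width (by omega)), hF 2 (by simp), h2₁]
      · refine ⟨by rwa [upd_ne (by omega)], (hF.upd (by simp) _ _).upd (by simp) _ _, ?_⟩
        intro l i hl hi
        rw [upd_ne (by omega), upd_same]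
        by_cases he : l * n + i = k * n + j
        · obtain ⟨rfl, rfl⟩ := mul_add_inj hi hj he
          rw [Function.update_self, if_pos ⟨rfl, by omega⟩]
        · rw [Function.update_of_ne he, h l i hl hi]
          by_cases hij : i = j
          · subst hij
            have hlk : l ≠ k := fun h => he (by rw [h])
            congr 1
            simp only [true_and, eq_iff_iff]
            omega
          · rw [if_neg (fun h => hij h.1), if_neg (fun h => hij h.1)]
    · have : dimE.cost = 2 := rfl
      rw [this]
      exact Nat.mul_le_mul_right _ (by norm_num)
    · rintro s' hs' - ⟨hF, h⟩
      refine ⟨hF₁.trans (hF.mono (by simp)), ?_, by rw [hF 3 (by simp), h3₁],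
        by rw [hF 7 (by simp), h7₁]⟩
      funext i l
      have := h l i l.2 i.2
      unfold bas
      rw [this]
      by_cases hi : i = ⟨j, hj⟩
      · subst hi
        rw [Function.update_self, if_pos ⟨rfl, l.2⟩]
        rfl
      · rw [Function.update_of_ne hi, if_neg fun h => hi (Fin.ext h.1)]
        rfl
  rintro s₂ hs₂ ⟨hF₂, h5₂, h3₂, h7₂⟩
  refine Wp.seq (T₁ := 1000 * (n + 1)) (T₂ := 400)
    (Q' := fun s' => Frame [3, 5, 7, 11, 14, 15, 16, 18] s s' ∧
      bas n s' = Function.update (fun i => (3 : ℤ) • bas n s i) ⟨j, hj⟩ (vec n s 2) ∧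
      vec n s' 3 = (3 : ℤ) • vec n s 3 ∧ s' 7 0 = D)
    (wp_tripleP (N := n) hn hs₂ (by omega) (by omega) (by omega) (lt_width (by omega)) hn
      (fun s' => value_dimE) (by decide) (by rwa [h3₂]) le_rfl
      fun s' _ h h' => ⟨hF₂.trans (h.mono (by simp)), ?_, ?_, by rw [h 7 (by simp), h7₂]⟩) ?_ le_rfl
  · rw [← h5₂]
    unfold bas
    rw [h 5 (by simp)]
  · funext i
    rw [h3₂] at h'
    exact h' i i.2
  rintro s₃ hs₃ ⟨hF₃, h5₃, h3₃, h7₃⟩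
  have hbas : ∀ s a x, a ≠ 5 → bas n (upd s a 0 x) = bas n s := fun s a x ha => by
    unfold bas; rw [upd_ne ha.symm]
  have hvec : ∀ s a x, a ≠ 3 → vec n (upd s a 0 x) 3 = vec n s 3 := fun s a x ha => by
    unfold vec; rw [upd_ne ha.symm]
  refine Wp.seq (T₁ := 100) (T₂ := 300) (Q' := fun s' => s' = upd s₃ 7 0 ((3 * D : ℕ) : ℤ))
    (wp_set hn hs₃ (by omega) (x := ((3 * D : ℕ) : ℤ)) (by simp [Arith.value, h7₃]) hD (by decide)
      rfl) ?_ le_rfl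
  rintro s₄ hs₄ h₄
  refine Wp.seq (T₁ := 100) (T₂ := 200) (Q' := fun s' => s' = upd s₄ 14 0 0)
    (wp_set hn hs₄ (by omega) (x := 0) rfl (by simp) (by decide) rfl) ?_ le_rfl
  rintro s₅ hs₅ h₅
  refine Wp.seq (T₁ := 100) (T₂ := 100) (Q' := fun s' => s' = upd s₅ 15 0 0)
    (wp_set hn hs₅ (by omega) (x := 0) rfl (by simp) (by decide) rfl) ?_ le_rfl
  rintro s₆ hs₆ h₆
  refine wp_set hn hs₆ (by omega) (x := 1) rfl (one_lt_pow_W hW) (by decide)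
    (hQ _ (hs₆.upd (by omega) (one_lt_pow_W hW)) ?_ ?_ ?_ ?_ ?_ ?_ (by simp))
  · rw [h₆, h₅, h₄]
    exact (((hF₃.upd (by simp) _ _).upd (by simp) _ _).upd (by simp) _ _).upd (by simp) _ _
  · rw [h₆, h₅, h₄, hbas _ _ _ (by omega), hbas _ _ _ (by omega), hbas _ _ _ (by omega),
      hbas _ _ _ (by omega), h5₃]
  · rw [h₆, h₅, h₄, hvec _ _ _ (by omega), hvec _ _ _ (by omega), hvec _ _ _ (by omega),
      hvec _ _ _ (by omega), h3₃]
  · rw [h₆, h₅, h₄, upd_ne (by omega), upd_ne (by omega), upd_ne (by omega)]; simp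
  · rw [h₆, h₅, upd_ne (by omega), upd_ne (by omega)]; simp
  · rw [h₆, upd_ne (by omega)]; simp

/-- Start with the identity matrix and the denominator three. -/
def initP : Prog :=
  .seq (forTo 11 dimE (put 5 (.mul (sc 11) (.add dimE (.lit 1))) (.lit 1))) (set 7 (.lit 3))

lemma wp_initP (hn : (n : ℤ) < 2 ^ W) (hW : 1 < W) (hT : 2000 * (n + 1) ≤ T)
    (hQ : ∀ s', StoreFits W s' → Frame [5, 7, 11] 0 s' →
      bas n s' = (fun j => Pi.single j 1) → s' 7 0 = 3 → Q s') :
    Wp O W initP T Q 0 := by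
  have h1 := one_lt_pow_W (W := W) (by omega)
  have hs : StoreFits W 0 := ⟨fun _ _ => rfl, fun _ _ => by simp⟩
  have hW3 : |(3 : ℤ)| < 2 ^ W := by
    have : (2 : ℤ) ^ 2 ≤ 2 ^ W := pow_le_pow_right₀ (by norm_num) hW
    rw [abs_of_nonneg (by norm_num)]
    linarith
  let I : ℕ → Store → Prop := fun k s' => Frame [5, 7, 11] 0 s' ∧
      (∀ l i, l < n → i < n → s' 5 (l * n + i) = if i = l ∧ l < k then 1 else 0)
  refine Wp.seq (T₁ := 1000 * (n + 1)) (T₂ := 100) (Q' := I n)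
    (wp_forTo (Tb := 300) I hn hs (by omega) hn (fun _ _ _ _ _ _ => value_dimE)
      ⟨(Frame.refl _ _).upd (by simp) _ _, fun l i hl hi => by rw [upd_ne (by omega)]; simp⟩ ?_ ?_
      fun s' _ _ h => h) ?_ (by linarith)
  · rintro k hk s' hs' hk' ⟨hF, h⟩
    refine wp_put hn hs' (by omega) (i := k * n + k) (x := 1) (mul_add_lt_width hk hk) ?_ rfl h1
      (by decide) ?_
    · simp only [Arith.value, value_sc, value_dimE, hk']
      push_cast
      ring
    · refine ⟨by rwa [upd_ne (by omega)], (hF.upd (by simp) _ _).upd (by simp) _ _, ?_⟩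
      intro l i hl hi
      rw [upd_ne (by omega), upd_same]
      by_cases he : l * n + i = k * n + k
      · obtain ⟨rfl, rfl⟩ := mul_add_inj hi hk he
        rw [Function.update_self, if_pos ⟨rfl, by omega⟩]
      · rw [Function.update_of_ne he, h l i hl hi]
        by_cases hil : i = l
        · subst hil
          have hlk : i ≠ k := fun h => he (by rw [h])
          congr 1
          simp only [true_and, eq_iff_iff]
          omega
        · rw [if_neg (fun h => hil h.1), if_neg (fun h => hil h.1)]
  · have : dimE.cost = 2 := rfl
    rw [this]
    exact Nat.mul_le_mul_right _ (by norm_num)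
  · rintro s' hs' ⟨hF, h⟩
    refine wp_set hn hs' (by omega) (x := 3) rfl hW3 (by decide)
      (hQ _ (hs'.upd (by omega) hW3) (hF.upd (by simp) _ _) ?_ (by simp))
    funext j l
    unfold bas
    rw [upd_ne (by omega), h l j l.2 j.2]
    by_cases hjl : l = j
    · subst hjl
      rw [if_pos ⟨rfl, l.2⟩, Pi.single_eq_same]
    · rw [Pi.single_eq_of_ne hjl, if_neg fun h => hjl (Fin.ext h.1).symm]

/-- Write the output, except for the denominator. -/
def outP : Prog :=
  .seq (tripleP 0 5 (.mul dimE dimE))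
    (forTo 11 dimE (put 0 (.add (.mul dimE dimE) (sc 11)) (.div (rd 3 (sc 11)) (sc 7))))

/-- The stored denominator is three times that of the matrix, so the matrix is tripled. Dividing the
reference vector by the denominator is exact and restores integer coordinates. -/
lemma wp_outP {D : ℕ} {v : Fin n → ℤ} (hn : (n : ℤ) < 2 ^ W) (hnn : ((n * n : ℕ) : ℤ) < 2 ^ W)
    (hs : StoreFits W s) (hD : 0 < D) (h7 : s 7 0 = D) (h3 : vec n s 3 = (D : ℤ) • v)
    (h5 : ∀ i < n * n, |3 * s 5 i| < 2 ^ W)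
    (hT : 4000 * (n + 1) * (n + 1) ≤ T)
    (hQ : ∀ s', StoreFits W s' → s' 7 0 = D → (∀ i < n * n, s' 0 i = 3 * s 5 i) →
      (∀ l : Fin n, s' 0 (n * n + l) = v l) → Q s') :
    Wp O W outP T Q s := by
  have hT' : 1000 * (n * n + 1) + 1000 * (n + 1) ≤ T := by
    have e : 4000 * (n + 1) * (n + 1) = 1000 * (n * n + 1) + 1000 * (n + 1) +
      (3000 * (n * n) + 7000 * n + 2000) := by ring
    rw [e] at hT
    exact le_trans (Nat.le_add_right _ _) hT
  refine Wp.seq (T₁ := 1000 * (n * n + 1)) (T₂ := 1000 * (n + 1))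
    (Q' := fun s' => Frame [18, 0] s s' ∧ ∀ i < n * n, s' 0 i = 3 * s 5 i)
    (wp_tripleP (N := n * n) hn hs (by omega) (by omega) (by omega) (by unfold width; omega) hnn
      (fun s' => by simp [Arith.value]) (by decide) h5 le_rfl fun s' _ h h' => ⟨h, h'⟩) ?_ hT'
  rintro s₁ hs₁ ⟨hF₁, h0₁⟩
  have hdiv : ∀ l : Fin n, s 3 l / s 7 0 = v l := fun l => by
    have := congrFun h3 l
    simp only [vec, Pi.smul_apply, smul_eq_mul] at this
    rw [this, h7, Int.mul_ediv_cancel_left _ (by omega)]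
  have hv : ∀ l : Fin n, |v l| < 2 ^ W := fun l => by
    refine lt_of_le_of_lt ?_ (hs.bound 3 l)
    have := congrFun h3 l
    simp only [vec, Pi.smul_apply, smul_eq_mul] at this
    rw [this, abs_mul, Nat.abs_cast]
    exact le_mul_of_one_le_left (abs_nonneg _) (by exact_mod_cast hD)
  let I : ℕ → Store → Prop := fun k s' => Frame [0, 11, 18] s s' ∧
    (∀ i < n * n, s' 0 i = 3 * s 5 i) ∧ ∀ l : Fin n, (l : ℕ) < k → s' 0 (n * n + l) = v l
  refine wp_forTo (Tb := 300) I hn hs₁ (by omega) hn (fun _ _ _ _ _ _ => value_dimE)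
    ⟨(hF₁.mono (by simp)).upd (by simp) _ _, fun i hi => by rw [upd_ne (by omega), h0₁ i hi],
      fun l hl => absurd hl (Nat.not_lt_zero _)⟩ ?_ ?_ ?_
  · rintro k hk s' hs' hk' ⟨hF, h, h'⟩
    refine wp_put hn hs' (by omega) (i := n * n + k) (x := v ⟨k, hk⟩) (by unfold width; omega)
      (by simp [Arith.value, hk']) ?_ (hv _) (by decide) ?_
    · rw [Arith.value, value_rd (i := k) (by simpa using hk') (lt_width (by omega)), value_sc,
        hF 3 (by simp), hF 7 (by simp)]
      exact hdiv ⟨k, hk⟩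
    · refine ⟨by rwa [upd_ne (by omega)], (hF.upd (by simp) _ _).upd (by simp) _ _, ?_, ?_⟩
      · intro i hi
        rw [upd_ne (by omega), upd_same, Function.update_of_ne (by omega), h i hi]
      · intro l hl
        rw [upd_ne (by omega), upd_same]
        rcases Nat.lt_succ_iff_lt_or_eq.1 hl with hl | rfl
        · rw [Function.update_of_ne (by omega), h' l hl]
        · rw [Function.update_self]
  · have : dimE.cost = 2 := rfl
    rw [this]
    exact Nat.mul_le_mul_right _ (by norm_num)
  · rintro s' hs' - ⟨hF, h, h'⟩
    exact hQ s' hs' (by rw [hF 7 (by simp), h7]) h fun l => h' l l.2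

end ThinLattice

/-! ### The shortest vector and the loop over the classes -/

namespace ThinLattice

variable {n W : ℕ} {K : Set (E n)} {b : Fin n → E n} {O : Query n → Option ℤ} {c R : ℝ} {N : ℕ}
  {s s₀ : Store} {T : ℕ} {Q : Store → Prop}

/-- The time bound of an enumeration. -/
def enumTime (n N : ℕ) : ℕ := 20000 * (n + 1) * (n + 6) * (N + 1)

/-- Find a shortest vector. -/
def svpP : Prog :=
  .loop (sc 9) (.lit 0) (.seq (set 8 (.add (sc 8) (.lit 3))) (.seq (copyP 1 2) enumP))

/-- The integer radii 1, 2, … are tried in turn. An unsuccessful enumeration with radius r + 1 shows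
r + 1 ≤ λ ≤ c, so ⌊c⌋ + 1 rounds are enough and no radius exceeds c + 1. In the first success the
best vector found is a shortest one, since all points outside the ball are longer. The reference
vector is zero here and the denominator is 3, so a radius term 3r means radius r. -/
lemma wp_svpP (S : Setup W K b O c R N) (hbas : bas n s₀ = fun j => Pi.single j 1)
    (h7 : s₀ 7 0 = 3) (h3 : vec n s₀ 3 = 0) (h2 : vec n s₀ 2 = 0)
    (hQ : ∀ s' v, StoreFits W s' → Frame [0, 1, 4, 6, 8, 9, 10, 11, 13] s₀ s' →
      vec n s' 4 = (3 : ℤ) • v → comb b (fun i => (v i : ℝ)) ≠ 0 →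
      gauge K (comb b fun i => (v i : ℝ)) = minDist K (lat b) → Q s') (f : ℕ) :
    ∀ r s, StoreFits W s → Frame [0, 1, 4, 6, 8, 9, 10, 11, 13] s₀ s → s 8 0 = ((3 * r : ℕ) : ℤ) →
      s 9 0 = 0 → (r : ℝ) ≤ minDist K (lat b) → ⌊c⌋₊ + 1 ≤ r + f →
      Wp O W svpP ((enumTime n N + 2000 * (n + 1)) * f + 100) Q s := by
  have hn := S.n_lt
  have hc := S.five_le
  induction f with
  | zero =>
    intro r s _ _ _ _ hr hf
    have := Nat.le_floor (hr.trans S.le_c)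
    omega
  | succ f ih =>
    intro r s hs hF h8 h9 hr hf
    have hrc := hr.trans S.le_c
    have hr3 : |((3 * (r + 1) : ℕ) : ℤ)| < 2 ^ W := by
      refine S.abs_lt ?_
      have h1 : c ≤ c ^ n := le_self_pow₀ (by linarith) S.n_pos.ne'
      have h2 := S.R_nonneg
      push_cast
      rw [abs_of_nonneg (by positivity)]
      nlinarith
    refine wp_loop_step (T₁ := enumTime n N + 1500 * (n + 1))
      (T₂ := (enumTime n N + 2000 * (n + 1)) * f + 100)
      (Q' := fun s' => Frame [0, 1, 4, 6, 8, 9, 10, 11, 13] s₀ s' ∧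
        s' 8 0 = ((3 * (r + 1) : ℕ) : ℤ) ∧
        Best K b (3 * 1) (leaves K b (3 * 1) (r + 1 : ℕ) (coset (coordGroup b 1 (bas n s₀)) 0))
          (leaves K b (3 * 1) (r + 1 : ℕ) (coset (coordGroup b 1 (bas n s₀)) 0)) s')
      (by simp [Arith.value, h9]) ?_ ?_ ?_
    · refine Wp.seq (T₁ := 100) (T₂ := enumTime n N + 1000 * (n + 1)) (Q' := fun s' =>
          Frame [0, 1, 4, 6, 8, 9, 10, 11, 13] s₀ s' ∧ s' 8 0 = ((3 * (r + 1) : ℕ) : ℤ))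
        (wp_set hn hs (by omega) (x := ((3 * (r + 1) : ℕ) : ℤ))
          (by simp only [Arith.value, value_sc, h8]; push_cast; ring) hr3 (by decide)
          ⟨hF.upd (by simp) _ _, by simp⟩) ?_ (by linarith)
      rintro s₁ hs₁ ⟨hF₁, h8₁⟩
      refine Wp.seq (T₁ := 1000 * (n + 1)) (T₂ := enumTime n N) (Q' := fun s' =>
          Frame [0, 1, 4, 6, 8, 9, 10, 11, 13] s₀ s' ∧ s' 8 0 = ((3 * (r + 1) : ℕ) : ℤ) ∧
          vec n s' 1 = 0)
        (wp_copyP hn hs₁ (by omega) (by omega) (by omega) (by omega) le_rfl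
          fun s' _ h h' => ⟨hF₁.trans (h.mono (by simp)), by rw [h 8 (by simp), h8₁], ?_⟩) ?_
        (by linarith)
      · rw [h', ← h2]
        unfold vec
        rw [hF₁ 2 (by simp)]
      rintro s₂ hs₂ ⟨hF₂, h8₂, h1₂⟩
      have hbas₂ : bas n s₂ = bas n s₀ := by unfold bas; rw [hF₂ 5 (by simp)]
      have h3₂ : vec n s₂ 3 = 0 := by rw [← h3]; unfold vec; rw [hF₂ 3 (by simp)]
      have hreach : IsReached K b 1 (bas n s₂) := by
        rw [hbas₂, hbas]
        exact isReached_one S.indep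
      have hcount : (index (lat (ratBasis b 1 (bas n s₂))) (lat b) : ℝ) *
          (c ^ n * (((r + 1 : ℕ) : ℝ) + 1) ^ n) ≤ (2 * c ^ 2) ^ n := by
        rw [hbas₂, hbas, ratBasis_one, index, AddSubgroup.relIndex_self, Nat.cast_one, one_mul]
        exact S.count_of_le (by positivity) (by push_cast; linarith)
      have hrad : intNorm K b (3 * 1) (vec n s₂ 3) + (s₂ 8 0 : ℝ) / (3 * 1 : ℕ) = (r + 1 : ℕ) := by
        rw [h3₂, h8₂, intNorm_eq, map_zero, gauge_zero]
        push_cast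
        ring
      obtain ⟨env, hbelow⟩ := S.enumEnv hreach (by rw [hF₂ 7 (by simp), h7]; rfl)
        (by positivity) (by push_cast; linarith) hcount hrad 0
      rw [hbas₂] at env hbelow
      refine env.wp_enumP S.n_pos hs₂ ?_ ?_ hbelow le_rfl fun s' hs' hF' hB =>
        ⟨hF₂.trans (hF'.mono (by simp)), by rw [hF' 8 (by simp), h8₂], hB⟩
      · rw [h1₂]
        change (0 : Fin n → ℤ) - 0 ∈ coordGroup b 1 (bas n s₀)
        rw [sub_zero]
        exact zero_mem _
      · intro i
        rw [h1₂]
        simp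
    · rintro s₁ hs₁ ⟨hF₁, h8₁, hB⟩
      have hlat : ∀ z ∈ lat b, ∃ u ∈ coset (coordGroup b 1 (bas n s₀)) 0,
          scaled b (3 * 1) u = z := by
        intro z hz
        rw [← ratBasis_one b, ← hbas] at hz
        obtain ⟨u, hu, rfl⟩ := exists_scaled_eq hz
        refine ⟨u, ?_, rfl⟩
        change u - 0 ∈ coordGroup b 1 (bas n s₀)
        rwa [sub_zero]
      have hb0 : b ⟨0, S.n_pos⟩ ∈ lat b := Submodule.subset_span ⟨_, rfl⟩
      rcases hB with ⟨h9, hB⟩ | ⟨h9, hG, hne, hmin⟩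
      · refine ih (r + 1) s₁ hs₁ hF₁ h8₁ h9 ?_ (by omega)
        refine le_minDist hb0 (S.indep.ne_zero _) fun z hz hz0 => ?_
        by_contra! hlt
        obtain ⟨u, hu, rfl⟩ := hlat z hz
        rw [hB u ⟨hu, hlt.le⟩, map_zero] at hz0
        exact hz0 rfl
      · have hmem : vec n s₁ 4 - 0 ∈ coordGroup b 1 (bas n s₀) := hG.1
        rw [sub_zero] at hmem
        have hlat4 : scaled b (3 * 1) (vec n s₁ 4) ∈ lat b := by
          have := hmem
          rwa [mem_coordGroup, hbas, ratBasis_one] at this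
        obtain ⟨v, hv⟩ := (mem_coordGroup_iff S.indep one_pos).1 hmem
        have hv' : vec n s₁ 4 = (3 : ℤ) • v := by
          rw [hv, hbas]
          funext l
          rw [Finset.sum_apply, Finset.sum_eq_single l]
          · simp [mul_comm]
          · intro i _ hi
            simp [Pi.single_eq_of_ne hi.symm]
          · simp
        have hsc : scaled b (3 * 1) (vec n s₁ 4) = comb b (fun i => (v i : ℝ)) := by
          rw [hv', scaled_three, scaled_apply]
          simp
        have hne' : scaled b (3 * 1) (vec n s₁ 4) ≠ 0 := fun h => hne
          (scaled_injective S.indep (by norm_num) (h.trans (map_zero _).symm))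
        refine wp_loop_stop hn hs₁ (by simp [Arith.value, h9]) (by rw [cost_sc]; simp only [Arith.cost]; omega)
          (hQ s₁ v hs₁ hF₁ hv' (hsc ▸ hne') ?_)
        rw [← hsc]
        refine le_antisymm (le_minDist hb0 (S.indep.ne_zero _) fun z hz hz0 => ?_)
          (minDist_le_gauge hlat4 hne')
        obtain ⟨u, hu, rfl⟩ := hlat z hz
        have hu0 : u ≠ 0 := fun h => hz0 (by rw [h, map_zero])
        rcases le_total (gauge K (scaled b (3 * 1) u)) ((r + 1 : ℕ) : ℝ) with hle | hle
        · exact hmin u ⟨hu, hle⟩ hu0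
        · exact hG.2.trans hle
    · rw [cost_sc, mul_add_one (enumTime n N + 2000 * (n + 1)) f]
      simp only [Arith.cost]
      linarith

/-- Try one class of points, and adjoin it to the lattice if it is far from the lattice. -/
def classP : Prog :=
  .seq buildP <| .seq (copyP 1 2) <| .seq enumP (.ite (sc 9) (.lit 0) extendP nextP)

/-- Try all classes. -/
def classesP : Prog := .loop (.add (sc 14) (.lit 1)) dimE classP

/-- The current lattice, and the shortest vector with coordinates `v`, are stored. -/
structure MainInv (K : Set (E n)) (b : Fin n → E n) (v : Fin n → ℤ) (D : ℕ) (s : Store) : Prop where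
  reached : IsReached K b D (bas n s)
  den : s 7 0 = ((3 * D : ℕ) : ℤ)
  rad : s 8 0 = 0
  short : vec n s 3 = ((3 * D : ℕ) : ℤ) • v

lemma MainInv.congr {v : Fin n → ℤ} {D : ℕ} (h : MainInv K b v D s) {s' : Store} (h3 : s' 3 = s 3)
    (h5 : s' 5 = s 5) (h7 : s' 7 = s 7) (h8 : s' 8 = s 8) : MainInv K b v D s' := by
  have e1 : bas n s' = bas n s := by unfold bas; rw [h5]
  have e2 : vec n s' 3 = vec n s 3 := by unfold vec; rw [h3]
  exact ⟨e1 ▸ h.reached, h7 ▸ h.den, h8 ▸ h.rad, e2 ▸ h.short⟩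

namespace Setup

variable {v : Fin n → ℤ} {D : ℕ}

lemma abs_entry_lt (S : Setup W K b O c R N) (h : MainInv K b v D s) {i : ℕ} (hi : i < n * n) :
    |3 * s 5 i| < 2 ^ W := by
  have hn := S.n_pos
  have h1 := h.reached.bound ⟨i % n, Nat.mod_lt _ hn⟩ ⟨i / n, Nat.div_lt_of_lt_mul hi⟩
  simp only [bas, Nat.div_add_mod'] at h1
  refine lt_of_le_of_lt ?_ (S.three_mul_lt h.reached (m := 3) (by norm_num))
  rw [abs_of_nonneg (by omega), abs_of_nonneg (by positivity)]
  push_cast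
  omega

lemma abs_short_lt (S : Setup W K b O c R N) (h : MainInv K b v D s)
    (hv : gauge K (comb b fun i => (v i : ℝ)) = minDist K (lat b)) {i : ℕ} (hi : i < n) :
    |3 * s 3 i| < 2 ^ W := by
  have h1 := congrFun h.short ⟨i, hi⟩
  simp only [vec, Pi.smul_apply, smul_eq_mul] at h1
  rw [h1]
  refine S.abs_lt ?_
  have h2 := S.coord_le (fun i => (v i : ℝ)) (by rw [hv]; linarith [S.le_c]) ⟨i, hi⟩
  have h3 := S.le_pow h.reached
  have h4 := S.R_nonneg
  have h5 : 0 ≤ c ^ n := (Nat.cast_nonneg _).trans h3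
  push_cast
  rw [abs_mul, abs_mul, abs_mul, Nat.abs_cast, abs_of_pos (by norm_num : (0 : ℝ) < 3)]
  calc 3 * (3 * (D : ℝ) * |(v ⟨i, hi⟩ : ℝ)|) = 9 * D * |(v ⟨i, hi⟩ : ℝ)| := by ring
    _ ≤ 9 * c ^ n * (R + 3) := by gcongr; linarith

lemma mul_self_lt (S : Setup W K b O c R N) : ((n * n : ℕ) : ℤ) < 2 ^ W :=
  lt_of_le_of_lt (by push_cast; linarith [(Nat.cast_nonneg n : (0 : ℤ) ≤ n)]) S.sq_lt

lemma one_lt_W (S : Setup W K b O c R N) : 1 < W := by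
  have h1 := S.lt_W
  by_contra! h
  have h2 : (2 : ℤ) ^ W ≤ 2 ^ 1 := pow_le_pow_right₀ (by norm_num) h
  have h3 : (3 : ℤ) ^ 1 ≤ 3 ^ (n + 1) := pow_le_pow_right₀ (by norm_num) (by omega)
  push_cast at h1
  linarith

/-- One class. -/
lemma wp_classP (S : Setup W K b O c R N) (hs : StoreFits W s) (h : MainInv K b v D s)
    (hshort : gauge K (comb b fun i => (v i : ℝ)) = minDist K (lat b))
    {j q : ℕ} (hj : j < n)
    (h14 : s 14 0 = j) (h15 : s 15 0 = q) (h16 : s 16 0 = ((3 ^ j : ℕ) : ℤ)) (hq : q < 3 ^ j)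
    (hT : enumTime n N + 19000 * (n + 1) * (n + 1) ≤ T)
    (hQ1 : ∀ s', StoreFits W s' → MainInv K b v (3 * D) s' → s' 14 0 = 0 → s' 15 0 = 0 →
      s' 16 0 = 1 → Q s')
    (hQ2 : ∀ s' j' q', StoreFits W s' → MainInv K b v D s' → bas n s' = bas n s →
      latDist K (lat (ratBasis b D (bas n s)))
        (thirdVec (ratBasis b D (bas n s)) ⟨j, hj⟩ (digits n q)) ≤ minDist K (lat b) →
      s' 14 0 = (j' : ℕ) → s' 15 0 = (q' : ℕ) → s' 16 0 = ((3 ^ j' : ℕ) : ℤ) → q' < 3 ^ j' →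
      ((j' = j ∧ q' = q + 1) ∨ (j' = j + 1 ∧ q' = 0 ∧ q + 1 = 3 ^ j)) → Q s') :
    Wp O W classP T Q s := by
  have hn := S.n_lt
  have hreach := h.reached
  have hpos := hreach.pos
  have hT' : 10000 * (n + 1) * (n + 1) + (1000 * (n + 1) + (enumTime n N +
      (4000 * (n + 1) * (n + 1) + 1000))) ≤ T := by
    have e : enumTime n N + 19000 * (n + 1) * (n + 1) = 10000 * (n + 1) * (n + 1) + (1000 * (n + 1) +
      (enumTime n N + (4000 * (n + 1) * (n + 1) + 1000))) + (5000 * (n * n) + 9000 * n + 3000) := by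
      ring
    rw [e] at hT
    exact le_trans (Nat.le_add_right _ _) hT
  refine Wp.seq (T₁ := 10000 * (n + 1) * (n + 1)) (T₂ := 1000 * (n + 1) + (enumTime n N +
      (4000 * (n + 1) * (n + 1) + 1000))) (Q' := fun s' => Frame [2, 11, 17, 18, 19] s s' ∧
      (∀ l, ((3 * D : ℕ) : ℤ) ∣ vec n s' 2 l -
        (bas n s ⟨j, hj⟩ + ∑ i ∈ Finset.Iio ⟨j, hj⟩, digits n q i • bas n s i) l) ∧
      (∀ l, ⟨j, hj⟩ ≤ l → vec n s' 2 l = bas n s ⟨j, hj⟩ l) ∧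
      (∀ l, 0 ≤ vec n s' 2 l ∧ vec n s' 2 l < ((3 * D : ℕ) : ℤ)))
    (wp_buildP hn S.one_lt_W hs h.den (by omega) hj h14 h15 ?_ ?_ le_rfl
      fun s' _ h1 h2 h3 h4 => ⟨h1, h2, h3, h4⟩) ?_ hT'
  · intro i l hil hl
    exact hreach.upper ⟨i, hil.trans hl⟩ ⟨l, hl⟩ (Fin.lt_def.2 hil)
  · intro l hl
    have := hreach.bound ⟨j, hj⟩ ⟨l, hl⟩
    simp only [bas] at this
    push_cast
    omega
  rintro s₁ hs₁ ⟨hF₁, hdvd, hge, hbd⟩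
  obtain ⟨a, ha⟩ := hreach.exists_thirdVec S.body S.n_pos S.indep hdvd hge
  refine Wp.seq (T₁ := 1000 * (n + 1)) (T₂ := enumTime n N + (4000 * (n + 1) * (n + 1) + 1000))
    (Q' := fun s' => Frame [1, 2, 11, 17, 18, 19] s s' ∧ s' 2 = s₁ 2 ∧ vec n s' 1 = vec n s₁ 2)
    (wp_copyP hn hs₁ (by omega) (by omega) (by omega) (by omega) le_rfl
      fun s' _ h h' => ⟨(hF₁.mono (by simp)).trans (h.mono (by simp)), h 2 (by simp), h'⟩) ?_ le_rfl
  rintro s₂ hs₂ ⟨hF₂, h2₂, h1₂⟩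
  have h₂ : MainInv K b v D s₂ := h.congr (hF₂ 3 (by simp)) (hF₂ 5 (by simp)) (hF₂ 7 (by simp))
    (hF₂ 8 (by simp))
  have hbas₂ : bas n s₂ = bas n s := by unfold bas; rw [hF₂ 5 (by simp)]
  -- With radius term 0 the radius is the norm of the reference vector; its coordinates 3D v over
  -- the denominator 3D give v, so the radius is exactly λ.
  obtain ⟨env, hbelow⟩ := S.enumEnv (ρ := minDist K (lat b)) h₂.reached h₂.den
    (by linarith [S.one_le]) (by linarith [S.le_c]) (S.count_of_eq h₂.reached) (by
      rw [h₂.short, h₂.rad, ← hshort, intNorm_eq]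
      have := scaled_mul (b := b) (D := 1) (m := 3 * D) (by omega) v
      rw [mul_one] at this
      rw [this, scaled_apply]
      simp) (vec n s₁ 2)
  rw [hbas₂] at env hbelow
  refine Wp.seq (T₁ := enumTime n N) (T₂ := 4000 * (n + 1) * (n + 1) + 1000)
    (Q' := fun s' => Frame scratch s₂ s' ∧ Best K b (3 * D)
      (leaves K b (3 * D) (minDist K (lat b)) (coset (coordGroup b D (bas n s)) (vec n s₁ 2)))
      (leaves K b (3 * D) (minDist K (lat b)) (coset (coordGroup b D (bas n s)) (vec n s₁ 2))) s')
    (env.wp_enumP S.n_pos hs₂ ?_ (by rw [h1₂]; exact hbd) hbelow le_rfl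
      fun s' _ h h' => ⟨h, h'⟩) ?_ le_rfl
  · rw [h1₂]
    change vec n s₁ 2 - vec n s₁ 2 ∈ coordGroup b D (bas n s)
    rw [sub_self]
    exact zero_mem _
  rintro s₃ hs₃ ⟨hF₃, hB⟩
  have h₃ : MainInv K b v D s₃ := h₂.congr (hF₃ 3 (by simp)) (hF₃ 5 (by simp)) (hF₃ 7 (by simp))
    (hF₃ 8 (by simp))
  have hbas₃ : bas n s₃ = bas n s := by rw [← hbas₂]; unfold bas; rw [hF₃ 5 (by simp)]
  have h14₃ : s₃ 14 0 = j := by rw [hF₃ 14 (by simp), hF₂ 14 (by simp), h14]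
  have h15₃ : s₃ 15 0 = q := by rw [hF₃ 15 (by simp), hF₂ 15 (by simp), h15]
  have h16₃ : s₃ 16 0 = ((3 ^ j : ℕ) : ℤ) := by rw [hF₃ 16 (by simp), hF₂ 16 (by simp), h16]
  have hX₃ : vec n s₃ 2 = vec n s₁ 2 := by unfold vec; rw [hF₃ 2 (by simp), h2₂]
  have hmin := hreach.minDist_eq S.body S.n_pos S.indep
  refine wp_ite (T' := 4000 * (n + 1) * (n + 1) + 900) (fun hle => ?_) (fun hlt => ?_)
    (by rw [cost_sc]; simp only [Arith.cost]; linarith)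
  · simp only [Arith.value, value_sc] at hle
    obtain ⟨-, hno⟩ := hB.resolve_right (by omega)
    have hlt := hreach.lt_latDist S.body S.n_pos S.indep hge hno
    have hext := hreach.extend S.body S.n_pos S.indep ha hge (fun l => ⟨(hbd l).1, (hbd l).2.le⟩)
      (by rwa [hmin])
    refine wp_extendP hn S.mul_self_lt S.W_pos hs₃ hj h14₃ h₃.den ?_
      (fun i hi => S.abs_entry_lt h₃ hi) (fun i hi => S.abs_short_lt h₃ hshort hi) (by linarith) ?_
    · rw [← mul_assoc]
      exact S.three_mul_lt hreach (by norm_num)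
    · intro s' hs' hF' hb' h3' h7' h14' h15' h16'
      refine hQ1 s' hs' ⟨?_, h7', by rw [hF' 8 (by simp), h₃.rad], ?_⟩ h14' h15' h16'
      · rw [hb', hX₃, hbas₃]
        exact hext
      · rw [h3', h₃.short, smul_smul]
        push_cast
        rfl
  · simp only [Arith.value, value_sc] at hlt
    obtain ⟨-, hG, -⟩ := hB.resolve_left (by omega)
    have hle := IsReached.latDist_le_of_mem S.body hG
    rw [ha, latDist_thirdVec (z := digits n q) _ fun i _ => ⟨a i, rfl⟩] at hle
    refine wp_nextP hn S.lt_W hs₃ hj h14₃ h15₃ h16₃ hq ?_ ?_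
    · have : 1 * 1 ≤ (n + 1) * (n + 1) := Nat.mul_le_mul (by omega) (by omega)
      linarith
    intro s' j' q' hs' hF' h14' h15' h16' hq' hcase
    refine hQ2 s' j' q' hs' (h₃.congr (hF' 3 (by simp)) (hF' 5 (by simp)) (hF' 7 (by simp))
      (hF' 8 (by simp))) ?_ hle h14' h15' h16' hq' hcase
    rw [← hbas₃]; unfold bas; rw [hF' 5 (by simp)]

/-- k counts the extensions made and g bounds the classes left in the current pass. The class (j, q)
has (3^j - 1)/2 + q predecessors among (3^n - 1)/2 classes, whence the inequality with 2g. An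
extension resets g to 3^n but lowers κ - k by one; a class close to the lattice lowers g. A pass
without extension shows that all classes are close, and the densification has stopped. -/
lemma wp_classesP (S : Setup W K b O c R N)
    (hshort : gauge K (comb b fun i => (v i : ℝ)) = minDist K (lat b)) {κ : ℕ}
    (hκ : ∀ k : ℕ, (3 : ℝ) ^ k ≤ c ^ n → k ≤ κ)
    (hQ : ∀ s' D, StoreFits W s' → MainInv K b v D s' →
      IsRogersOutput K (lat b) (lat (ratBasis b D (bas n s'))) → Q s') (f : ℕ) :
    ∀ k g j q s, StoreFits W s → MainInv K b v (3 ^ k) s → s 14 0 = ((j : ℕ) : ℤ) →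
      s 15 0 = ((q : ℕ) : ℤ) → s 16 0 = ((3 ^ j : ℕ) : ℤ) → q < 3 ^ j → j ≤ n →
      (∀ j' q' (hj' : j' < n), q' < 3 ^ j' → (j' < j ∨ j' = j ∧ q' < q) →
        latDist K (lat (ratBasis b (3 ^ k) (bas n s)))
          (thirdVec (ratBasis b (3 ^ k) (bas n s)) ⟨j', hj'⟩ (digits n q')) ≤ minDist K (lat b)) →
      3 ^ n ≤ 3 ^ j + 2 * q + 2 * g → (κ - k) * 3 ^ n + g ≤ f →
      Wp O W classesP ((enumTime n N + 20000 * (n + 1) * (n + 1)) * f + 100) Q s := by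
  have hn := S.n_lt
  have hend : ∀ k q s, StoreFits W s → MainInv K b v (3 ^ k) s → s 14 0 = ((n : ℕ) : ℤ) →
      (∀ j' q' (hj' : j' < n), q' < 3 ^ j' → (j' < n ∨ j' = n ∧ q' < q) →
        latDist K (lat (ratBasis b (3 ^ k) (bas n s)))
          (thirdVec (ratBasis b (3 ^ k) (bas n s)) ⟨j', hj'⟩ (digits n q')) ≤ minDist K (lat b)) →
      ∀ T, 100 ≤ T → Wp O W classesP T Q s := by
    intro k q s hs h h14 hdone T hT
    refine wp_loop_stop hn hs (by simp [Arith.value, h14]) (le_trans (by decide) hT)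
      (hQ s _ hs h (h.reached.isRogersOutput S.body fun j z hz => ?_))
    rw [h.reached.minDist_eq S.body S.n_pos S.indep]
    let z' : ℕ → ℤ := fun i => if hi : i < n then z ⟨i, hi⟩ else 0
    obtain ⟨q', hq', hz'⟩ := exists_digits j z' fun i => by
      by_cases hi : i < n
      · simp only [z', dif_pos hi]
        exact hz _
      · simp [z', hi]
    refine le_trans (le_of_eq ?_) (hdone j q' j.2 hq' (Or.inl j.2))
    refine latDist_thirdVec j fun i hi => ⟨0, ?_⟩
    rw [mul_zero, add_zero, digits, hz' i (Fin.lt_def.1 hi)]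
    simp [z']
  induction f using Nat.strong_induction_on with
  | _ f ih =>
  intro k g j q s hs h h14 h15 h16 hq hjn hdone hg hf
  rcases hjn.eq_or_lt with rfl | hj
  · exact hend k q s hs h h14 hdone _ (Nat.le_add_left _ _)
  have hg1 : 1 ≤ g := by
    have h1 : 3 ^ (j + 1) ≤ 3 ^ n := Nat.pow_le_pow_right (by norm_num) hj
    rw [pow_succ] at h1
    omega
  obtain ⟨f, rfl⟩ : ∃ f', f = f' + 1 := ⟨f - 1, by omega⟩
  refine wp_loop_step (T₁ := enumTime n N + 19000 * (n + 1) * (n + 1))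
    (T₂ := (enumTime n N + 20000 * (n + 1) * (n + 1)) * f + 100)
    (Q' := fun s' => Wp O W classesP ((enumTime n N + 20000 * (n + 1) * (n + 1)) * f + 100) Q s')
    (by simp only [Arith.value, value_sc, value_dimE, h14]; omega)
    (S.wp_classP hs h hshort hj h14 h15 h16 hq le_rfl ?_ ?_) (fun s' _ h => h) ?_
  · intro s' hs' h' h14' h15' h16'
    -- The new denominator 3^(k+1) is again bounded by the index, hence by c^n, so the budget of
    -- extensions is never exceeded.
    have hk : k + 1 ≤ κ := hκ _ (by
      have := S.le_pow h'.reached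
      rw [pow_succ']
      exact_mod_cast this)
    refine ih f (by omega) (k + 1) (3 ^ n) 0 0 s' hs' (by rwa [pow_succ']) h14' h15' (by simpa using h16')
      (by simp) (Nat.zero_le _) (fun j' q' hj' _ hlt => by omega) (by omega) ?_
    have e : κ - k = (κ - (k + 1)) + 1 := by omega
    rw [e, add_mul, one_mul] at hf
    omega
  · intro s' j' q' hs' h' hbas hle h14' h15' h16' hq' hcase
    have h3 : 3 ^ (j + 1) = 3 * 3 ^ j := pow_succ' 3 j
    refine ih f (by omega) k (g - 1) j' q' s' hs' h' h14' h15' h16' hq' (by omega) ?_ ?_ (by omega)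
    · rw [hbas]
      intro j'' q'' hj'' hq'' hlt
      by_cases he : j'' = j ∧ q'' = q
      · obtain ⟨rfl, rfl⟩ := he
        exact hle
      · refine hdone j'' q'' hj'' hq'' ?_
        rcases hcase with ⟨rfl, rfl⟩ | ⟨rfl, rfl, hq1⟩
        · omega
        · rcases hlt with hlt | ⟨-, h0⟩
          · rcases Nat.lt_succ_iff_lt_or_eq.1 hlt with hlt | rfl
            · exact Or.inl hlt
            · exact Or.inr ⟨rfl, by omega⟩
          · omega
    · rcases hcase with ⟨rfl, rfl⟩ | ⟨rfl, rfl, hq1⟩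
      · omega
      · rw [h3]; omega
  · have hd : dimE.cost = 2 := rfl
    rw [mul_add_one (enumTime n N + 20000 * (n + 1) * (n + 1)) f, hd]
    simp only [Arith.cost, cost_sc]
    have : 1 * 1 ≤ (n + 1) * (n + 1) := Nat.mul_le_mul (by omega) (by omega)
    linarith

end Setup

end ThinLattice

/-! ### The complete program -/

namespace ThinLattice

variable {n W : ℕ} {K : Set (E n)} {b : Fin n → E n} {O : Query n → Option ℤ} {c R : ℝ} {N : ℕ}
  {s : Store} {T : ℕ} {Q : Store → Prop}

/-- The densification, up to the output of the denominator. -/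
def mainP : Prog :=
  .seq initP <| .seq svpP <| .seq (copyP 3 4) <| .seq (set 8 (.lit 0)) <|
  .seq (set 16 (.lit 1)) <| .seq classesP outP

/-- The densification. -/
def densifyP : Prog := .seq mainP (.store (.lit 0) (sc 7))

/-- The time bound of the densification. -/
def densifyTime (n N f₁ f₂ : ℕ) : ℕ :=
  (enumTime n N + 2000 * (n + 1)) * f₁ + (enumTime n N + 20000 * (n + 1) * (n + 1)) * f₂ +
    (4000 * (n + 1) * (n + 1) + 3000 * (n + 1) + 500)

lemma wp_mainP (S : Setup W K b O c R N) {κ : ℕ} (hκ : ∀ k : ℕ, (3 : ℝ) ^ k ≤ c ^ n → k ≤ κ)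
    (hQ : ∀ s' D B (v : Fin n → ℤ), StoreFits W s' → IsReached K b D B →
      IsRogersOutput K (lat b) (lat (ratBasis b D B)) → s' 7 0 = ((3 * D : ℕ) : ℤ) →
      (∀ i j : Fin n, s' 0 (i * n + j) = 3 * B j i) → (∀ l : Fin n, s' 0 (n * n + l) = v l) →
      comb b (fun i => (v i : ℝ)) ≠ 0 →
      gauge K (comb b fun i => (v i : ℝ)) = minDist K (lat b) → Q s') :
    Wp O W mainP (densifyTime n N (⌊c⌋₊ + 1) (κ * 3 ^ n + 3 ^ n)) Q 0 := by
  have hn := S.n_lt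
  have hc := S.five_le
  -- The products are made opaque, so that the remaining time bounds are linear.
  obtain ⟨t₁, ht₁⟩ : ∃ t, t = (enumTime n N + 2000 * (n + 1)) * (⌊c⌋₊ + 1) := ⟨_, rfl⟩
  obtain ⟨t₂, ht₂⟩ : ∃ t, t = (enumTime n N + 20000 * (n + 1) * (n + 1)) * (κ * 3 ^ n + 3 ^ n) :=
    ⟨_, rfl⟩
  rw [densifyTime, ← ht₁, ← ht₂]
  obtain ⟨t₃, ht₃⟩ : ∃ t, t = 4000 * (n + 1) * (n + 1) := ⟨_, rfl⟩
  rw [← ht₃]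
  refine Wp.seq (T₁ := 2000 * (n + 1)) (T₂ := t₁ + 100 + (1000 * (n + 1) + (200 + (t₂ + 100 + t₃))))
    (Q' := fun s' => Frame [5, 7, 11] 0 s' ∧ bas n s' = (fun j => Pi.single j 1) ∧ s' 7 0 = 3)
    (wp_initP hn S.one_lt_W le_rfl fun s' _ h1 h2 h3 => ⟨h1, h2, h3⟩) ?_ (by linarith)
  rintro s₁ hs₁ ⟨hF₁, hb₁, h7₁⟩
  have hz : ∀ a, a ∉ [5, 7, 11] → s₁ a = 0 := fun a ha => hF₁ a ha
  refine Wp.seq (T₁ := t₁ + 100) (T₂ := 1000 * (n + 1) + (200 + (t₂ + 100 + t₃)))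
    (Q' := fun s' => Frame [0, 1, 4, 6, 8, 9, 10, 11, 13] s₁ s' ∧
      ∃ v : Fin n → ℤ, vec n s' 4 = (3 : ℤ) • v ∧ comb b (fun i => (v i : ℝ)) ≠ 0 ∧
      gauge K (comb b fun i => (v i : ℝ)) = minDist K (lat b)) ?_ ?_ le_rfl
  · rw [ht₁]
    refine wp_svpP S hb₁ h7₁ ?_ ?_ (fun s' v _ h1 h2 h3 h4 => ⟨h1, v, h2, h3, h4⟩) _ 0 s₁ hs₁
      (.refl _ _) ?_ ?_ ?_ (by omega)
    · unfold vec; rw [hz 3 (by simp)]; rfl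
    · unfold vec; rw [hz 2 (by simp)]; rfl
    · rw [hz 8 (by simp)]; rfl
    · rw [hz 9 (by simp)]; rfl
    · rw [Nat.cast_zero]
      exact minDist_nonneg
  rintro s₂ hs₂ ⟨hF₂, v, hv, hv0, hshort⟩
  refine Wp.seq (T₁ := 1000 * (n + 1)) (T₂ := 200 + (t₂ + 100 + t₃))
    (Q' := fun s' => Frame [0, 1, 3, 4, 6, 8, 9, 10, 11, 13] s₁ s' ∧ vec n s' 3 = (3 : ℤ) • v)
    (wp_copyP hn hs₂ (by omega) (by omega) (by omega) (by omega) le_rfl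
      fun s' _ h h' => ⟨(hF₂.mono (by simp)).trans (h.mono (by simp)), by rw [h', hv]⟩) ?_ le_rfl
  rintro s₃ hs₃ ⟨hF₃, h3₃⟩
  -- From here on the radius term is 0, and the radius comes from the reference vector alone.
  refine Wp.seq (T₁ := 100) (T₂ := 100 + (t₂ + 100 + t₃)) (Q' := fun s' => s' = upd s₃ 8 0 0)
    (wp_set hn hs₃ (by omega) (x := 0) rfl (by simp) (by decide) rfl) ?_ (by linarith)
  rintro s₄ hs₄ h₄
  refine Wp.seq (T₁ := 100) (T₂ := t₂ + 100 + t₃) (Q' := fun s' => s' = upd s₄ 16 0 1)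
    (wp_set hn hs₄ (by omega) (x := 1) rfl (one_lt_pow_W S.W_pos) (by decide) rfl) ?_ le_rfl
  rintro s₅ hs₅ h₅
  have e5 : ∀ a, a ≠ 8 → a ≠ 16 → s₅ a = s₃ a := fun a h h' => by
    rw [h₅, upd_ne h', h₄, upd_ne h]
  have hinv : MainInv K b v (3 ^ 0) s₅ := by
    refine ⟨?_, ?_, ?_, ?_⟩
    · have : bas n s₅ = fun j => Pi.single j 1 := by
        rw [← hb₁]
        unfold bas
        rw [e5 5 (by omega) (by omega), hF₃ 5 (by simp)]
      rw [this]
      exact isReached_one S.indep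
    · rw [e5 7 (by omega) (by omega), hF₃ 7 (by simp), h7₁]; rfl
    · rw [h₅, upd_ne (by omega), h₄]; simp
    · have : vec n s₅ 3 = vec n s₃ 3 := by unfold vec; rw [e5 3 (by omega) (by omega)]
      rw [this, h3₃]; rfl
  refine Wp.seq (T₁ := t₂ + 100) (T₂ := t₃) (Q' := fun s' => ∃ D, MainInv K b v D s' ∧
    IsRogersOutput K (lat b) (lat (ratBasis b D (bas n s')))) ?_ ?_ le_rfl
  · rw [ht₂]
    refine S.wp_classesP hshort hκ (fun s' D _ h1 h2 => ⟨D, h1, h2⟩) _ 0 (3 ^ n) 0 0 s₅ hs₅ hinv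
      ?_ ?_ ?_ (by simp) (Nat.zero_le _) (fun j' q' hj' _ hlt => by omega) (by omega) le_rfl
    · rw [e5 14 (by omega) (by omega), hF₃ 14 (by simp), hz 14 (by simp)]; rfl
    · rw [e5 15 (by omega) (by omega), hF₃ 15 (by simp), hz 15 (by simp)]; rfl
    · rw [h₅]; simp
  rintro s₆ hs₆ ⟨D, h₆, hout⟩
  have hpos := h₆.reached.pos
  refine wp_outP hn S.mul_self_lt hs₆ (by omega) h₆.den h₆.short
    (fun i hi => S.abs_entry_lt h₆ hi) (by rw [ht₃]) ?_
  intro s' hs' h7' h0' hv'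
  exact hQ s' D (bas n s₆) v hs' h₆.reached hout h7' (fun i j => h0' _ (mul_add_lt i.2 j.2)) hv' hv0
    hshort

lemma enc_zero : enc n 0 = initMem n := by
  funext a
  simp [enc, initMem]

theorem exists_run (S : Setup W K b O c R N) {κ : ℕ} (hκ : ∀ k : ℕ, (3 : ℝ) ^ k ≤ c ^ n → k ≤ κ) :
    ∃ (m : Mem) (t : ℕ), Run O (cells n) W densifyP (initMem n) m t ∧
      t ≤ densifyTime n N (⌊c⌋₊ + 1) (κ * 3 ^ n + 3 ^ n) + 100 ∧ 0 < m 0 ∧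
      IsRogersOutput K (lat b) (lat (outBasis b m)) ∧
      IsDirectionalBasis (outBasis b m) (lat (outBasis b m)) b ∧
      outVector b m ∈ lat b ∧ outVector b m ≠ 0 ∧
      gauge K (outVector b m) = minDist K (lat (outBasis b m)) := by
  obtain ⟨s, t, hrun, ht, hs, D, B, v, hreach, hout, h7, hB, hv, hv0, hshort⟩ :=
    wp_mainP S hκ (Q := fun s => ∃ D B, ∃ v : Fin n → ℤ, IsReached K b D B ∧
      IsRogersOutput K (lat b) (lat (ratBasis b D B)) ∧ s 7 0 = ((3 * D : ℕ) : ℤ) ∧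
      (∀ i j : Fin n, s 0 (i * n + j) = 3 * B j i) ∧ (∀ l : Fin n, s 0 (n * n + l) = v l) ∧
      comb b (fun i => (v i : ℝ)) ≠ 0 ∧
      gauge K (comb b fun i => (v i : ℝ)) = minDist K (lat b))
      fun s D B v _ h1 h2 h3 h4 h5 h6 h7 => ⟨D, B, v, h1, h2, h3, h4, h5, h6, h7⟩
  have hpos := hreach.pos
  -- Array addresses are computed from the dimension in cell 0. The denominator may replace it there
  -- only in the very last command, which is therefore executed outside the calculus of stores.
  set m : Mem := Function.update (enc n s) 0 ((3 * D : ℕ) : ℤ) with hm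
  have hfits := hs.fits S.n_lt
  have hfits' : Fits (cells n) W m := by
    refine ⟨fun a ha => ?_, fun a => ?_⟩
    · have : a ≠ 0 := by unfold cells at ha; omega
      rw [hm, Function.update_of_ne this, hfits.1 a ha]
    · by_cases ha : a = 0
      · rw [ha, hm, Function.update_self]
        exact S.three_mul_lt hreach (by norm_num)
      · rw [hm, Function.update_of_ne ha]
        exact hfits.2 a
  have hstore : Run O (cells n) W (.store (.lit 0) (sc 7)) (enc n s) m 21 := by
    have h := Run.store (O := O) (N := cells n) (W := W) (.lit 0) (sc 7) (enc n s) hfits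
    rw [value_sc, h7] at h
    exact h hfits'
  have hm0 : m 0 = ((3 * D : ℕ) : ℤ) := by rw [hm, Function.update_self]
  have hm1 : ∀ i < width n, m (1 + i) = s 0 i := fun i hi => by
    rw [hm, Function.update_of_ne (by omega)]
    have := enc_addr (s := s) (a := 0) hi
    simpa using this
  have hbasis : outBasis b m = ratBasis b D B := by
    funext j
    rw [ratBasis, ← scaled_three, scaled_apply, outBasis]
    congr 1
    funext i
    rw [hm0, add_assoc, hm1 _ (mul_add_lt_width i.2 j.2), hB i j]
    rfl
  have hvec : outVector b m = comb b (fun i => (v i : ℝ)) := by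
    rw [outVector]
    congr 1
    funext i
    rw [add_assoc, hm1 _ (by unfold width; omega), hv i]
  refine ⟨m, t + 21, ?_, by omega, ?_, ?_⟩
  · rw [← enc_zero]
    exact .seq _ _ _ _ _ _ _ hrun hstore
  · rw [hm0]
    exact_mod_cast (by omega : 0 < 3 * D)
  · rw [hbasis, hvec]
    refine ⟨hout, hreach.dir, ?_, hv0, ?_⟩
    · rw [mem_lat_iff]
      exact ⟨v, rfl⟩
    · rw [hshort, hreach.minDist_eq S.body S.n_pos S.indep]

/-! ## Bounds -/

lemma le_three_pow_ceil (c : ℝ) : c ≤ 3 ^ ⌈c⌉₊ := by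
  refine (Nat.le_ceil c).trans ?_
  exact_mod_cast (Nat.lt_pow_self (by norm_num : 1 < 3)).le

/-- As c ≤ 3^⌈c⌉, the number of extensions is linear in n. -/
lemma pow_exponent_le {c : ℝ} (hc : 0 ≤ c) (k : ℕ) (h : (3 : ℝ) ^ k ≤ c ^ n) : k ≤ ⌈c⌉₊ * n := by
  have h1 : (3 : ℝ) ^ k ≤ 3 ^ (⌈c⌉₊ * n) := by
    rw [pow_mul]
    exact h.trans (pow_le_pow_left₀ hc (le_three_pow_ceil c) n)
  exact (pow_le_pow_iff_right₀ (by norm_num)).1 h1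

lemma coord_le_of_gauge_le {R : ℕ} (hK : IsSymmetricConvexBody K)
    (hR : ∀ w : Fin n → ℝ, comb b w ∈ K → ∀ i, |w i| ≤ R) {r : ℝ} (hr : 0 < r) {w : Fin n → ℝ}
    (hw : gauge K (comb b w) ≤ r) (i : Fin n) : |w i| ≤ r * R := by
  have h1 : comb b (r⁻¹ • w) ∈ K := by
    rw [← hK.gauge_le_one_iff, comb_eq_linearCombination, map_smul, hK.gauge_smul,
      abs_of_pos (inv_pos.2 hr), inv_mul_le_iff₀ hr, mul_one]
    exact hw
  have h2 := hR _ h1 i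
  rw [Pi.smul_apply, smul_eq_mul, abs_mul, abs_of_pos (inv_pos.2 hr), inv_mul_le_iff₀ hr] at h2
  exact h2

/-- Uses c ≤ 2^⌈c⌉ and R + 1 ≤ 2^(size of R); the bit length is then linear in n and in the size of
R, with constants depending on c. -/
lemma bits_lt {c : ℝ} (hc : 5 ≤ c) {R : ℕ} (hn : 0 < n)
    (hW : (2 * ⌈c⌉₊ + 6) * (n + Nat.size R) ≤ W) :
    9 * c ^ n * ((c + 1) * R + 3) < (2 : ℝ) ^ W := by
  have h1 : c ≤ 2 ^ ⌈c⌉₊ := (Nat.le_ceil c).trans (by exact_mod_cast Nat.lt_two_pow_self.le)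
  have h2 : ((R : ℝ) + 1) ≤ 2 ^ Nat.size R := by exact_mod_cast Nat.lt_size_self R
  calc 9 * c ^ n * ((c + 1) * R + 3) < 16 * c ^ n * (2 * c * (R + 1)) := by
        have hR : (0 : ℝ) ≤ R := Nat.cast_nonneg _
        have hp : 0 < c ^ n := by positivity
        have : (c + 1) * R + 3 ≤ 2 * c * (R + 1) := by nlinarith
        have h0 : 0 < (c + 1) * R + 3 := by positivity
        calc 9 * c ^ n * ((c + 1) * R + 3) < 16 * c ^ n * ((c + 1) * R + 3) := by
              gcongr; norm_num
          _ ≤ _ := by gcongr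
    _ ≤ 2 ^ 4 * (2 ^ ⌈c⌉₊) ^ n * (2 * 2 ^ ⌈c⌉₊ * 2 ^ Nat.size R) := by
        gcongr
        norm_num
    _ = 2 ^ (4 + ⌈c⌉₊ * n + (1 + ⌈c⌉₊ + Nat.size R)) := by
        rw [pow_add, pow_add, pow_add, pow_add, pow_one, pow_mul]
    _ ≤ 2 ^ W := by
        refine pow_le_pow_right₀ (by norm_num) (le_trans ?_ hW)
        have : ⌈c⌉₊ * 1 ≤ ⌈c⌉₊ * n := Nat.mul_le_mul_left _ hn
        have : 0 ≤ ⌈c⌉₊ * Nat.size R := Nat.zero_le _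
        nlinarith

lemma three_pow_lt (hW : 6 * n ≤ W) (hn : 0 < n) : ((3 ^ (n + 1) : ℕ) : ℤ) < 2 ^ W := by
  have h : 3 ^ (n + 1) < 2 ^ W := by
    calc 3 ^ (n + 1) < 4 ^ (n + 1) := Nat.pow_lt_pow_left (by norm_num) (by omega)
      _ = 2 ^ (2 * (n + 1)) := by rw [pow_mul]; norm_num
      _ ≤ 2 ^ W := Nat.pow_le_pow_right (by norm_num) (by omega)
  exact_mod_cast h

lemma cells_le (hn : 0 < n) : cells n ≤ 200 * n ^ 4 := by
  have h2 : n ^ 2 ≤ n ^ 4 := Nat.pow_le_pow_right hn (by norm_num)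
  have h1 : n ≤ n ^ 4 := Nat.le_self_pow (by norm_num) n
  have h0 : 1 ≤ n ^ 4 := Nat.one_le_pow _ _ hn
  unfold cells width
  rw [← sq]
  omega

lemma enumTime_le {x G : ℝ} (hx : (n : ℝ) = x) (hx1 : 1 ≤ x) (hG : 1 ≤ G) (hN : (N : ℝ) ≤ x * G) :
    (enumTime n N : ℝ) ≤ 600000 * x ^ 3 * G := by
  have hxG : 1 ≤ x * G := one_le_mul_of_one_le_of_one_le hx1 hG
  unfold enumTime
  push_cast
  rw [hx]
  calc 20000 * (x + 1) * (x + 6) * ((N : ℝ) + 1) ≤ 20000 * (2 * x) * (7 * x) * (2 * (x * G)) := by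
        gcongr <;> linarith
    _ = 560000 * (x ^ 3 * G) := by ring
    _ ≤ 600000 * (x ^ 3 * G) := by
        gcongr
        norm_num
    _ = _ := by ring

/-- Here x is the dimension, G bounds the nodes per level, P stands for 3^n and A for a constant. An
enumeration costs O(x³ G), and about A x P of them are made. -/
lemma densifyTime_le {x G P A : ℝ} {f₁ f₂ : ℕ} (hx : (n : ℝ) = x) (hx1 : 1 ≤ x) (hG : 1 ≤ G)
    (hP : 1 ≤ P) (hA : 1 ≤ A) (hN : (N : ℝ) ≤ x * G) (hf₁ : (f₁ : ℝ) ≤ A)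
    (hf₂ : (f₂ : ℝ) ≤ A * x * P) :
    ((densifyTime n N f₁ f₂ + 100 : ℕ) : ℝ) ≤ 2000000 * A * x ^ 4 * (P * G) := by
  have hE := enumTime_le hx hx1 hG hN
  have hx2 : x ≤ x ^ 2 := le_self_pow₀ hx1 (by norm_num)
  have hx3 : x ^ 2 ≤ x ^ 3 := pow_le_pow_right₀ hx1 (by norm_num)
  have hx4 : x ^ 3 ≤ x ^ 4 := pow_le_pow_right₀ hx1 (by norm_num)
  have hxG : x ^ 3 ≤ x ^ 3 * G := le_mul_of_one_le_right (by positivity) hG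
  have hPG : 1 ≤ P * G := one_le_mul_of_one_le_of_one_le hP hG
  have h1 : ((enumTime n N : ℝ) + 2000 * (x + 1)) * f₁ ≤ 700000 * (A * x ^ 4 * (P * G)) := by
    calc _ ≤ (700000 * x ^ 3 * G) * A := by gcongr; linarith
      _ = 700000 * (A * x ^ 3 * (1 * G)) := by ring
      _ ≤ _ := by gcongr
  have h2 : ((enumTime n N : ℝ) + 20000 * (x + 1) * (x + 1)) * f₂ ≤
      700000 * (A * x ^ 4 * (P * G)) := by
    calc _ ≤ (700000 * x ^ 3 * G) * (A * x * P) := by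
          gcongr
          nlinarith
      _ = _ := by ring
  have h3 : 4000 * (x + 1) * (x + 1) + 3000 * (x + 1) + 500 + 100 ≤
      600000 * (A * x ^ 4 * (P * G)) := by
    have h4 : 1 * x ^ 4 * 1 ≤ A * x ^ 4 * (P * G) := by gcongr
    nlinarith
  unfold densifyTime
  push_cast
  rw [hx]
  linarith

/-- Since 2c³ exceeds e, the logarithm of (2c³)^n is at least n, so four logarithmic factors absorb
n^4. -/
lemma le_softO {C : ℕ} {c X : ℝ} (hc : 5 ≤ c) (hX : X ≤ C * n ^ 4 * (2 * c ^ 3) ^ n) :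
    X ≤ softO C 4 ((2 * c ^ 3) ^ n) := by
  have h3 : (5 : ℝ) ^ 3 ≤ c ^ 3 := by gcongr
  have hlog : 1 ≤ Real.log (2 * c ^ 3) := by
    rw [Real.le_log_iff_exp_le (by positivity)]
    have := Real.exp_one_lt_three
    linarith
  have hn : (n : ℝ) ≤ Real.log ((2 * c ^ 3) ^ n) := by
    rw [Real.log_pow]
    exact le_mul_of_one_le_right (Nat.cast_nonneg _) hlog
  refine hX.trans ?_
  unfold softO
  calc (C : ℝ) * n ^ 4 * (2 * c ^ 3) ^ n = C * (2 * c ^ 3) ^ n * n ^ 4 := by ring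
    _ ≤ _ := by gcongr

end ThinLattice

/-! ### The theorem: choice of the constants -/

open ThinLattice in
theorem mainTheorem5 :
    ∃ prog : Prog, ∀ c : ℝ, 5 ≤ c → ∃ C k : ℕ,
      ∀ n : ℕ, 0 < n → ∀ (K : Set (E n)) (b bM : Fin n → E n),
        IsSymmetricConvexBody K → IsMLattice K c b → IsPackingLattice K c b bM →
        -- every outcome of the densification of `M = lat bM` has the claimed properties
        (∀ Λ : Submodule ℤ (E n), IsRogersOutput K (lat bM) Λ →
          lat bM ≤ Λ ∧
          minDist K (lat bM) = minDist K Λ ∧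
          covRadius K Λ ≤ 3 / 2 * minDist K Λ ∧
          3 / 2 * minDist K Λ ≤ 3 * c / 2 ∧
          0 < index Λ (lat bM) ∧ (index Λ (lat bM) : ℝ) ≤ c ^ n ∧
          IsCovering K ((2 / (3 * minDist K Λ)) • Λ) ∧
          IsThin K ((2 / (3 * minDist K Λ)) • Λ) (3 ^ n) ∧
          ∀ bΛ : Fin n → E n, IsDirectionalBasis bΛ Λ bM →
            IsSE K (fun i => (2 / (3 * minDist K Λ)) • bΛ i) (softO C k ((2 * c ^ 3) ^ n))) ∧
        -- such an outcome is computed by the program within the claimed time and space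
        (∀ (O : Query n → Option ℤ) (R : ℕ), IsOracle K bM O →
          (∀ w : Fin n → ℝ, comb bM w ∈ K → ∀ i, |w i| ≤ R) →
          ∃ (m : Mem) (t : ℕ),
            Run O (C * n ^ k) (C * (n + Nat.size R) ^ k) prog (initMem n) m t ∧
            (t : ℝ) ≤ softO C k ((2 * c ^ 3) ^ n) ∧
            0 < m 0 ∧
            IsRogersOutput K (lat bM) (lat (outBasis bM m)) ∧
            IsDirectionalBasis (outBasis bM m) (lat (outBasis bM m)) bM ∧
            outVector bM m ∈ lat bM ∧ outVector bM m ≠ 0 ∧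
            gauge K (outVector bM m) = minDist K (lat (outBasis bM m))) := by
  refine ⟨densifyP, fun c hc => ?_⟩
  -- A bounds the number of radii tried for the shortest vector, and A n the number of passes over
  -- the classes. The exponent 4 is that of n in `densifyTime_le`, whose numerical factor also
  -- suffices for cells and bits.
  obtain ⟨A, hA⟩ : ∃ A, A = ⌈c⌉₊ + 1 := ⟨_, rfl⟩
  refine ⟨2000000 * A, 4, fun n hn K b bM hK hL hP => ⟨fun Λ hΛ => ?_, fun O R hO hR => ?_⟩⟩
  · obtain ⟨h1, h2, h3, h4, h5, h6, h7, h8, h9⟩ := rogersOutput_properties hn hc hK hP hΛ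
    refine ⟨h1, h2, h3, h4, h5, h6, h7, h8, fun bΛ hb i t => ⟨(h9 bΛ hb i t).1, ?_⟩⟩
    refine (h9 bΛ hb i t).2.trans (le_softO hc ?_)
    have hx : (1 : ℝ) ≤ n := by exact_mod_cast hn
    have hA1 : (1 : ℝ) ≤ A := by rw [hA]; push_cast; linarith [(Nat.cast_nonneg ⌈c⌉₊ : (0 : ℝ) ≤ _)]
    have hC : (1 : ℝ) ≤ ((2000000 * A : ℕ) : ℝ) * n ^ 4 := by
      refine one_le_mul_of_one_le_of_one_le ?_ (one_le_pow₀ hx)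
      push_cast
      linarith
    exact le_mul_of_one_le_left (by positivity) hC
  · have hM := hP.directional.linearIndependent
    have hpow : n + Nat.size R ≤ (n + Nat.size R) ^ 4 := Nat.le_self_pow (by norm_num) _
    have hW : (2 * ⌈c⌉₊ + 6) * (n + Nat.size R) ≤ 2000000 * A * (n + Nat.size R) ^ 4 :=
      Nat.mul_le_mul (by rw [hA]; linarith) hpow
    have hceil := Nat.le_ceil c
    have S : Setup (2000000 * A * (n + Nat.size R) ^ 4) K bM O c ((c + 1) * R)
        (n * ⌊(2 * c ^ 2) ^ n⌋₊) :=
      { n_pos := hn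
        lt_W := three_pow_lt (le_trans (Nat.mul_le_mul (by linarith) (Nat.le_add_right _ _)) hW) hn
        body := hK
        oracle := hO
        indep := hM
        se := hP.se
        one_le := hP.one_le_minDist
        le_c := hP.minDist_le
        five_le := hc
        index_le := fun b' hb' hle hmin => index_le_div_pow hn hK hL hP hb' hle hmin
        R_nonneg := by positivity
        coord_le := fun w hw i => coord_le_of_gauge_le hK hR (by linarith) hw i
        bits := bits_lt hc hn hW
        count := le_rfl }
    obtain ⟨m, t, hrun, ht, h⟩ := exists_run S (κ := ⌈c⌉₊ * n) fun k hk =>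
      pow_exponent_le (by linarith) k hk
    refine ⟨m, t, hrun.mono ?_ le_rfl, le_softO hc ?_, h⟩
    · refine (cells_le hn).trans (Nat.mul_le_mul_right _ ?_)
      rw [hA]
      linarith
    · have hx : (1 : ℝ) ≤ n := by exact_mod_cast hn
      have hA1 : (1 : ℝ) ≤ A := by
        rw [hA]; push_cast; linarith [(Nat.cast_nonneg ⌈c⌉₊ : (0 : ℝ) ≤ _)]
      have hG : (1 : ℝ) ≤ (2 * c ^ 2) ^ n := one_le_pow₀ (by nlinarith)
      have hP3 : (1 : ℝ) ≤ 3 ^ n := one_le_pow₀ (by norm_num)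
      have key := densifyTime_le (n := n) (N := n * ⌊(2 * c ^ 2) ^ n⌋₊) (f₁ := ⌊c⌋₊ + 1)
        (f₂ := ⌈c⌉₊ * n * 3 ^ n + 3 ^ n) rfl hx hG hP3 hA1 ?_ ?_ ?_
      · have ht' : (t : ℝ) ≤ ((densifyTime n (n * ⌊(2 * c ^ 2) ^ n⌋₊) (⌊c⌋₊ + 1)
            (⌈c⌉₊ * n * 3 ^ n + 3 ^ n) + 100 : ℕ) : ℝ) := by exact_mod_cast ht
        refine ht'.trans (key.trans ?_)
        push_cast
        rw [← mul_pow]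
        -- The 3^n classes and (2c²)^n nodes multiply to (6c²)^n, and 6c² ≤ 2c³ because c ≥ 3.
        refine mul_le_mul_of_nonneg_left (pow_le_pow_left₀ (by positivity) ?_ n) (by positivity)
        nlinarith [mul_nonneg (sq_nonneg c) (by linarith : 0 ≤ c - 3)]
      · push_cast
        gcongr
        exact Nat.floor_le (by positivity)
      · have hfl : ⌊c⌋₊ + 1 ≤ A := by
          rw [hA]
          exact Nat.add_le_add_right (Nat.floor_le_ceil c) 1
        exact_mod_cast hfl
      · rw [hA]
        push_cast
        nlinarith
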